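/- Let $k,j\ge 1$ be integers and $0<\mu_1<\mu_0-\mu_1$. On the circle $\mathbb R/\mu_0\mathbb Z$ let $K$ be the Hermitian bundle equal to $\mathbb C^{k+j}$ over $(-\mu_1,\mu_1)$ (large side) and $\mathbb C^{k}$ over $(\mu_1,\mu_0-\mu_1)$ (small side), glued at $\pm\mu_1$ by isometric injections $\iota_\pm:\mathbb C^k\to\mathbb C^{k+j}$ with adjoints $\pi_\pm=\iota_\pm^*$. Let $T_0,\dots,T_3$ be smooth skew-adjoint endomorphisms of $K$ over the two open intervals solving Nahm's equations $$\frac{dT_{\sigma(1)}}{dz}+[T_0,T_{\sigma(1)}]=[T_{\sigma(2)},T_{\sigma(3)}],\qquad \sigma \text{ an even permutation of } (123),$$ with the following boundary conditions at each of the points $c=\pm\mu_1$. From the small side the $T_i$, $i=0,\dots,3$, have limits. On the large side near $c$ there is a unitary frame $U(z)$ with $U'+T_0U=0$ and $U(z)\to 1$ as $z\to c$ (a gauge in which $T_0=0$) such that, relative to $\mathbb C^{k+j}=\operatorname{im}\iota\oplus\ker\pi$, for $i=1,2,3$, $$U^{*}T_iU=\begin{pmatrix}\hat T_i& O(|z-c|^{(j-1)/2})\\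 O(|z-c|^{(j-1)/2})&R_i\end{pmatrix},$$ where $\hat T_i$ tends to the limit of $T_i$ from the small side, $R_i=\rho_i/(z-c)+O(1)$, and the residues $\rho_1,\rho_2,\rho_3$ form an irreducible representation of $su(2)$ on $\ker\pi$, i.e. $[\rho_i,\rho_{i+1}]=-\rho_{i+2}$ (indices mod 3) and there is no proper nonzero invariant subspace. Assume irreducibility: there is no nonzero covariant constant section $s$ of $K$ ($s'+T_0s=0$, values corresponding under $\iota_\pm$, allowed to close up around the circle only up to a phase) whose line is invariant under $T_1,T_2,T_3$. Fix $(x_0,x_1,x_2,x_3)\in\mathbb R^4$ and put $\alpha=T_0-iT_3$, $\beta=T_1+iT_2$, $w=x_1+ix_2$, $y=\mu_0x_0-ix_3$, $$D_1v=\bigl(i(\tfrac{d}{dz}+\alpha-iy)v,\ (-\beta+iw)v\bigr),$$ and let $D_1^*$ be the formal adjoint of $D_1$. By a solution on the circle of $D_1^*D_1v=\delta_xu$ we mean a continuous section $v$ of $K$ (so $v_{\rm large}=\iota(v_{\rm small})$ at $\pm\mu_1$) whose covariant derivative $(\frac d{dz}+T_0)v$ has limits from both sides at $\pm\mu_1$,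 the limit from the large side being mapped by $\pi$ to that from the small side, and which satisfies the equation in the sense of distributions on each of the two open intervals. Then: 1. For every $x\in(-\mu_1,\mu_1)$ and $u\in\mathbb C^{k+j}$ there is a unique solution on the circle of $D_1^*D_1v=\delta_xu$. 2. For every $x\in(\mu_1,\mu_0-\mu_1)$ and $u\in\mathbb C^{k}$ there is a unique solution on the circle of $D_1^*D_1v=\delta_xu$. 3. For every $x\in(\mu_1,\mu_0-\mu_1)$ and $u,u_+,u_-\in\mathbb C^{k}$ there is a unique continuous $v$ on $[\mu_1,\mu_0-\mu_1]$ with $D_1^*D_1v=\delta_xu$ on the open interval, $v(\mu_1)=u_+$ and $v(\mu_0-\mu_1)=u_-$. 4. There is a constant $C$, depending only on the Nahm data and $(x_0,\dots,x_3)$ and not on $x$ or $u$, such that the solutions $v$ in 1 and 2 satisfy $\|v\|_{L^\infty}\le C|u|$. -/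

import Mathlib

open Set Filter Topology Asymptotics
open scoped ContDiff

noncomputable section

/-- The Hermitian space `ℂⁿ`. -/
abbrev Vn (n : ℕ) : Type := EuclideanSpace ℂ (Fin n)

/-- Complex `n × n` matrices, as operators on the Hermitian space `ℂⁿ`. -/
abbrev Mn (n : ℕ) : Type := Vn n →L[ℂ] Vn n

/-- `T 0, …, T 3` are smooth and skew-adjoint on the open interval `(a, b)` and solve
`dT_σ(1)/dz + [T_0, T_σ(1)] = [T_σ(2), T_σ(3)]`, `σ` an even (cyclic) permutation of `(123)`. -/
structure NahmOn {n : ℕ} (T : Fin 4 → ℝ → Mn n) (a b : ℝ) : Prop where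
  smooth : ∀ i, ContDiffOn ℝ ∞ (T i) (Ioo a b)
  skew : ∀ i, ∀ z ∈ Ioo a b, ContinuousLinearMap.adjoint (T i z) = -T i z
  nahm : ∀ i : Fin 3, ∀ z ∈ Ioo a b,
    deriv (T i.succ) z + ⁅T 0 z, T i.succ z⁆ = ⁅T (i + 1).succ z, T (i + 2).succ z⁆

/-- The matrices of a pair of Nahm data (`TL` on the large side, of size `k + j`; `TS` on the
small side, of size `k`), and the isometric injections of the small fibre into the large fibre
at the two points `μ₁` (`ιp`) and `-μ₁` (`ιm`) where the rank of the bundle `K` jumps. -/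
structure NahmData (k j : ℕ) where
  TL : Fin 4 → ℝ → Mn (k + j)
  TS : Fin 4 → ℝ → Mn k
  ιp : Vn k →ₗᵢ[ℂ] Vn (k + j)
  ιm : Vn k →ₗᵢ[ℂ] Vn (k + j)

/-- The injection `ι`, as a continuous linear map. -/
def inj {k m : ℕ} (ι : Vn k →ₗᵢ[ℂ] Vn m) : Vn k →L[ℂ] Vn m := ι.toContinuousLinearMap

/-- The surjection `π` from the large fibre to the small one: the adjoint of `ι`, so that
`π ∘ ι = 1` and the decomposition `im ι ⊕ ker π` of the large fibre is orthogonal. -/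
def surj {k m : ℕ} (ι : Vn k →ₗᵢ[ℂ] Vn m) : Vn m →L[ℂ] Vn k :=
  ContinuousLinearMap.adjoint (inj ι)

/-- The orthogonal projection `1 - ι π` of the large fibre onto `ker π = (im ι)ᗮ`. -/
def projQ {k m : ℕ} (ι : Vn k →ₗᵢ[ℂ] Vn m) : Mn m := 1 - (inj ι).comp (surj ι)

/-- The endomorphisms `ρ 0, ρ 1, ρ 2` act on `ker π` (they vanish on `im ι` and have values in
`ker π`) by an irreducible representation of `su(2)`: `-ρ` satisfies `[e_i, e_{i+1}] = e_{i+2}`,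
and `ker π` has no invariant subspaces except `0` and itself. -/
structure IsIrredSU2 {k m : ℕ} (ι : Vn k →ₗᵢ[ℂ] Vn m) (ρ : Fin 3 → Mn m) : Prop where
  supp : ∀ i, projQ ι * ρ i * projQ ι = ρ i
  bracket : ∀ i : Fin 3, ⁅ρ i, ρ (i + 1)⁆ = -ρ (i + 2)
  irred : ∀ S : Submodule ℂ (Vn m), S ≤ LinearMap.ker (surj ι).toLinearMap →
    (∀ i, ∀ v ∈ S, ρ i v ∈ S) → S = ⊥ ∨ S = LinearMap.ker (surj ι).toLinearMap

/-- The boundary condition for `j > 0` on the large side of a jump point `c`; `l` is the filter of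
one-sided neighbourhoods of `c` inside the large interval and `Tlim` are the limits of the `T_i`
from the small side. `U` is a unitary frame with `U(c) = 1` which is parallel for `d/dz + T 0`, i.e.
a gauge in which `T 0` becomes `0` and the fibre at `c` is not changed. In this gauge, relative to
`im ι ⊕ ker π`, the `im ι` blocks of `T_1, T_2, T_3` tend to the limits from the small side, the
off-diagonal blocks are `O(|z - c|^((j-1)/2))`, and the `ker π` blocks have simple poles whose
residues `ρ` form an irreducible representation of `su(2)`. -/
def LargeSideBC {k : ℕ} (j : ℕ) (T : Fin 4 → ℝ → Mn (k + j)) (ι : Vn k →ₗᵢ[ℂ] Vn (k + j))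
    (Tlim : Fin 3 → Mn k) (c : ℝ) (l : Filter ℝ) : Prop :=
  ∃ (U : ℝ → Mn (k + j)) (ρ : Fin 3 → Mn (k + j)),
    (∀ᶠ z in l, U z ∈ unitary (Mn (k + j)) ∧ HasDerivAt U (-(T 0 z * U z)) z) ∧
    Tendsto U l (𝓝 1) ∧
    IsIrredSU2 ι ρ ∧
    ∀ i : Fin 3,
      Tendsto (fun z => (surj ι).comp ((star (U z) * T i.succ z * U z).comp (inj ι))) l
        (𝓝 (Tlim i)) ∧
      (fun z => (surj ι).comp ((star (U z) * T i.succ z * U z).comp (projQ ι)))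
        =O[l] (fun z => |z - c| ^ (((j : ℝ) - 1) / 2)) ∧
      (fun z => (projQ ι).comp ((star (U z) * T i.succ z * U z).comp (inj ι)))
        =O[l] (fun z => |z - c| ^ (((j : ℝ) - 1) / 2)) ∧
      (fun z => projQ ι * (star (U z) * T i.succ z * U z) * projQ ι - (z - c)⁻¹ • ρ i)
        =O[l] (fun _ => (1 : ℝ))

/-- Solutions of Nahm's equations on the circle `ℝ / μ₀ ℤ`, of rank `k + j` on `(-μ₁, μ₁)` and of
rank `k` on `(μ₁, μ₀ - μ₁)`, with the boundary conditions of the case `j > 0` at `± μ₁`. -/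
structure IsNahmSolution {k j : ℕ} (μ₀ μ₁ : ℝ) (N : NahmData k j) : Prop where
  large : NahmOn N.TL (-μ₁) μ₁
  small : NahmOn N.TS μ₁ (μ₀ - μ₁)
  small_limits : ∀ i, ContinuousOn (N.TS i) (Icc μ₁ (μ₀ - μ₁))
  bc_plus : LargeSideBC j N.TL N.ιp (fun i => N.TS i.succ μ₁) μ₁ (𝓝[<] μ₁)
  bc_minus : LargeSideBC j N.TL N.ιm (fun i => N.TS i.succ (μ₀ - μ₁)) (-μ₁) (𝓝[>] (-μ₁))

/-- `s` is covariant constant on the interval and spans a line invariant under `T_1, T_2, T_3`. -/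
structure IsInvariantParallel {n : ℕ} (T : Fin 4 → ℝ → Mn n) (a b : ℝ) (s : ℝ → Vn n) : Prop where
  cont : ContinuousOn s (Icc a b)
  parallel : ∀ z ∈ Ioo a b, HasDerivAt s (-(T 0 z (s z))) z
  invariant : ∀ i : Fin 3, ∀ z ∈ Ioo a b, ∃ c : ℂ, T i.succ z (s z) = c • s z

/-- Irreducibility: there is no nonzero covariant constant section of `K` which is left invariant
(up to scalars) by the `T_i`. The section may close up around the circle up to a phase `c`. -/
def IsIrreducibleNahm {k j : ℕ} (μ₀ μ₁ : ℝ) (N : NahmData k j) : Prop :=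
  ∀ (c : ℂ) (sL : ℝ → Vn (k + j)) (sS : ℝ → Vn k), ‖c‖ = 1 →
    IsInvariantParallel N.TL (-μ₁) μ₁ sL → IsInvariantParallel N.TS μ₁ (μ₀ - μ₁) sS →
    sL μ₁ = N.ιp (sS μ₁) → sL (-μ₁) = c • N.ιm (sS (μ₀ - μ₁)) →
    (∀ z ∈ Icc (-μ₁) μ₁, sL z = 0) ∧ (∀ z ∈ Icc μ₁ (μ₀ - μ₁), sS z = 0)

/-- The zeroth-order term `α - i y` of `D₁`, where `α = T_0 - i T_3` and `y = μ₀ x_0 - i x_3`. -/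
def coeffA {n : ℕ} (μ₀ : ℝ) (T : Fin 4 → ℝ → Mn n) (x : Fin 4 → ℝ) (z : ℝ) : Mn n :=
  (T 0 z - Complex.I • T 3 z)
    - (Complex.I * ((μ₀ * x 0 : ℝ) - Complex.I * (x 3 : ℝ)) : ℂ) • (1 : Mn n)

/-- The term `-β + i w` of `D₁`, where `β = T_1 + i T_2` and `w = x_1 + i x_2`. -/
def coeffB {n : ℕ} (T : Fin 4 → ℝ → Mn n) (x : Fin 4 → ℝ) (z : ℝ) : Mn n :=
  -(T 1 z + Complex.I • T 2 z)
    + (Complex.I * ((x 1 : ℝ) + Complex.I * (x 2 : ℝ)) : ℂ) • (1 : Mn n)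

/-- `D₁ v = (i (d/dz + α - i y) v, (-β + i w) v)`. -/
def opD1 {n : ℕ} (μ₀ : ℝ) (T : Fin 4 → ℝ → Mn n) (x : Fin 4 → ℝ) (v : ℝ → Vn n) :
    ℝ → Vn n × Vn n :=
  fun z => (Complex.I • (deriv v z + coeffA μ₀ T x z (v z)), coeffB T x z (v z))

/-- The formal adjoint of `D₁`:
`D₁* (s₁, s₂) = i (d/dz - (α - i y)*) s₁ + (-β + i w)* s₂`. -/
def opD1Star {n : ℕ} (μ₀ : ℝ) (T : Fin 4 → ℝ → Mn n) (x : Fin 4 → ℝ) (s : ℝ → Vn n × Vn n) :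
    ℝ → Vn n :=
  fun z =>
    Complex.I • (deriv (fun t => (s t).1) z
        - ContinuousLinearMap.adjoint (coeffA μ₀ T x z) (s z).1)
      + ContinuousLinearMap.adjoint (coeffB T x z) (s z).2

/-- Smooth test functions with compact support in the open interval `(a, b)`. -/
structure IsTest {n : ℕ} (a b : ℝ) (φ : ℝ → Vn n) : Prop where
  smooth : ContDiff ℝ ∞ φ
  compact : HasCompactSupport φ
  supp : tsupport φ ⊆ Ioo a b

/-- The vector-valued distribution `δ_p u`, as a functional on test functions. -/
def diracAt {n : ℕ} (p : ℝ) (u : Vn n) : (ℝ → Vn n) → ℂ := fun φ => inner ℂ (φ p) u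

/-- The zero distribution. -/
def zeroDistr {n : ℕ} : (ℝ → Vn n) → ℂ := fun _ => 0

/-- `D₁* D₁ v = F` in the sense of distributions on the open interval `(a, b)`. -/
def WeakEq {n : ℕ} (μ₀ : ℝ) (T : Fin 4 → ℝ → Mn n) (x : Fin 4 → ℝ) (a b : ℝ)
    (v : ℝ → Vn n) (F : (ℝ → Vn n) → ℂ) : Prop :=
  ∀ φ : ℝ → Vn n, IsTest a b φ →
    ∫ z in a..b, inner ℂ (opD1Star μ₀ T x (opD1 μ₀ T x φ) z) (v z) = F φ

/-- The covariant derivative `(d/dz + T_0) v`. -/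
def covDeriv {n : ℕ} (T : Fin 4 → ℝ → Mn n) (v : ℝ → Vn n) : ℝ → Vn n :=
  fun z => deriv v z + T 0 z (v z)

/-- `(vL, vS)` is a solution on the circle of `D₁* D₁ v = F`, where the distribution `F` is given by
`FL` on `(-μ₁, μ₁)` and by `FS` on `(μ₁, μ₀ - μ₁)`: a continuous section of `K` (large and small
values correspond under `ι` at the jump points) with limits of the covariant derivative at the jump
points that correspond under `π`, which solves the equation over each of the two intervals.
The point `μ₀ - μ₁` is the point `-μ₁` of the circle. -/
structure SolvesOnCircle {k j : ℕ} (μ₀ μ₁ : ℝ) (N : NahmData k j) (x : Fin 4 → ℝ)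
    (FL : (ℝ → Vn (k + j)) → ℂ) (FS : (ℝ → Vn k) → ℂ)
    (vL : ℝ → Vn (k + j)) (vS : ℝ → Vn k) : Prop where
  contL : ContinuousOn vL (Icc (-μ₁) μ₁)
  contS : ContinuousOn vS (Icc μ₁ (μ₀ - μ₁))
  glue_plus : vL μ₁ = N.ιp (vS μ₁)
  glue_minus : vL (-μ₁) = N.ιm (vS (μ₀ - μ₁))
  dglue_plus : ∃ d : Vn (k + j), Tendsto (covDeriv N.TL vL) (𝓝[<] μ₁) (𝓝 d) ∧
    Tendsto (covDeriv N.TS vS) (𝓝[>] μ₁) (𝓝 (surj N.ιp d))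
  dglue_minus : ∃ d : Vn (k + j), Tendsto (covDeriv N.TL vL) (𝓝[>] (-μ₁)) (𝓝 d) ∧
    Tendsto (covDeriv N.TS vS) (𝓝[<] (μ₀ - μ₁)) (𝓝 (surj N.ιm d))
  eqL : WeakEq μ₀ N.TL x (-μ₁) μ₁ vL FL
  eqS : WeakEq μ₀ N.TS x μ₁ (μ₀ - μ₁) vS FS

/-- `v` is continuous on `[a, b]`, has the values `ua` at `a` and `ub` at `b`, and solves
`D₁* D₁ v = F` on `(a, b)`. -/
structure SolvesOnInterval {n : ℕ} (μ₀ : ℝ) (T : Fin 4 → ℝ → Mn n) (x : Fin 4 → ℝ) (a b : ℝ)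
    (ua ub : Vn n) (F : (ℝ → Vn n) → ℂ) (v : ℝ → Vn n) : Prop where
  cont : ContinuousOn v (Icc a b)
  left_value : v a = ua
  right_value : v b = ub
  eqn : WeakEq μ₀ T x a b v F

end

/-! Nahm's equations turn `D₁* D₁` into `-(d/dz + P)² + ∑ Sᵢ* Sᵢ` with `P = T₀ - i μ₀ x₀`
skew-adjoint and `Sᵢ = Tᵢ - i xᵢ` (`NahmOn.opD1Star_opD1`). For a solution `v` with covariant
derivative `η`, the flux `Re ⟨v, η⟩` is half the derivative of `‖v‖²`, and its own derivative is
`‖η‖² + ∑ ‖Sᵢ v‖² ≥ 0`. This positivity drives everything.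

Uniqueness: at a jump point `v` has its limit in `im ι`, so the flux sees only the `π`-part of the
derivative and passes continuously through the gluing. On a circle a monotone continuous flux is
constant, hence `η = 0` and `Sᵢ v = 0`, and irreducibility forces `v = 0`
(`GluedSystem.Admissible.eq_zero`).

Existence: on the space of continuous piecewise solutions having limits at the ends, the map "jumps
of the derivative" is injective by uniqueness, and the map "values at the pole and at the gluing
points" is surjective onto a space of the same dimension. So the first map is onto as well
(`surjective_of_injective_of_surjective`, used in `GluedSystem.Admissible.exists_smooth`), and the
dimension of the solution space need not be known.

The analytic core is the surjectivity at a pole of the `Tᵢ`: every limit in `im ι` must be attained.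
By `LargeSideBC.singularEnd` the potential is `λ s⁻²` on `ker π` up to `O(s⁻¹)`, where `λ ≥ 0` is
minus the Casimir scalar of the residues, and `O(s^(-1/2))` on `im ι`. Dirichlet solutions on `[ε,
z₀]` converge along a subsequence as `ε → 0`, and a convexity estimate shows that the limit
approaches `ι w` at the rate `s^(1/2)` (`ODESystem.Regular.exists_sol_close`). With this rate the
equation becomes `W'' = λ s⁻² W + O(s^(-1/2))` on `ker π`, and the derivative has a limit
(`ODESystem.Regular.tendsto_of_close`).

The uniform bound: Green's identity against fixed sections bounds the value at one gluing point by
the size of `u` (`GluedSystem.Admissible.exists_bound_at`). The flux is monotone around the circle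
up to jumps of size at most `sup ‖v‖ · |u|`, so `‖v‖²` oscillates by at most a constant times that
(`GluedSystem.IsTransmission.normSq_le`). The resulting quadratic inequality bounds `sup ‖v‖`.

Distributional solutions are reduced to classical ones by du Bois-Reymond's lemma. -/

noncomputable section

/-! ### Linear ordinary differential equations on intervals. -/

section LinearODE

variable {F : Type*} [NormedAddCommGroup F] [NormedSpace ℝ F]

/-- Uniqueness for linear ordinary differential equations on an open interval. -/
theorem eqOn_of_linearODE {A : ℝ → F →L[ℝ] F} {a b t₀ : ℝ} (hA : ContinuousOn A (Ioo a b))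
    {f g : ℝ → F} (ht₀ : t₀ ∈ Ioo a b) (hf : ∀ t ∈ Ioo a b, HasDerivAt f (A t (f t)) t)
    (hg : ∀ t ∈ Ioo a b, HasDerivAt g (A t (g t)) t) (h₀ : f t₀ = g t₀) :
    EqOn f g (Ioo a b) := by
  intro t ht
  obtain ⟨c, hc, hc'⟩ := exists_between (lt_min ht₀.1 ht.1)
  obtain ⟨d, hd, hd'⟩ := exists_between (max_lt ht₀.2 ht.2)
  rw [lt_min_iff] at hc'
  rw [max_lt_iff] at hd
  have hsub : Icc c d ⊆ Ioo a b := Icc_subset_Ioo hc hd'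
  obtain ⟨K, hK⟩ := isCompact_Icc.exists_bound_of_continuousOn (hA.mono hsub)
  have hsub' : Ioo c d ⊆ Ioo a b := Ioo_subset_Icc_self.trans hsub
  refine ODE_solution_unique_of_mem_Ioo (v := fun t x => A t x) (s := fun _ => univ)
    (K := K.toNNReal) (fun s hs => ?_) ⟨hc'.1, hd.1⟩ (fun s hs => ⟨hf s (hsub' hs), trivial⟩)
    (fun s hs => ⟨hg s (hsub' hs), trivial⟩) h₀ ⟨hc'.2, hd.2⟩
  refine ((A s).lipschitz.weaken ?_).lipschitzOnWith
  rw [← NNReal.coe_le_coe, Real.coe_toNNReal']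
  exact (hK s (Ioo_subset_Icc_self hs)).trans (le_max_left _ _)

/-- A cutoff function: it is `1` for `r ≤ R` and vanishes for `r ≥ 2 R`. -/
def radialCutoff (R r : ℝ) : ℝ := max 0 (min 1 (2 - r / R))

theorem radialCutoff_nonneg (R r : ℝ) : 0 ≤ radialCutoff R r := le_max_left _ _

theorem radialCutoff_le_one (R r : ℝ) : radialCutoff R r ≤ 1 :=
  max_le zero_le_one (min_le_left _ _)

theorem radialCutoff_eq_one {R r : ℝ} (hR : 0 < R) (hr : r ≤ R) : radialCutoff R r = 1 := by
  have : r / R ≤ 1 := (div_le_one hR).2 hr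
  rw [radialCutoff, min_eq_left (by linarith), max_eq_right zero_le_one]

theorem radialCutoff_mul_le {R r : ℝ} (hR : 0 < R) (hr : 0 ≤ r) :
    radialCutoff R r * r ≤ 2 * R := by
  rcases le_total r (2 * R) with h | h
  · exact (mul_le_of_le_one_left hr (radialCutoff_le_one _ _)).trans h
  · have : 2 ≤ r / R := (le_div_iff₀ hR).2 h
    have h0 : radialCutoff R r = 0 :=
      max_eq_left ((min_le_right _ _).trans (by linarith))
    rw [h0, zero_mul]
    positivity

theorem abs_radialCutoff_sub_le {R : ℝ} (hR : 0 < R) (r s : ℝ) :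
    |radialCutoff R r - radialCutoff R s| ≤ |r - s| / R := by
  have h1 : |radialCutoff R r - radialCutoff R s|
      ≤ |min 1 (2 - r / R) - min 1 (2 - s / R)| := by
    have := abs_max_sub_max_le_max 0 (min 1 (2 - r / R)) 0 (min 1 (2 - s / R))
    simpa [radialCutoff] using this
  have h2 : |min 1 (2 - r / R) - min 1 (2 - s / R)| ≤ |(2 - r / R) - (2 - s / R)| := by
    have := abs_min_sub_min_le_max 1 (2 - r / R) 1 (2 - s / R)
    simpa using this
  refine h1.trans (h2.trans_eq ?_)
  rw [show (2 - r / R) - (2 - s / R) = (s - r) / R by ring, abs_div, abs_of_pos hR, abs_sub_comm]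

variable [CompleteSpace F]

/-- A linear ordinary differential equation is solvable on a compact interval. -/
theorem exists_linearODE_Icc {A : ℝ → F →L[ℝ] F} {c d t₀ : ℝ} (hA : ContinuousOn A (Icc c d))
    (ht₀ : t₀ ∈ Icc c d) (x₀ : F) :
    ∃ f : ℝ → F, f t₀ = x₀ ∧ ∀ t ∈ Ioo c d, HasDerivAt f (A t (f t)) t := by
  obtain ⟨K₀, hK₀⟩ := isCompact_Icc.exists_bound_of_continuousOn hA
  set K : ℝ := max K₀ 0
  have hK : ∀ t ∈ Icc c d, ‖A t‖ ≤ K := fun t ht => (hK₀ t ht).trans (le_max_left _ _)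
  have hK0 : 0 ≤ K := le_max_right _ _
  have hcd : c ≤ d := ht₀.1.trans ht₀.2
  -- The Grönwall bound for a solution on the whole interval; the `+ 1` makes it positive even when
  -- `x₀ = 0`.
  set R : ℝ := ‖x₀‖ * Real.exp (K * (d - c)) + 1
  have hR : 0 < R := by positivity
  -- Truncating the linear field at radius `R` makes it globally bounded, so Picard–Lindelöf covers
  -- all of `[c, d]` at once. By Grönwall the solution never leaves the ball where the truncation is
  -- inactive.
  set w : ℝ → F → F := fun t x => A t (radialCutoff R ‖x‖ • x) with hw
  have hwle : ∀ t ∈ Icc c d, ∀ x, ‖w t x‖ ≤ K * ‖x‖ := fun t ht x => by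
    refine ((A t).le_opNorm _).trans (mul_le_mul (hK t ht) ?_ (norm_nonneg _) hK0)
    rw [norm_smul, Real.norm_of_nonneg (radialCutoff_nonneg _ _)]
    exact mul_le_of_le_one_left (norm_nonneg _) (radialCutoff_le_one _ _)
  have hwle' : ∀ t ∈ Icc c d, ∀ x, ‖w t x‖ ≤ K * (2 * R) := fun t ht x => by
    refine ((A t).le_opNorm _).trans (mul_le_mul (hK t ht) ?_ (norm_nonneg _) hK0)
    rw [norm_smul, Real.norm_of_nonneg (radialCutoff_nonneg _ _)]
    exact radialCutoff_mul_le hR (norm_nonneg _)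
  -- Bound of the field times the length of the interval: no solution can leave this ball.
  set r : ℝ := K * (2 * R) * (d - c)
  have hr : 0 ≤ r := mul_nonneg (by positivity) (sub_nonneg.2 hcd)
  have hPL : IsPicardLindelof w (⟨t₀, ht₀⟩ : Icc c d) x₀ ⟨r, hr⟩ 0 ⟨K * (2 * R), by positivity⟩
      ⟨K * (1 + (‖x₀‖ + r) / R), by positivity⟩ := by
    refine ⟨fun t ht => ?_, fun x _ => ?_, fun t ht x _ => hwle' t ht x, ?_⟩
    · refine LipschitzOnWith.of_dist_le_mul fun x _ y hy => ?_
      have hy' : ‖y‖ ≤ ‖x₀‖ + r := by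
        have h1 : ‖y - x₀‖ ≤ r := by rwa [Metric.mem_closedBall, dist_eq_norm] at hy
        linarith [norm_le_norm_add_norm_sub' y x₀]
      rw [dist_eq_norm, dist_eq_norm, hw, ← map_sub]
      refine ((A t).le_opNorm _).trans ?_
      change _ ≤ K * (1 + (‖x₀‖ + r) / R) * ‖x - y‖
      rw [mul_assoc]
      refine mul_le_mul (hK t ht) ?_ (norm_nonneg _) hK0
      have hdec : radialCutoff R ‖x‖ • x - radialCutoff R ‖y‖ • y
          = radialCutoff R ‖x‖ • (x - y) + (radialCutoff R ‖x‖ - radialCutoff R ‖y‖) • y := by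
        rw [smul_sub, sub_smul]; abel
      rw [hdec]
      refine (norm_add_le _ _).trans ?_
      rw [norm_smul, norm_smul, Real.norm_of_nonneg (radialCutoff_nonneg _ _), Real.norm_eq_abs]
      have h1 : radialCutoff R ‖x‖ * ‖x - y‖ ≤ ‖x - y‖ :=
        mul_le_of_le_one_left (norm_nonneg _) (radialCutoff_le_one _ _)
      have h2 : |radialCutoff R ‖x‖ - radialCutoff R ‖y‖| ≤ ‖x - y‖ / R :=
        (abs_radialCutoff_sub_le hR _ _).trans
          (div_le_div_of_nonneg_right (abs_norm_sub_norm_le _ _) hR.le)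
      have h3 : |radialCutoff R ‖x‖ - radialCutoff R ‖y‖| * ‖y‖
          ≤ ‖x - y‖ / R * (‖x₀‖ + r) := mul_le_mul h2 hy' (norm_nonneg _) (by positivity)
      calc _ ≤ ‖x - y‖ + ‖x - y‖ / R * (‖x₀‖ + r) := add_le_add h1 h3
        _ = _ := by ring
    · exact hA.clm_apply continuousOn_const
    · change K * (2 * R) * max (d - t₀) (t₀ - c) ≤ r - 0
      rw [sub_zero]
      exact mul_le_mul_of_nonneg_left (max_le (by linarith [ht₀.1]) (by linarith [ht₀.2]))
        (by positivity)
  obtain ⟨f, hf0, hf⟩ := hPL.exists_eq_forall_mem_Icc_hasDerivWithinAt₀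
  have hcont : ContinuousOn f (Icc c d) := fun t ht => (hf t ht).continuousWithinAt
  have hright : ∀ t ∈ Icc t₀ d, ‖f t‖ ≤ ‖x₀‖ * Real.exp (K * (t - t₀)) := by
    have := norm_le_gronwallBound_of_norm_deriv_right_le (f := f) (f' := fun t => w t (f t))
      (δ := ‖x₀‖) (K := K) (ε := 0) (a := t₀) (b := d)
      (hcont.mono (Icc_subset_Icc_left ht₀.1)) (fun t ht => ?_) (by simp [hf0])
      (fun t ht => by
        simpa using hwle t ⟨ht₀.1.trans ht.1, ht.2.le⟩ (f t))
    · simpa [gronwallBound_ε0] using this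
    · exact (hf t ⟨ht₀.1.trans ht.1, ht.2.le⟩).mono_of_mem_nhdsWithin
        (mem_of_superset (Icc_mem_nhdsGE ht.2) (Icc_subset_Icc_left (ht₀.1.trans ht.1)))
  -- Grönwall runs forward in time only, so the part to the left of `t₀` is treated by reversing
  -- time.
  have hleft : ∀ t ∈ Icc (-t₀) (-c), ‖f (-t)‖ ≤ ‖x₀‖ * Real.exp (K * (t - -t₀)) := by
    have := norm_le_gronwallBound_of_norm_deriv_right_le (f := fun t => f (-t))
      (f' := fun t => -w (-t) (f (-t)))
      (δ := ‖x₀‖) (K := K) (ε := 0) (a := -t₀) (b := -c)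
      (hcont.comp continuousOn_neg fun t ht => ⟨by linarith [ht.2], by linarith [ht.1, ht₀.2]⟩)
      (fun t ht => ?_) (by simp [hf0])
      (fun t ht => by
        simpa using hwle (-t) ⟨by linarith [ht.2], by linarith [ht.1, ht₀.2]⟩ (f (-t)))
    · simpa [gronwallBound_ε0] using this
    · have hmem : -t ∈ Icc c d := ⟨by linarith [ht.2], by linarith [ht.1, ht₀.2]⟩
      have hle : -t ≤ d := hmem.2
      have h1 : HasDerivWithinAt f (w (-t) (f (-t))) (Iic (-t)) (-t) :=
        (hf (-t) hmem).mono_of_mem_nhdsWithin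
          (mem_of_superset (Icc_mem_nhdsLE (by linarith [ht.2] : c < -t))
            (Icc_subset_Icc_right hle))
      have h2 := HasDerivWithinAt.scomp t h1 (hasDerivAt_neg t).hasDerivWithinAt
        (s := Ici t) (fun s hs => mem_Iic.2 (neg_le_neg (mem_Ici.1 hs)))
      simpa [Function.comp_def] using h2
  have hbound : ∀ t ∈ Icc c d, ‖f t‖ ≤ R := by
    intro t ht
    have key : ∀ s, s ≤ d - c → ‖x₀‖ * Real.exp (K * s) ≤ R := fun s hs =>
      (mul_le_mul_of_nonneg_left (Real.exp_le_exp.2 (mul_le_mul_of_nonneg_left hs hK0))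
        (norm_nonneg _)).trans (by simp [R])
    rcases le_total t₀ t with h | h
    · exact (hright t ⟨h, ht.2⟩).trans (key _ (by linarith [ht.2, ht₀.1]))
    · have := hleft (-t) ⟨neg_le_neg h, neg_le_neg ht.1⟩
      rw [neg_neg] at this
      exact this.trans (key _ (by linarith [ht.1, ht₀.2]))
  refine ⟨f, hf0, fun t ht => ?_⟩
  have h1 := (hf t (Ioo_subset_Icc_self ht)).hasDerivAt (Icc_mem_nhds ht.1 ht.2)
  simp only [hw] at h1
  rwa [radialCutoff_eq_one hR (hbound t (Ioo_subset_Icc_self ht)), one_smul] at h1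

/-- A linear ordinary differential equation is solvable on an open interval. -/
theorem exists_linearODE_Ioo {A : ℝ → F →L[ℝ] F} {a b t₀ : ℝ} (hA : ContinuousOn A (Ioo a b))
    (ht₀ : t₀ ∈ Ioo a b) (x₀ : F) :
    ∃ f : ℝ → F, f t₀ = x₀ ∧ ∀ t ∈ Ioo a b, HasDerivAt f (A t (f t)) t := by
  have key : ∀ t : Ioo a b, ∃ c d : ℝ, ∃ f : ℝ → F, Ioo c d ⊆ Ioo a b ∧ t.1 ∈ Ioo c d ∧
      t₀ ∈ Ioo c d ∧ f t₀ = x₀ ∧ ∀ s ∈ Ioo c d, HasDerivAt f (A s (f s)) s := by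
    rintro ⟨t, ht⟩
    obtain ⟨c, hc, hc'⟩ := exists_between (lt_min ht₀.1 ht.1)
    obtain ⟨d, hd, hd'⟩ := exists_between (max_lt ht₀.2 ht.2)
    rw [lt_min_iff] at hc'
    rw [max_lt_iff] at hd
    have hsub : Icc c d ⊆ Ioo a b := Icc_subset_Ioo hc hd'
    obtain ⟨f, hf⟩ := exists_linearODE_Icc (hA.mono hsub) ⟨hc'.1.le, hd.1.le⟩ x₀
    exact ⟨c, d, f, Ioo_subset_Icc_self.trans hsub, ⟨hc'.2, hd.2⟩, ⟨hc'.1, hd.1⟩, hf⟩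
  choose c d f hsub ht ht0 hf0 hf using key
  classical
  -- At each `t` the solution chosen for that `t` is used. All choices agree at `t₀`, hence on
  -- common intervals, so `g` is locally one of them.
  set g : ℝ → F := fun t => if h : t ∈ Ioo a b then f ⟨t, h⟩ t else 0 with hg
  have hgf : ∀ t : Ioo a b, EqOn g (f t) (Ioo (c t) (d t)) := by
    intro t s hs
    have hs' := hsub t hs
    rw [hg]
    simp only [hs', dif_pos]
    set s' : Ioo a b := ⟨s, hs'⟩
    have hss : Ioo (max (c s') (c t)) (min (d s') (d t)) ⊆ Ioo a b :=
      (Ioo_subset_Ioo (le_max_left _ _) (min_le_left _ _)).trans (hsub s')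
    refine eqOn_of_linearODE (hA.mono hss) (t₀ := t₀)
      ⟨max_lt (ht0 s').1 (ht0 t).1, lt_min (ht0 s').2 (ht0 t).2⟩
      (fun z hz => hf s' z ?_) (fun z hz => hf t z ?_) ((hf0 s').trans (hf0 t).symm)
      ⟨max_lt (ht s').1 hs.1, lt_min (ht s').2 hs.2⟩
    · exact Ioo_subset_Ioo (le_max_left _ _) (min_le_left _ _) hz
    · exact Ioo_subset_Ioo (le_max_right _ _) (min_le_right _ _) hz
  refine ⟨g, ?_, fun t htab => ?_⟩
  · rw [hgf ⟨t₀, ht₀⟩ (ht0 _), hf0]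
  · have h1 := hf ⟨t, htab⟩ t (ht _)
    rw [← hgf ⟨t, htab⟩ (ht _)] at h1
    exact h1.congr_of_eventuallyEq
      (eventually_of_mem (Ioo_mem_nhds (ht ⟨t, htab⟩).1 (ht ⟨t, htab⟩).2) (hgf ⟨t, htab⟩))

end LinearODE

end

/-! ### The second order system, its flow, flux and Wronskian. -/

noncomputable section

/-- The product rule for complex linear operators depending on a real parameter. -/
theorem hasDerivAt_clm_apply {E F : Type*} [NormedAddCommGroup E] [NormedSpace ℂ E]
    [NormedAddCommGroup F] [NormedSpace ℂ F] {L : ℝ → E →L[ℂ] F} {L' : E →L[ℂ] F} {v : ℝ → E}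
    {v' : E} {z : ℝ} (hL : HasDerivAt L L' z) (hv : HasDerivAt v v' z) :
    HasDerivAt (fun t => L t (v t)) (L' (v z) + L z v') z := by
  have h1 := (ContinuousLinearMap.restrictScalarsL ℂ E F ℝ ℝ).hasFDerivAt.comp_hasDerivAt z hL
  exact h1.clm_apply hv

/-- The coefficients `P` and `S 0, S 1, S 2` of the equation `(d/dz + P)² v = ∑ Sᵢ* Sᵢ v`. -/
structure ODESystem (n : ℕ) where
  P : ℝ → Mn n
  S : Fin 3 → ℝ → Mn n

namespace ODESystem

variable {n : ℕ}

/-- The nonnegative endomorphism `∑ Sᵢ* Sᵢ`. -/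
def N (Y : ODESystem n) (z : ℝ) : Mn n := ∑ i, ContinuousLinearMap.adjoint (Y.S i z) * Y.S i z

/-- The coefficients are continuous on `(a, b)` and `d/dz + P` is a unitary connection. -/
structure Regular (Y : ODESystem n) (a b : ℝ) : Prop where
  contP : ContinuousOn Y.P (Ioo a b)
  contS : ∀ i, ContinuousOn (Y.S i) (Ioo a b)
  skew : ∀ z ∈ Ioo a b, ContinuousLinearMap.adjoint (Y.P z) = -Y.P z

/-- `v` solves `(d/dz + P)² v = N v` on `s`, and `η` is its covariant derivative. -/
def IsSol (Y : ODESystem n) (s : Set ℝ) (v η : ℝ → Vn n) : Prop :=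
  ∀ z ∈ s, HasDerivAt v (η z - Y.P z (v z)) z ∧ HasDerivAt η (Y.N z (v z) - Y.P z (η z)) z

/-- The radial derivative `Re ⟨v, η⟩`, half of the derivative of `‖v‖²`. -/
def flux (v η : ℝ → Vn n) (z : ℝ) : ℝ := (inner ℂ (v z) (η z)).re

/-- The Wronskian of `(x, ξ)` and `(v, η)`. -/
def wronskian (x ξ v η : ℝ → Vn n) (z : ℝ) : ℂ := inner ℂ (ξ z) (v z) - inner ℂ (x z) (η z)

variable {Y : ODESystem n} {a b : ℝ} {s : Set ℝ} {v η v' η' : ℝ → Vn n}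

theorem Regular.mono {c d : ℝ} (h : Y.Regular a b) (hcd : Ioo c d ⊆ Ioo a b) : Y.Regular c d :=
  ⟨h.contP.mono hcd, fun i => (h.contS i).mono hcd, fun z hz => h.skew z (hcd hz)⟩

theorem Regular.contN (h : Y.Regular a b) : ContinuousOn Y.N (Ioo a b) := by
  have : Y.N = fun z => ∑ i, ContinuousLinearMap.adjoint (Y.S i z) * Y.S i z := rfl
  rw [this]
  refine continuousOn_finsetSum _ fun i _ => ContinuousOn.mul ?_ (h.contS i)
  exact ContinuousLinearMap.adjoint.continuous.comp_continuousOn (h.contS i)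

theorem Regular.inner_P (h : Y.Regular a b) {z : ℝ} (hz : z ∈ Ioo a b) (x y : Vn n) :
    inner ℂ (Y.P z x) y = -inner ℂ x (Y.P z y) := by
  rw [← ContinuousLinearMap.adjoint_inner_right, h.skew z hz]
  simp

theorem inner_N (Y : ODESystem n) (z : ℝ) (x y : Vn n) :
    inner ℂ x (Y.N z y) = ∑ i, inner ℂ (Y.S i z x) (Y.S i z y) := by
  simp [N, ContinuousLinearMap.adjoint_inner_right]

theorem inner_N_left (Y : ODESystem n) (z : ℝ) (x y : Vn n) :
    inner ℂ (Y.N z x) y = ∑ i, inner ℂ (Y.S i z x) (Y.S i z y) := by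
  simp [N, ContinuousLinearMap.adjoint_inner_left]

theorem re_inner_N_self (Y : ODESystem n) (z : ℝ) (x : Vn n) :
    (inner ℂ x (Y.N z x)).re = ∑ i, ‖Y.S i z x‖ ^ 2 := by
  rw [inner_N, Complex.re_sum]
  exact Finset.sum_congr rfl fun i _ => by rw [inner_self_eq_norm_sq_to_K]; norm_cast

theorem IsSol.mono {t : Set ℝ} (h : Y.IsSol s v η) (hts : t ⊆ s) : Y.IsSol t v η :=
  fun z hz => h z (hts hz)

theorem IsSol.continuousOn (h : Y.IsSol s v η) : ContinuousOn v s :=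
  fun z hz => (h z hz).1.continuousAt.continuousWithinAt

theorem IsSol.continuousOn' (h : Y.IsSol s v η) : ContinuousOn η s :=
  fun z hz => (h z hz).2.continuousAt.continuousWithinAt

theorem IsSol.add (h : Y.IsSol s v η) (h' : Y.IsSol s v' η') :
    Y.IsSol s (fun z => v z + v' z) (fun z => η z + η' z) := fun z hz => by
  refine ⟨((h z hz).1.add (h' z hz).1).congr_deriv ?_, ((h z hz).2.add (h' z hz).2).congr_deriv ?_⟩
  · rw [map_add, sub_add_sub_comm]
  · rw [map_add, map_add, sub_add_sub_comm]

theorem IsSol.sub (h : Y.IsSol s v η) (h' : Y.IsSol s v' η') :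
    Y.IsSol s (fun z => v z - v' z) (fun z => η z - η' z) := fun z hz => by
  refine ⟨((h z hz).1.sub (h' z hz).1).congr_deriv ?_, ((h z hz).2.sub (h' z hz).2).congr_deriv ?_⟩
  · rw [map_sub, sub_sub_sub_comm]
  · rw [map_sub, map_sub, sub_sub_sub_comm]

/-- The first order system for `(v, η)` as a single linear operator. -/
def coeff (Y : ODESystem n) (z : ℝ) : Vn n × Vn n →L[ℂ] Vn n × Vn n :=
  (ContinuousLinearMap.inl ℂ (Vn n) (Vn n)).comp
      (ContinuousLinearMap.snd ℂ (Vn n) (Vn n) - (Y.P z).comp (ContinuousLinearMap.fst ℂ _ _))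
    + (ContinuousLinearMap.inr ℂ (Vn n) (Vn n)).comp
      ((Y.N z).comp (ContinuousLinearMap.fst ℂ _ _) - (Y.P z).comp (ContinuousLinearMap.snd ℂ _ _))

theorem coeff_apply (Y : ODESystem n) (z : ℝ) (X : Vn n × Vn n) :
    Y.coeff z X = (X.2 - Y.P z X.1, Y.N z X.1 - Y.P z X.2) := by
  simp [coeff]

theorem Regular.contCoeff (h : Y.Regular a b) : ContinuousOn Y.coeff (Ioo a b) := by
  have : Y.coeff = fun z => (ContinuousLinearMap.inl ℂ (Vn n) (Vn n)).comp
      (ContinuousLinearMap.snd ℂ (Vn n) (Vn n) - (Y.P z).comp (ContinuousLinearMap.fst ℂ _ _))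
    + (ContinuousLinearMap.inr ℂ (Vn n) (Vn n)).comp
      ((Y.N z).comp (ContinuousLinearMap.fst ℂ _ _)
        - (Y.P z).comp (ContinuousLinearMap.snd ℂ _ _)) := rfl
  rw [this]
  have hP := h.contP
  have hN := h.contN
  refine ContinuousOn.add ?_ ?_
  · exact continuousOn_const.clm_comp (continuousOn_const.sub (hP.clm_comp continuousOn_const))
  · exact continuousOn_const.clm_comp
      ((hN.clm_comp continuousOn_const).sub (hP.clm_comp continuousOn_const))

/-- The flow of the system. -/
theorem Regular.exists_flow (h : Y.Regular a b) {z₀ : ℝ} (hz₀ : z₀ ∈ Ioo a b) :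
    ∃ Φ : ℝ → (Vn n × Vn n →L[ℂ] Vn n × Vn n), Φ z₀ = 1 ∧
      (∀ X, Y.IsSol (Ioo a b) (fun z => (Φ z X).1) (fun z => (Φ z X).2)) ∧
      ∀ v η, Y.IsSol (Ioo a b) v η → ∀ z ∈ Ioo a b, (v z, η z) = Φ z (v z₀, η z₀) := by
  -- The operator-valued equation `Φ' = coeff ∘ Φ` yields all solutions at once, linear in the
  -- Cauchy data.
  obtain ⟨Φ, h0, hΦ⟩ := exists_linearODE_Ioo
    (A := fun z => (ContinuousLinearMap.compL ℂ (Vn n × Vn n) (Vn n × Vn n) (Vn n × Vn n)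
      (Y.coeff z)).restrictScalars ℝ)
    ((ContinuousLinearMap.restrictScalarsL ℂ _ _ ℝ ℝ).continuous.comp_continuousOn
      ((ContinuousLinearMap.compL ℂ _ _ _).continuous.comp_continuousOn h.contCoeff)) hz₀ 1
  have hX : ∀ X, ∀ z ∈ Ioo a b, HasDerivAt (fun z => Φ z X) (Y.coeff z (Φ z X)) z := by
    intro X z hz
    have := hasDerivAt_clm_apply (hΦ z hz) (hasDerivAt_const z X)
    simpa using this
  refine ⟨Φ, h0, fun X z hz => ?_, fun v η hv => ?_⟩
  · have h1 := hX X z hz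
    rw [coeff_apply] at h1
    exact ⟨h1.fst, h1.snd⟩
  · have := eqOn_of_linearODE (A := fun z => (Y.coeff z).restrictScalars ℝ) (t₀ := z₀)
      ((ContinuousLinearMap.restrictScalarsL ℂ (Vn n × Vn n) (Vn n × Vn n) ℝ ℝ).continuous.comp_continuousOn
        h.contCoeff) (f := fun z => (v z, η z)) (g := fun z => Φ z (v z₀, η z₀)) hz₀
      (fun z hz => ?_) (fun z hz => hX _ z hz) (by simp [h0])
    · exact this
    · have h1 := (hv z hz).1.prodMk (hv z hz).2
      refine h1.congr_deriv ?_
      simp [coeff_apply]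

theorem Regular.exists_sol (h : Y.Regular a b) {z₀ : ℝ} (hz₀ : z₀ ∈ Ioo a b) (v₀ η₀ : Vn n) :
    ∃ v η, Y.IsSol (Ioo a b) v η ∧ v z₀ = v₀ ∧ η z₀ = η₀ := by
  obtain ⟨Φ, h0, hΦ, -⟩ := h.exists_flow hz₀
  exact ⟨_, _, hΦ (v₀, η₀), by simp [h0], by simp [h0]⟩

theorem Regular.eqOn (h : Y.Regular a b) {z₀ : ℝ} (hz₀ : z₀ ∈ Ioo a b)
    (hv : Y.IsSol (Ioo a b) v η) (hv' : Y.IsSol (Ioo a b) v' η') (h₁ : v z₀ = v' z₀)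
    (h₂ : η z₀ = η' z₀) : EqOn v v' (Ioo a b) ∧ EqOn η η' (Ioo a b) := by
  obtain ⟨Φ, -, -, hu⟩ := h.exists_flow hz₀
  have key : ∀ z ∈ Ioo a b, (v z, η z) = (v' z, η' z) := fun z hz => by
    rw [hu v η hv z hz, hu v' η' hv' z hz, h₁, h₂]
  exact ⟨fun z hz => congrArg Prod.fst (key z hz), fun z hz => congrArg Prod.snd (key z hz)⟩

/-- The connection terms cancel because `P` is skew-adjoint, and `Re ⟨v, N v⟩` is a sum of squares.
Every positivity argument below rests on the sign of this derivative. -/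
theorem Regular.hasDerivAt_flux (h : Y.Regular a b) {z : ℝ} (hz : z ∈ Ioo a b)
    (hv : Y.IsSol {z} v η) :
    HasDerivAt (flux v η) (‖η z‖ ^ 2 + ∑ i, ‖Y.S i z (v z)‖ ^ 2) z := by
  have h1 := ((hv z rfl).1.inner ℂ (hv z rfl).2)
  have h2 := Complex.reCLM.hasFDerivAt.comp_hasDerivAt z h1
  refine h2.congr_deriv ?_
  rw [← re_inner_N_self, inner_sub_right, inner_sub_left, h.inner_P hz,
    inner_self_eq_norm_sq_to_K (𝕜 := ℂ) (η z)]
  have : ((‖η z‖ : ℂ) ^ 2).re = ‖η z‖ ^ 2 := by norm_cast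
  simp [this]
  ring

theorem Regular.hasDerivAt_normSq (h : Y.Regular a b) {z : ℝ} (hz : z ∈ Ioo a b)
    (hv : Y.IsSol {z} v η) :
    HasDerivAt (fun z => ‖v z‖ ^ 2) (2 * flux v η z) z := by
  have h1 := ((hv z rfl).1.inner ℂ (hv z rfl).1)
  have h2 := Complex.reCLM.hasFDerivAt.comp_hasDerivAt z h1
  have h3 : (fun z => ‖v z‖ ^ 2) = fun z => (inner ℂ (v z) (v z)).re := by
    ext z; rw [inner_self_eq_norm_sq_to_K]; norm_cast
  rw [h3]
  refine h2.congr_deriv ?_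
  rw [inner_sub_right, inner_sub_left, h.inner_P hz, flux]
  have : (inner ℂ (η z) (v z)).re = (inner ℂ (v z) (η z)).re := inner_re_symm (𝕜 := ℂ) _ _
  simp [this]
  ring

/-- Skewness of `P` cancels the connection terms, self-adjointness of `N` the potential terms. -/
theorem Regular.hasDerivAt_wronskian (h : Y.Regular a b) {z : ℝ} (hz : z ∈ Ioo a b)
    {x ξ : ℝ → Vn n} (hx : Y.IsSol {z} x ξ) (hv : Y.IsSol {z} v η) :
    HasDerivAt (wronskian x ξ v η) 0 z := by
  refine (((hx z rfl).2.inner ℂ (hv z rfl).1).sub ((hx z rfl).1.inner ℂ (hv z rfl).2)).congr_deriv ?_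
  simp only [inner_sub_left, inner_sub_right, h.inner_P hz, inner_N, inner_N_left]
  ring

end ODESystem

end

/-! ### Convexity of `‖v‖²`, the maximum principle and the Dirichlet problem. -/

noncomputable section

/-- A function whose derivative is monotone is convex. -/
theorem convexOn_Icc_of_hasDerivAt {f f' : ℝ → ℝ} {x y : ℝ}
    (hf : ∀ z ∈ Icc x y, HasDerivAt f (f' z) z) (hf' : MonotoneOn f' (Icc x y)) :
    ConvexOn ℝ (Icc x y) f := by
  refine MonotoneOn.convexOn_of_deriv (convex_Icc x y)
    (fun z hz => (hf z hz).continuousAt.continuousWithinAt)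
    (fun z hz => (hf z (interior_subset hz)).differentiableAt.differentiableWithinAt) ?_
  intro z hz w hw hzw
  rw [(hf z (interior_subset hz)).deriv, (hf w (interior_subset hw)).deriv]
  exact hf' (interior_subset hz) (interior_subset hw) hzw

theorem monotoneOn_of_hasDerivAt_nonneg {f f' : ℝ → ℝ} {D : Set ℝ} (hD : Convex ℝ D)
    (hf : ∀ z ∈ D, HasDerivAt f (f' z) z) (hf' : ∀ z ∈ D, 0 ≤ f' z) : MonotoneOn f D := by
  refine monotoneOn_of_deriv_nonneg hD
    (fun z hz => (hf z hz).continuousAt.continuousWithinAt)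
    (fun z hz => (hf z (interior_subset hz)).differentiableAt.differentiableWithinAt) ?_
  intro z hz
  rw [(hf z (interior_subset hz)).deriv]
  exact hf' z (interior_subset hz)

/-- Mean value inequality with a majorant. -/
theorem norm_sub_le_of_hasDerivAt_le {F : Type*} [NormedAddCommGroup F] [NormedSpace ℝ F]
    {f f' : ℝ → F} {φ φ' : ℝ → ℝ} {x y : ℝ} (hxy : x ≤ y)
    (hf : ∀ z ∈ Icc x y, HasDerivAt f (f' z) z) (hφ : ∀ z ∈ Icc x y, HasDerivAt φ (φ' z) z)
    (h : ∀ z ∈ Icc x y, ‖f' z‖ ≤ φ' z) : ‖f y - f x‖ ≤ φ y - φ x := by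
  have hcf : ContinuousOn (fun z => f z - f x) (Icc x y) := fun z hz =>
    ((hf z hz).continuousAt.sub continuousAt_const).continuousWithinAt
  have := image_norm_le_of_norm_deriv_right_le_deriv_boundary' (f := fun z => f z - f x)
    (f' := f') (B := fun z => φ z - φ x) (B' := φ') hcf
    (fun z hz => ((hf z (Ico_subset_Icc_self hz)).sub_const _).hasDerivWithinAt) (by simp)
    (fun z hz => ((hφ z hz).continuousAt.sub continuousAt_const).continuousWithinAt)
    (fun z hz => ((hφ z (Ico_subset_Icc_self hz)).sub_const _).hasDerivWithinAt)
    (fun z hz => h z (Ico_subset_Icc_self hz))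
  exact this ⟨hxy, le_rfl⟩

namespace ODESystem

variable {n : ℕ} {Y : ODESystem n} {a b : ℝ} {s : Set ℝ} {v η v' η' : ℝ → Vn n}

theorem Regular.monotoneOn_flux (h : Y.Regular a b) (hv : Y.IsSol (Ioo a b) v η) :
    MonotoneOn (flux v η) (Ioo a b) :=
  monotoneOn_of_hasDerivAt_nonneg (convex_Ioo a b)
    (fun z hz => h.hasDerivAt_flux hz (hv.mono (singleton_subset_iff.2 hz)))
    (fun z _ => by positivity)

/-- The flux lies between its limits at the ends of the interval. -/
theorem Regular.flux_mem_Icc (h : Y.Regular a b) (hv : Y.IsSol (Ioo a b) v η) {l₁ l₂ : ℝ}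
    (h₁ : Tendsto (flux v η) (𝓝[>] a) (𝓝 l₁)) (h₂ : Tendsto (flux v η) (𝓝[<] b) (𝓝 l₂))
    {z : ℝ} (hz : z ∈ Ioo a b) : flux v η z ∈ Icc l₁ l₂ := by
  have hm := h.monotoneOn_flux hv
  constructor
  · refine le_of_tendsto h₁ ?_
    filter_upwards [Ioo_mem_nhdsGT hz.1] with w hw
    exact hm ⟨hw.1, hw.2.trans hz.2⟩ hz hw.2.le
  · refine ge_of_tendsto h₂ ?_
    filter_upwards [Ioo_mem_nhdsLT hz.2] with w hw
    exact hm hz ⟨hz.1.trans hw.1, hw.2⟩ hw.1.le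

theorem Regular.flux_lim_le (h : Y.Regular a b) (hab : a < b) (hv : Y.IsSol (Ioo a b) v η)
    {l₁ l₂ : ℝ} (h₁ : Tendsto (flux v η) (𝓝[>] a) (𝓝 l₁))
    (h₂ : Tendsto (flux v η) (𝓝[<] b) (𝓝 l₂)) : l₁ ≤ l₂ := by
  obtain ⟨z, hz⟩ := exists_between hab
  have := h.flux_mem_Icc hv h₁ h₂ hz
  exact this.1.trans this.2

/-- A solution without flux is parallel and annihilated by the `Sᵢ`. -/
theorem Regular.parallel_of_flux (h : Y.Regular a b) (hv : Y.IsSol (Ioo a b) v η)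
    {l₁ l₂ : ℝ} (h₁ : Tendsto (flux v η) (𝓝[>] a) (𝓝 l₁))
    (h₂ : Tendsto (flux v η) (𝓝[<] b) (𝓝 l₂)) (hl : l₂ ≤ l₁) {z : ℝ} (hz : z ∈ Ioo a b) :
    η z = 0 ∧ ∀ i, Y.S i z (v z) = 0 := by
  have hc : flux v η =ᶠ[𝓝 z] fun _ => l₁ := by
    filter_upwards [Ioo_mem_nhds hz.1 hz.2] with w hw
    have := h.flux_mem_Icc hv h₁ h₂ hw
    exact le_antisymm (this.2.trans hl) this.1
  have h0 := (h.hasDerivAt_flux hz (hv.mono (singleton_subset_iff.2 hz))).unique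
    ((hasDerivAt_const z l₁).congr_of_eventuallyEq hc)
  have hs : ∀ i ∈ Finset.univ, 0 ≤ ‖Y.S i z (v z)‖ ^ 2 := fun i _ => by positivity
  have h1 := (add_eq_zero_iff_of_nonneg (by positivity) (Finset.sum_nonneg hs)).1 h0
  refine ⟨by simpa using h1.1, fun i => ?_⟩
  simpa using (Finset.sum_eq_zero_iff_of_nonneg hs).1 h1.2 i (Finset.mem_univ i)

/-- The maximum principle. -/
theorem Regular.norm_le_max (h : Y.Regular a b) (hv : Y.IsSol (Ioo a b) v η) {x y z : ℝ}
    (hx : x ∈ Ioo a b) (hy : y ∈ Ioo a b) (hz : z ∈ Icc x y) : ‖v z‖ ≤ max ‖v x‖ ‖v y‖ := by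
  have hsub : Icc x y ⊆ Ioo a b := fun w hw => ⟨hx.1.trans_le hw.1, hw.2.trans_lt hy.2⟩
  have hconv : ConvexOn ℝ (Icc x y) fun z => ‖v z‖ ^ 2 :=
    convexOn_Icc_of_hasDerivAt
      (fun w hw => h.hasDerivAt_normSq (hsub hw) (hv.mono (singleton_subset_iff.2 (hsub hw))))
      (fun w hw w' hw' hww => mul_le_mul_of_nonneg_left
        (h.monotoneOn_flux hv (hsub hw) (hsub hw') hww) (by norm_num))
  have hxy : x ≤ y := hz.1.trans hz.2
  have h1 := hconv.le_max_of_mem_Icc (left_mem_Icc.2 hxy) (right_mem_Icc.2 hxy) hz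
  rcases le_max_iff.1 h1 with h2 | h2
  · exact (le_max_left _ _).trans' ((sq_le_sq₀ (norm_nonneg _) (norm_nonneg _)).1 h2)
  · exact (le_max_right _ _).trans' ((sq_le_sq₀ (norm_nonneg _) (norm_nonneg _)).1 h2)

/-- The maximum principle kills `v` between the two zeros; there the covariant derivative vanishes
too, and uniqueness for the Cauchy problem propagates this to the whole interval. -/
theorem Regular.eq_zero_of_dirichlet (h : Y.Regular a b) (hv : Y.IsSol (Ioo a b) v η) {x y : ℝ}
    (hx : x ∈ Ioo a b) (hy : y ∈ Ioo a b) (hxy : x < y) (h₁ : v x = 0) (h₂ : v y = 0) :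
    ∀ z ∈ Ioo a b, v z = 0 ∧ η z = 0 := by
  have h0 : ∀ z ∈ Icc x y, v z = 0 := fun z hz => by
    have := h.norm_le_max hv hx hy hz
    rw [h₁, h₂, norm_zero, max_self] at this
    exact norm_le_zero_iff.1 this
  obtain ⟨m, hm⟩ := exists_between hxy
  have hmab : m ∈ Ioo a b := ⟨hx.1.trans hm.1, hm.2.trans hy.2⟩
  have hηm : η m = 0 := by
    have hc : v =ᶠ[𝓝 m] fun _ => 0 := by
      filter_upwards [Icc_mem_nhds hm.1 hm.2] with w hw using h0 w hw
    have := (hv m hmab).1.unique ((hasDerivAt_const m (0 : Vn n)).congr_of_eventuallyEq hc)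
    simpa [h0 m (Ioo_subset_Icc_self hm)] using this
  have hz : Y.IsSol (Ioo a b) (fun _ => 0) (fun _ => 0) := fun z _ => by
    simp only [map_zero, sub_zero]
    exact ⟨hasDerivAt_const _ _, hasDerivAt_const _ _⟩
  have := h.eqOn hmab hv hz (h0 m (Ioo_subset_Icc_self hm)) hηm
  exact fun z hz => ⟨this.1 hz, this.2 hz⟩

/-- The solutions with prescribed values at two points, as a linear family. -/
theorem Regular.exists_dirichlet_flow (h : Y.Regular a b) {x y : ℝ} (hx : x ∈ Ioo a b)
    (hy : y ∈ Ioo a b) (hxy : x < y) :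
    ∃ Θ : ℝ → (Vn n × Vn n →L[ℂ] Vn n × Vn n),
      (∀ X, Y.IsSol (Ioo a b) (fun z => (Θ z X).1) (fun z => (Θ z X).2)) ∧
      ∀ X, (Θ x X).1 = X.1 ∧ (Θ y X).1 = X.2 := by
  obtain ⟨Φ, h0, hΦ, -⟩ := h.exists_flow hx
  -- Cauchy data at `x` to boundary values at `x` and `y`: source and target have equal dimension,
  -- so injectivity, which is uniqueness, gives solvability.
  set L : Vn n × Vn n →ₗ[ℂ] Vn n × Vn n :=
    ((LinearMap.fst ℂ _ _).comp (Φ x).toLinearMap).prod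
      ((LinearMap.fst ℂ _ _).comp (Φ y).toLinearMap) with hL
  have hLapp : ∀ X, L X = ((Φ x X).1, (Φ y X).1) := fun X => rfl
  have hinj : Function.Injective L := by
    rw [← LinearMap.ker_eq_bot, LinearMap.ker_eq_bot']
    intro X hX
    rw [hLapp, Prod.mk_eq_zero] at hX
    have := h.eq_zero_of_dirichlet (hΦ X) hx hy hxy hX.1 hX.2 x hx
    simpa [h0, Prod.ext_iff] using this
  set e := LinearEquiv.ofInjectiveEndo L hinj
  refine ⟨fun z => (Φ z).comp (LinearMap.toContinuousLinearMap e.symm.toLinearMap),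
    fun X => hΦ (e.symm X), fun X => ?_⟩
  have h1 : L (e.symm X) = X := e.apply_symm_apply X
  rw [hLapp] at h1
  exact ⟨(congrArg Prod.fst h1 :), (congrArg Prod.snd h1 :)⟩

/-- A semiconvexity estimate for the difference of a solution and a parallel section. -/
theorem Regular.convexOn_normSq_sub (h : Y.Regular a b) (hv : Y.IsSol (Ioo a b) v η) {x y : ℝ}
    (hxy : Icc x y ⊆ Ioo a b) {t : ℝ → Vn n}
    (ht : ∀ z ∈ Icc x y, HasDerivAt t (-Y.P z (t z)) z) {κ : ℝ}
    (hκ : ∀ z ∈ Icc x y, ∑ i, ‖Y.S i z (t z)‖ ^ 2 ≤ 4 * κ) :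
    ConvexOn ℝ (Icc x y) fun z => ‖v z - t z‖ ^ 2 + κ * z ^ 2 := by
  have hd : ∀ z ∈ Icc x y, HasDerivAt (fun z => v z - t z) (η z - Y.P z (v z - t z)) z :=
    fun z hz => ((hv z (hxy hz)).1.sub (ht z hz)).congr_deriv (by
      rw [map_sub, sub_neg_eq_add, sub_add])
  set g : ℝ → ℝ := fun z => (inner ℂ (v z - t z) (η z)).re with hg
  have h1 : ∀ z ∈ Icc x y,
      HasDerivAt (fun z => ‖v z - t z‖ ^ 2 + κ * z ^ 2) (2 * (g z + κ * z)) z := by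
    intro z hz
    have h2 := Complex.reCLM.hasFDerivAt.comp_hasDerivAt z ((hd z hz).inner ℂ (hd z hz))
    have h3 : (fun z => ‖v z - t z‖ ^ 2)
        = fun z => (inner ℂ (v z - t z) (v z - t z)).re := by
      ext z; rw [inner_self_eq_norm_sq_to_K]; norm_cast
    have h4 : HasDerivAt (fun z => ‖v z - t z‖ ^ 2) (2 * g z) z := by
      rw [h3]
      refine h2.congr_deriv ?_
      rw [inner_sub_right _ (η z), inner_sub_left (η z), h.inner_P (hxy hz), hg]
      have : (inner ℂ (η z) (v z - t z)).re = (inner ℂ (v z - t z) (η z)).re :=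
        inner_re_symm (𝕜 := ℂ) _ _
      simp only [Complex.reCLM_apply, Complex.sub_re, Complex.add_re, Complex.neg_re, this]
      ring
    refine (h4.add (((hasDerivAt_id z).pow 2).const_mul κ)).congr_deriv ?_
    simp
    ring
  have h5 : ∀ z ∈ Icc x y, HasDerivAt (fun z => g z + κ * z)
      (‖η z‖ ^ 2 + (inner ℂ (v z - t z) (Y.N z (v z))).re + κ) z := by
    intro z hz
    have h2 := Complex.reCLM.hasFDerivAt.comp_hasDerivAt z ((hd z hz).inner ℂ (hv z (hxy hz)).2)
    have h6 : HasDerivAt g (‖η z‖ ^ 2 + (inner ℂ (v z - t z) (Y.N z (v z))).re) z := by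
      refine h2.congr_deriv ?_
      rw [inner_sub_right _ (Y.N z (v z)), inner_sub_left (η z), h.inner_P (hxy hz),
        inner_self_eq_norm_sq_to_K (𝕜 := ℂ) (η z)]
      have : ((‖η z‖ : ℂ) ^ 2).re = ‖η z‖ ^ 2 := by norm_cast
      simp only [Complex.reCLM_apply, Complex.sub_re, Complex.add_re, Complex.neg_re,
        Complex.coe_algebraMap, this]
      ring
    exact (h6.add ((hasDerivAt_id z).const_mul κ)).congr_deriv (by simp)
  have hpos : ∀ z ∈ Icc x y, 0 ≤ ‖η z‖ ^ 2 + (inner ℂ (v z - t z) (Y.N z (v z))).re + κ := by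
    intro z hz
    -- With `p = Sᵢ (v - t)` and `q = Sᵢ t`, completing the square gives `‖p‖² - ‖p‖ ‖q‖ ≥ -‖q‖² /
    -- 4`; this is the origin of the factor `4` in the hypothesis on `κ`.
    have h7 : ∀ i, -(‖Y.S i z (t z)‖ ^ 2 / 4)
        ≤ (inner ℂ (Y.S i z (v z - t z)) (Y.S i z (v z))).re := by
      intro i
      have hsplit : Y.S i z (v z) = Y.S i z (v z - t z) + Y.S i z (t z) := by
        rw [← map_add, sub_add_cancel]
      rw [hsplit, inner_add_right, inner_self_eq_norm_sq_to_K, Complex.add_re]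
      set p := Y.S i z (v z - t z)
      set q := Y.S i z (t z)
      have e1 : ((‖p‖ : ℂ) ^ 2).re = ‖p‖ ^ 2 := by norm_cast
      have e2 : -(‖p‖ * ‖q‖) ≤ (inner ℂ p q).re :=
        neg_le_of_abs_le ((Complex.abs_re_le_norm _).trans (norm_inner_le_norm p q))
      simp only [Complex.coe_algebraMap, e1]
      nlinarith [sq_nonneg (‖p‖ - ‖q‖ / 2)]
    have h8 : -κ ≤ (inner ℂ (v z - t z) (Y.N z (v z))).re := by
      rw [inner_N, Complex.re_sum]
      refine le_trans ?_ (Finset.sum_le_sum fun i _ => h7 i)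
      rw [Finset.sum_neg_distrib, ← Finset.sum_div]
      linarith [hκ z hz]
    nlinarith [sq_nonneg ‖η z‖]
  have hmono := monotoneOn_of_hasDerivAt_nonneg (convex_Icc x y) h5 hpos
  exact convexOn_Icc_of_hasDerivAt h1
    (fun w hw w' hw' hww => mul_le_mul_of_nonneg_left (hmono hw hw' hww) (by norm_num))

end ODESystem

end

/-! ### Asymptotics of singular equations at `s = 0`. -/

noncomputable section

section SingularODE

variable {F : Type*} [NormedAddCommGroup F] [NormedSpace ℝ F]

theorem exists_pos_of_eventually_nhdsGT {p : ℝ → Prop} (h : ∀ᶠ s in 𝓝[>] (0 : ℝ), p s) {B : ℝ}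
    (hB : 0 < B) : ∃ s₁, 0 < s₁ ∧ s₁ ≤ B ∧ ∀ s ∈ Ioc 0 s₁, p s := by
  obtain ⟨ε, hε, h'⟩ := mem_nhdsGT_iff_exists_Ioc_subset.1 h
  exact ⟨min ε B, lt_min hε hB, min_le_right _ _, fun s hs => h' ⟨hs.1, hs.2.trans (min_le_left _ _)⟩⟩

/-- A function whose derivative is `O(s^(-1/2))` has a limit at `0`. -/
theorem exists_tendsto_of_deriv_isBigO [CompleteSpace F] {f f' : ℝ → F}
    (hf : ∀ᶠ s in 𝓝[>] (0 : ℝ), HasDerivAt f (f' s) s)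
    (hO : f' =O[𝓝[>] (0 : ℝ)] fun s => s ^ (-(1 / 2) : ℝ)) :
    ∃ L, Tendsto f (𝓝[>] 0) (𝓝 L) := by
  obtain ⟨K, hK0, hK⟩ := hO.exists_pos
  obtain ⟨s₁, hs₁, -, h₁⟩ := exists_pos_of_eventually_nhdsGT (hf.and hK.bound) one_pos
  -- A primitive of the majorant `K s^(-1/2)` that vanishes at `0`, so that `f` is Cauchy there.
  set φ : ℝ → ℝ := fun s => 2 * K * s ^ (1 / 2 : ℝ) with hφdef
  have hφ : ∀ s, 0 < s → HasDerivAt φ (K * s ^ (-(1 / 2) : ℝ)) s := fun s hs => by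
    refine ((Real.hasDerivAt_rpow_const (Or.inl hs.ne')).const_mul (2 * K)).congr_deriv ?_
    norm_num
    ring
  have hφ0 : ∀ s, 0 < s → 0 ≤ φ s := fun s hs => by positivity
  have hφlim : Tendsto φ (𝓝[>] 0) (𝓝 0) := by
    have : Tendsto φ (𝓝 0) (𝓝 (φ 0)) :=
      (((Real.continuous_rpow_const (by norm_num)).const_mul (2 * K)).tendsto 0)
    have h0 : φ 0 = 0 := by simp [hφdef]
    rw [h0] at this
    exact this.mono_left nhdsWithin_le_nhds
  have key : ∀ x y, 0 < x → x ≤ y → y ≤ s₁ → ‖f y - f x‖ ≤ φ y := by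
    intro x y hx hxy hy
    have := norm_sub_le_of_hasDerivAt_le hxy
      (fun z hz => (h₁ z ⟨hx.trans_le hz.1, hz.2.trans hy⟩).1)
      (fun z hz => hφ z (hx.trans_le hz.1)) (fun z hz => ?_)
    · linarith [hφ0 x hx]
    · have hz0 : 0 < z := hx.trans_le hz.1
      have := (h₁ z ⟨hz0, hz.2.trans hy⟩).2
      rwa [Real.norm_of_nonneg (by positivity)] at this
  refine cauchy_map_iff_exists_tendsto.1 (Metric.cauchy_iff.2 ⟨inferInstance, fun ε hε => ?_⟩)
  obtain ⟨s₂, hs₂, hs₂', h₂⟩ :=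
    exists_pos_of_eventually_nhdsGT (hφlim.eventually_lt_const hε) hs₁
  refine ⟨f '' Ioc 0 s₂, image_mem_map (Ioc_mem_nhdsGT hs₂), ?_⟩
  rintro _ ⟨x, hx, rfl⟩ _ ⟨y, hy, rfl⟩
  rcases le_total x y with hxy | hxy
  · rw [dist_comm, dist_eq_norm]
    exact (key x y hx.1 hxy (hy.2.trans hs₂')).trans_lt (h₂ y hy)
  · rw [dist_eq_norm]
    exact (key y x hy.1 hxy (hx.2.trans hs₂')).trans_lt (h₂ x hx)

/-- Bounded solutions of `W'' = λ s⁻² W + O(s^(-1/2))` with `λ > 0` satisfy `W' → 0`. -/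
theorem tendsto_deriv_of_singular {W y f : ℝ → F} {lam : ℝ} (hlam : 0 < lam)
    (hW : ∀ᶠ s in 𝓝[>] (0 : ℝ), HasDerivAt W (y s) s)
    (hy : ∀ᶠ s in 𝓝[>] (0 : ℝ), HasDerivAt y ((lam * (s ^ 2)⁻¹) • W s + f s) s)
    (hf : f =O[𝓝[>] (0 : ℝ)] fun s => s ^ (-(1 / 2) : ℝ))
    (hb : W =O[𝓝[>] (0 : ℝ)] fun _ => (1 : ℝ)) : Tendsto y (𝓝[>] 0) (𝓝 0) := by
  -- The homogeneous equation has the solutions `s ^ r` and `s ^ (1 - r)`, for the larger root `r`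
  -- of the indicial equation; the second is unbounded because `r > 1`.
  obtain ⟨r, hr1, hr⟩ : ∃ r : ℝ, 1 < r ∧ r * (r - 1) = lam := by
    refine ⟨(1 + √(1 + 4 * lam)) / 2, ?_, ?_⟩
    · have : 1 < √(1 + 4 * lam) := Real.lt_sqrt_of_sq_lt (by linarith)
      linarith
    · have := Real.sq_sqrt (show 0 ≤ 1 + 4 * lam by linarith)
      nlinarith
  -- Here `δ ≤ 1/2` makes `s^(-1/2) ≤ s^(δ - 1)` for `s ≤ 1`, while `δ < r - 1` makes the exponent
  -- `δ - r + 1` negative and avoids a resonance with `s ^ r`.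
  set δ : ℝ := min (1 / 2) ((r - 1) / 2)
  have hδ0 : 0 < δ := lt_min (by norm_num) (by linarith)
  have hδ1 : δ ≤ 1 / 2 := min_le_left _ _
  have hδ2 : δ ≤ (r - 1) / 2 := min_le_right _ _
  obtain ⟨K, hK0, hK⟩ := hf.exists_pos
  obtain ⟨B, hB0, hB⟩ := hb.exists_pos
  obtain ⟨s₁, hs₁, hs₁', h₁⟩ := exists_pos_of_eventually_nhdsGT
    ((hW.and hy).and (hK.bound.and hB.bound)) one_pos
  have hfK : ∀ s ∈ Ioc 0 s₁, ‖f s‖ ≤ K * s ^ (δ - 1) := by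
    intro s hs
    have h2 := (h₁ s hs).2.1
    rw [Real.norm_of_nonneg (by have := hs.1; positivity)] at h2
    refine h2.trans (mul_le_mul_of_nonneg_left ?_ hK0.le)
    exact Real.rpow_le_rpow_of_exponent_ge hs.1 (hs.2.trans hs₁') (by linarith)
  -- The second order operator factors into first order ones: `q' = s^(1-r) f`, and below `p =
  -- s^(r-1) W` satisfies `p' = s^(2r-2) q`.
  set q : ℝ → F := fun s => s ^ (1 - r) • y s + ((r - 1) * s ^ (-r)) • W s with hq
  have hqd : ∀ s ∈ Ioc 0 s₁, HasDerivAt q (s ^ (1 - r) • f s) s := by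
    intro s hs
    have hs0 := hs.1
    have e1 : HasDerivAt (fun s : ℝ => s ^ (1 - r)) ((1 - r) * s ^ (1 - r - 1)) s :=
      Real.hasDerivAt_rpow_const (Or.inl hs0.ne')
    have e2 : HasDerivAt (fun s : ℝ => (r - 1) * s ^ (-r)) ((r - 1) * (-r * s ^ (-r - 1))) s :=
      (Real.hasDerivAt_rpow_const (Or.inl hs0.ne')).const_mul _
    refine ((e1.smul (h₁ s hs).1.2).add (e2.smul (h₁ s hs).1.1)).congr_deriv ?_
    have p1 : s ^ (1 - r - 1) = s ^ (-r) := by congr 1; ring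
    have p2 : s ^ (-r - 1) = s ^ (1 - r) * (s ^ 2)⁻¹ := by
      rw [← Real.rpow_natCast, ← Real.rpow_neg hs0.le, ← Real.rpow_add hs0]
      congr 1
      push_cast
      ring
    rw [p1, p2, ← hr]
    module
  have hrδ : 0 < r - 1 - δ := by linarith
  set K₂ : ℝ := K / (r - 1 - δ)
  have hK₂ : 0 < K₂ := by positivity
  set K₃ : ℝ := ‖q s₁‖ + K₂
  have hK₃ : 0 < K₃ := by positivity
  -- Integration inwards from `s₁`; the constant `‖q s₁‖` is absorbed because a negative power of `s
  -- ≤ 1` is at least `1`.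
  have hqb : ∀ s ∈ Ioc 0 s₁, ‖q s‖ ≤ K₃ * s ^ (δ - r + 1) := by
    intro s hs
    have h2 := norm_sub_le_of_hasDerivAt_le (φ := fun s => -K₂ * s ^ (δ - r + 1))
      (φ' := fun s => K * s ^ (δ - r)) hs.2
      (fun z hz => hqd z ⟨hs.1.trans_le hz.1, hz.2⟩) (fun z hz => ?_) (fun z hz => ?_)
    · have h3 : 0 ≤ K₂ * s₁ ^ (δ - r + 1) := by positivity
      have h4 : 1 ≤ s ^ (δ - r + 1) :=
        Real.one_le_rpow_of_pos_of_le_one_of_nonpos hs.1 (hs.2.trans hs₁') (by linarith)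
      have h5 : ‖q s‖ ≤ ‖q s₁‖ + ‖q s₁ - q s‖ := by
        have := norm_sub_norm_le (q s) (q s₁)
        rw [norm_sub_rev] at this
        linarith
      have h6 : ‖q s₁‖ ≤ ‖q s₁‖ * s ^ (δ - r + 1) := le_mul_of_one_le_right (norm_nonneg _) h4
      calc ‖q s‖ ≤ ‖q s₁‖ * s ^ (δ - r + 1) + K₂ * s ^ (δ - r + 1) := by linarith
        _ = _ := by ring
    · have hz0 : z ≠ 0 := (hs.1.trans_le hz.1).ne'
      refine ((Real.hasDerivAt_rpow_const (Or.inl hz0)).const_mul (-K₂)).congr_deriv ?_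
      rw [show δ - r + 1 - 1 = δ - r by ring]
      have : K₂ * (r - 1 - δ) = K := div_mul_cancel₀ _ hrδ.ne'
      linear_combination (z ^ (δ - r)) * this
    · have hz0 : 0 < z := hs.1.trans_le hz.1
      rw [norm_smul, Real.norm_of_nonneg (by positivity)]
      refine (mul_le_mul_of_nonneg_left (hfK z ⟨hz0, hz.2⟩) (by positivity)).trans_eq ?_
      rw [mul_left_comm, ← Real.rpow_add hz0]
      congr 2
      ring
  set p : ℝ → F := fun s => s ^ (r - 1) • W s with hp
  have hpd : ∀ s ∈ Ioc 0 s₁, HasDerivAt p (s ^ (2 * r - 2) • q s) s := by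
    intro s hs
    have hs0 := hs.1
    have e1 : HasDerivAt (fun s : ℝ => s ^ (r - 1)) ((r - 1) * s ^ (r - 1 - 1)) s :=
      Real.hasDerivAt_rpow_const (Or.inl hs0.ne')
    refine (e1.smul (h₁ s hs).1.1).congr_deriv ?_
    have p1 : s ^ (2 * r - 2) * s ^ (1 - r) = s ^ (r - 1) := by
      rw [← Real.rpow_add hs0]; congr 1; ring
    have p2 : s ^ (2 * r - 2) * s ^ (-r) = s ^ (r - 1 - 1) := by
      rw [← Real.rpow_add hs0]; congr 1; ring
    rw [← p2, ← p1, hq]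
    module
  set K₄ : ℝ := K₃ / (r + δ)
  have hrδ' : 0 < r + δ := by linarith
  have hK₄ : 0 < K₄ := by positivity
  -- Boundedness of `W` enters here: it excludes the solution `s ^ (1 - r)`, for which `p` would be
  -- constant, and lets `p'` be integrated from `0`.
  have hplim : Tendsto p (𝓝[>] 0) (𝓝 0) := by
    have h2 : Tendsto (fun s : ℝ => s ^ (r - 1) * B) (𝓝[>] 0) (𝓝 0) := by
      have := ((Real.continuous_rpow_const (q := r - 1) (by linarith)).mul_const B).tendsto 0
      simp only [Real.zero_rpow (show r - 1 ≠ 0 by linarith), zero_mul] at this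
      exact this.mono_left nhdsWithin_le_nhds
    refine squeeze_zero_norm' ?_ h2
    filter_upwards [Ioc_mem_nhdsGT hs₁] with s hs
    have hs0 := hs.1
    rw [hp, norm_smul, Real.norm_of_nonneg (by positivity)]
    refine mul_le_mul_of_nonneg_left ?_ (by positivity)
    simpa using (h₁ s hs).2.2
  have hpb : ∀ s ∈ Ioc 0 s₁, ‖p s‖ ≤ K₄ * s ^ (r + δ) := by
    intro s hs
    have h2 : Tendsto (fun x => ‖p s - p x‖) (𝓝[>] 0) (𝓝 ‖p s - 0‖) :=
      (tendsto_const_nhds.sub hplim).norm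
    rw [sub_zero] at h2
    refine le_of_tendsto h2 ?_
    filter_upwards [Ioc_mem_nhdsGT hs.1] with x hx
    have h3 := norm_sub_le_of_hasDerivAt_le (φ := fun s => K₄ * s ^ (r + δ))
      (φ' := fun s => K₃ * s ^ (r - 1 + δ)) hx.2
      (fun z hz => hpd z ⟨hx.1.trans_le hz.1, hz.2.trans hs.2⟩) (fun z hz => ?_) (fun z hz => ?_)
    · have := hx.1
      have : 0 ≤ K₄ * x ^ (r + δ) := by positivity
      linarith
    · have hz0 : z ≠ 0 := (hx.1.trans_le hz.1).ne'
      refine ((Real.hasDerivAt_rpow_const (Or.inl hz0)).const_mul K₄).congr_deriv ?_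
      rw [show r + δ - 1 = r - 1 + δ by ring]
      have : K₄ * (r + δ) = K₃ := div_mul_cancel₀ _ hrδ'.ne'
      linear_combination (z ^ (r - 1 + δ)) * this
    · have hz0 : 0 < z := hx.1.trans_le hz.1
      rw [norm_smul, Real.norm_of_nonneg (by positivity)]
      refine (mul_le_mul_of_nonneg_left (hqb z ⟨hz0, hz.2.trans hs.2⟩)
        (by positivity)).trans_eq ?_
      rw [mul_left_comm, ← Real.rpow_add hz0]
      congr 2
      ring
  have hyb : ∀ s ∈ Ioc 0 s₁, ‖y s‖ ≤ (K₃ + (r - 1) * K₄) * s ^ δ := by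
    intro s hs
    have hs0 := hs.1
    have hdec : y s = s ^ (r - 1) • q s - ((r - 1) * s ^ (-r)) • p s := by
      have p1 : s ^ (r - 1) * s ^ (1 - r) = 1 := by
        rw [← Real.rpow_add hs0]; simp
      simp only [hq, hp]
      match_scalars
      · linear_combination -p1
      · ring
    rw [hdec]
    refine (norm_sub_le _ _).trans ?_
    rw [norm_smul, norm_smul, Real.norm_of_nonneg (by positivity),
      Real.norm_of_nonneg (mul_nonneg (by linarith) (by positivity))]
    have e1 : s ^ (r - 1) * ‖q s‖ ≤ K₃ * s ^ δ := by
      refine (mul_le_mul_of_nonneg_left (hqb s hs) (by positivity)).trans_eq ?_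
      rw [mul_left_comm, ← Real.rpow_add hs0]
      congr 2
      ring
    have e2 : (r - 1) * s ^ (-r) * ‖p s‖ ≤ (r - 1) * K₄ * s ^ δ := by
      refine (mul_le_mul_of_nonneg_left (hpb s hs)
        (mul_nonneg (by linarith) (by positivity))).trans_eq ?_
      have : s ^ (-r) * s ^ (r + δ) = s ^ δ := by
        rw [← Real.rpow_add hs0]; congr 1; ring
      linear_combination (r - 1) * K₄ * this
    linarith
  have hlim : Tendsto (fun s : ℝ => (K₃ + (r - 1) * K₄) * s ^ δ) (𝓝[>] 0) (𝓝 0) := by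
    have := ((Real.continuous_rpow_const (q := δ) hδ0.le).const_mul (K₃ + (r - 1) * K₄)).tendsto 0
    simp only [Real.zero_rpow hδ0.ne', mul_zero] at this
    exact this.mono_left nhdsWithin_le_nhds
  refine squeeze_zero_norm' ?_ hlim
  filter_upwards [Ioc_mem_nhdsGT hs₁] with s hs using hyb s hs

end SingularODE

end

/-! ### Solutions at a singular end. -/

noncomputable section

theorem hasDerivAt_clm_const_apply {E F : Type*} [NormedAddCommGroup E] [NormedSpace ℂ E]
    [NormedAddCommGroup F] [NormedSpace ℂ F] (A : E →L[ℂ] F) {g : ℝ → E} {g' : E} {z : ℝ}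
    (hg : HasDerivAt g g' z) : HasDerivAt (fun z => A (g z)) (A g') z := by
  simpa using hasDerivAt_clm_apply (hasDerivAt_const z A) hg

theorem isBigO_clm_apply {α E F : Type*} [NormedAddCommGroup E] [NormedSpace ℂ E]
    [NormedAddCommGroup F] [NormedSpace ℂ F] {l : Filter α} {L : α → E →L[ℂ] F} {x : α → E}
    {g h : α → ℝ} (hL : L =O[l] g) (hx : x =O[l] h) :
    (fun z => L z (x z)) =O[l] fun z => g z * h z := by
  refine IsBigO.trans (g := fun z => ‖L z‖ * ‖x z‖) ?_ (hL.norm_left.mul hx.norm_left)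
  exact IsBigO.of_bound 1 (Eventually.of_forall fun z => by
    rw [one_mul, Real.norm_of_nonneg (by positivity)]
    exact (L z).le_opNorm _)

section Injection

variable {k n : ℕ} (ι : Vn k →ₗᵢ[ℂ] Vn n)

theorem inj_apply (u : Vn k) : inj ι u = ι u := rfl

theorem surj_inj (u : Vn k) : surj ι (ι u) = u := by
  refine ext_inner_left ℂ fun w => ?_
  rw [surj, ContinuousLinearMap.adjoint_inner_right, inj_apply, ι.inner_map_map]

theorem projQ_apply (v : Vn n) : projQ ι v = v - ι (surj ι v) := rfl

theorem projQ_inj (u : Vn k) : projQ ι (ι u) = 0 := by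
  rw [projQ_apply, surj_inj, sub_self]

theorem surj_projQ (v : Vn n) : surj ι (projQ ι v) = 0 := by
  rw [projQ_apply, map_sub, surj_inj, sub_self]

theorem projQ_projQ (v : Vn n) : projQ ι (projQ ι v) = projQ ι v := by
  rw [projQ_apply ι (projQ ι v), surj_projQ, map_zero, sub_zero]

theorem inj_surj_add_projQ (v : Vn n) : ι (surj ι v) + projQ ι v = v := by
  rw [projQ_apply]; exact add_sub_cancel _ _

theorem inner_surj (u : Vn k) (v : Vn n) : inner ℂ (ι u) v = inner ℂ u (surj ι v) := by
  rw [surj, ContinuousLinearMap.adjoint_inner_right, inj_apply]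

theorem inner_surj_left (u : Vn k) (v : Vn n) : inner ℂ v (ι u) = inner ℂ (surj ι v) u := by
  rw [surj, ContinuousLinearMap.adjoint_inner_left, inj_apply]

end Injection

namespace ODESystem

variable {k n : ℕ} {Y : ODESystem n} {a b : ℝ} {v η : ℝ → Vn n} {ι : Vn k →ₗᵢ[ℂ] Vn n}

/-- The behaviour of a system at a singular end `c`: in a parallel unitary frame `U` with
`U(c) = 1`, the endomorphism `N` has on `ker π` the leading term `λ (z - c)⁻²`. -/
structure SingularEnd (Y : ODESystem n) (ι : Vn k →ₗᵢ[ℂ] Vn n) (c : ℝ) (l : Filter ℝ)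
    (U : ℝ → Mn n) (lam : ℝ) : Prop where
  frame : ∀ᶠ z in l, U z ∈ unitary (Mn n) ∧ HasDerivAt U (-(Y.P z * U z)) z
  frame_lim : Tendsto U l (𝓝 1)
  lam_nonneg : 0 ≤ lam
  bdd : ∀ i, (fun z => (Y.S i z * U z).comp (inj ι)) =O[l] fun _ => (1 : ℝ)
  off : (fun z => (star (U z) * Y.N z * U z).comp (inj ι)) =O[l]
    fun z => |z - c| ^ (-(1 / 2) : ℝ)
  pole : (fun z => star (U z) * Y.N z * U z * projQ ι - (lam * (|z - c| ^ 2)⁻¹) • projQ ι) =O[l]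
    fun z => |z - c|⁻¹

theorem norm_star_apply_of_unitary {U : Mn n} (hU : U ∈ unitary (Mn n)) (x : Vn n) :
    ‖star U x‖ = ‖x‖ := by
  have h : U * star U = 1 := (Unitary.mem_iff.1 hU).2
  have h1 : (‖star U x‖ : ℂ) ^ 2 = (‖x‖ : ℂ) ^ 2 := by
    have h2 := inner_self_eq_norm_sq_to_K (𝕜 := ℂ) (star U x)
    have h3 := inner_self_eq_norm_sq_to_K (𝕜 := ℂ) x
    have h4 : inner ℂ (star U x) (star U x) = inner ℂ x x := by
      rw [ContinuousLinearMap.star_eq_adjoint, ContinuousLinearMap.adjoint_inner_left,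
        ← ContinuousLinearMap.star_eq_adjoint, ← mul_apply_eq_comp, h,
        one_apply_eq_self]
    exact h2.symm.trans (h4.trans h3)
  have h5 : ‖star U x‖ ^ 2 = ‖x‖ ^ 2 := by exact_mod_cast h1
  exact (sq_eq_sq₀ (norm_nonneg _) (norm_nonneg _)).1 h5

theorem norm_apply_of_unitary {U : Mn n} (hU : U ∈ unitary (Mn n)) (x : Vn n) : ‖U x‖ = ‖x‖ := by
  have := norm_star_apply_of_unitary (Unitary.star_mem hU) x
  rwa [star_star] at this

/-- Near a singular end there is a solution with a prescribed value at an inner point and the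
limit `ι w` at the end, approached at the rate `s^(1/2)`. -/
theorem Regular.exists_sol_close {L : ℝ} (h : Y.Regular 0 L) {U : ℝ → Mn n} {lam : ℝ}
    (he : Y.SingularEnd ι 0 (𝓝[>] 0) U lam) {z₀ : ℝ} (hz₀ : z₀ ∈ Ioo 0 L) (u : Vn n) (w : Vn k) :
    ∃ v η, Y.IsSol (Ioo 0 L) v η ∧ v z₀ = u ∧
      ∃ K, ∀ᶠ z in 𝓝[>] (0 : ℝ), ‖v z - U z (ι w)‖ ^ 2 ≤ K * z := by
  have hbdd : ∃ B, 0 < B ∧ ∀ᶠ z in 𝓝[>] (0 : ℝ), ∀ i, ‖(Y.S i z * U z).comp (inj ι)‖ ≤ B := by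
    choose B hB0 hB using fun i => (he.bdd i).exists_pos
    refine ⟨∑ i, B i, Finset.sum_pos (fun i _ => hB0 i) Finset.univ_nonempty, ?_⟩
    refine eventually_all.2 fun i => ?_
    filter_upwards [(hB i).bound] with z hz
    simp only [norm_one, mul_one] at hz
    exact hz.trans (Finset.single_le_sum (fun i _ => (hB0 i).le) (Finset.mem_univ i))
  obtain ⟨B, hB0, hB⟩ := hbdd
  obtain ⟨s₁, hs₁, hs₁', h₁⟩ :=
    exists_pos_of_eventually_nhdsGT (he.frame.and hB) (half_pos hz₀.1)
  have hs₁z : s₁ < z₀ := by linarith [hz₀.1]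
  have hs₁m : s₁ ∈ Ioo 0 L := ⟨hs₁, hs₁z.trans hz₀.2⟩
  set t : ℝ → Vn n := fun z => U z (ι w) with htdef
  have htn : ∀ z ∈ Ioc 0 s₁, ‖t z‖ = ‖w‖ := fun z hz => by
    rw [htdef, norm_apply_of_unitary (h₁ z hz).1.1, ι.norm_map]
  have htd : ∀ z ∈ Ioc 0 s₁, HasDerivAt t (-Y.P z (t z)) z := fun z hz => by
    refine (hasDerivAt_clm_apply (h₁ z hz).1.2 (hasDerivAt_const z (ι w))).congr_deriv ?_
    simp [htdef]
  -- Three summands, each at most `(B ‖w‖)²`, must add up to at most `4 κ`.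
  set κ : ℝ := 3 / 4 * (B * ‖w‖) ^ 2
  have hκ : ∀ z ∈ Ioc 0 s₁, ∑ i, ‖Y.S i z (t z)‖ ^ 2 ≤ 4 * κ := fun z hz => by
    have : ∀ i, ‖Y.S i z (t z)‖ ^ 2 ≤ (B * ‖w‖) ^ 2 := fun i => by
      refine pow_le_pow_left₀ (norm_nonneg _) ?_ 2
      exact (((Y.S i z * U z).comp (inj ι)).le_opNorm w).trans
        (mul_le_mul_of_nonneg_right ((h₁ z hz).2 i) (norm_nonneg _))
    refine (Finset.sum_le_sum fun i _ => this i).trans_eq ?_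
    simp only [Finset.sum_const, Finset.card_univ, Fintype.card_fin, nsmul_eq_mul, κ]
    push_cast
    ring
  -- Solutions parametrised by their values at `s₁` and `z₀`. The approximations then live in one
  -- fixed finite-dimensional family, and it suffices to extract a limit of their values at `s₁`.
  obtain ⟨Θ, hΘ, hΘ'⟩ := h.exists_dirichlet_flow hs₁m hz₀ hs₁z
  set R : ℝ := max ‖w‖ ‖u‖
  set D : ℝ := (R + ‖w‖) ^ 2 + κ * s₁ ^ 2
  have hκ0 : 0 ≤ κ := by positivity
  have hD0 : 0 ≤ D := by positivity
  -- The approximation has the values `t ε` at `ε` and `u` at `z₀`. The maximum principle bounds its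
  -- value at `s₁` by `R` for every `ε`, and convexity of `‖v - t‖² + κ z²` on `[ε, s₁]`, where `v -
  -- t` vanishes at `ε`, gives a bound linear in `z`.
  have approx : ∀ ε ∈ Ioo 0 s₁, ∃ y : Vn n, ‖y‖ ≤ R ∧
      ∀ z ∈ Icc ε s₁, ‖(Θ z (y, u)).1 - t z‖ ^ 2 ≤ κ * ε ^ 2 + D * z / s₁ := by
    intro ε hε
    have hεm : ε ∈ Ioo 0 L := ⟨hε.1, hε.2.trans hs₁m.2⟩
    have hεI : Icc ε s₁ ⊆ Ioc 0 s₁ := fun z hz => ⟨hε.1.trans_le hz.1, hz.2⟩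
    obtain ⟨Ψ, hΨ, hΨ'⟩ := h.exists_dirichlet_flow hεm hz₀ (hε.2.trans hs₁z)
    have hsol := hΨ (t ε, u)
    obtain ⟨e1, e2⟩ := hΨ' (t ε, u)
    set y := (Ψ s₁ (t ε, u)).1 with hy
    have hyR : ‖y‖ ≤ R := by
      have := h.norm_le_max hsol hεm hz₀ ⟨hε.2.le, hs₁z.le⟩
      simp only [e1, e2, htn ε ⟨hε.1, hε.2.le⟩] at this
      exact this
    refine ⟨y, hyR, fun z hz => ?_⟩
    -- Both are solutions with the values `y` at `s₁` and `u` at `z₀`.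
    have heq : (Θ z (y, u)).1 = (Ψ z (t ε, u)).1 := by
      have h0 := h.eq_zero_of_dirichlet ((hΘ (y, u)).sub hsol) hs₁m hz₀ hs₁z
        (sub_eq_zero.2 (hΘ' (y, u)).1) (sub_eq_zero.2 ((hΘ' (y, u)).2.trans e2.symm)) z
        ⟨hε.1.trans_le hz.1, hz.2.trans_lt hs₁m.2⟩
      exact sub_eq_zero.1 h0.1
    rw [heq]
    have hconv := h.convexOn_normSq_sub hsol (x := ε) (y := s₁)
      (fun z hz => ⟨hε.1.trans_le hz.1, hz.2.trans_lt hs₁m.2⟩)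
      (fun z hz => htd z (hεI hz)) (fun z hz => hκ z (hεI hz))
    have hlen : 0 < s₁ - ε := sub_pos.2 hε.2
    set θ : ℝ := (z - ε) / (s₁ - ε)
    have hθ0 : 0 ≤ θ := div_nonneg (sub_nonneg.2 hz.1) hlen.le
    have hθ1 : θ ≤ 1 := (div_le_one hlen).2 (by linarith [hz.2])
    have hθz : (1 - θ) * ε + θ * s₁ = z := by
      have : θ * (s₁ - ε) = z - ε := div_mul_cancel₀ _ hlen.ne'
      linarith
    have hθs : θ ≤ z / s₁ := by
      rw [div_le_div_iff₀ hlen hs₁]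
      nlinarith [hz.2, hε.1]
    have h2 := hconv.2 (left_mem_Icc.2 hε.2.le) (right_mem_Icc.2 hε.2.le)
      (sub_nonneg.2 hθ1) hθ0 (sub_add_cancel 1 θ)
    simp only [smul_eq_mul, hθz, e1, sub_self, norm_zero] at h2
    have h3 : ‖y - t s₁‖ ^ 2 + κ * s₁ ^ 2 ≤ D := by
      have : ‖y - t s₁‖ ≤ R + ‖w‖ := by
        refine (norm_sub_le _ _).trans ?_
        rw [htn s₁ ⟨hs₁, le_rfl⟩]
        linarith
      have := pow_le_pow_left₀ (norm_nonneg _) this 2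
      linarith
    have h4 : θ * (‖y - t s₁‖ ^ 2 + κ * s₁ ^ 2) ≤ z / s₁ * D :=
      mul_le_mul hθs h3 (by positivity) (hθ0.trans hθs)
    have h5 : (1 - θ) * (κ * ε ^ 2) ≤ κ * ε ^ 2 :=
      mul_le_of_le_one_left (by positivity) (by linarith)
    have h6 : 0 ≤ κ * z ^ 2 := by positivity
    have h7 : z / s₁ * D = D * z / s₁ := by ring
    rw [← hy] at h2
    norm_num at h2
    linarith
  -- The `2` keeps `ε m` strictly below `s₁` already for `m = 0`.
  set ε : ℕ → ℝ := fun m => s₁ / (m + 2)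
  have hε : ∀ m, ε m ∈ Ioo 0 s₁ := fun m => by
    have h2 : (1 : ℝ) < m + 2 := by
      have : (0 : ℝ) ≤ m := Nat.cast_nonneg m
      linarith
    exact ⟨by positivity, div_lt_self hs₁ h2⟩
  have hεlim : Tendsto ε atTop (𝓝 0) :=
    tendsto_const_nhds.div_atTop (tendsto_atTop_add_const_right _ 2 tendsto_natCast_atTop_atTop)
  choose y hyR hy using fun m => approx (ε m) (hε m)
  obtain ⟨y', -, φ, hφ, hlim⟩ := (isCompact_closedBall (0 : Vn n) R).tendsto_subseq
    (fun m => mem_closedBall_zero_iff.2 (hyR m))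
  refine ⟨_, _, hΘ (y', u), (hΘ' (y', u)).2, D / s₁, ?_⟩
  filter_upwards [Ioc_mem_nhdsGT hs₁] with z hz
  have hl1 : Tendsto (fun m => ‖(Θ z (y (φ m), u)).1 - t z‖ ^ 2) atTop
      (𝓝 (‖(Θ z (y', u)).1 - t z‖ ^ 2)) := by
    have hc : Continuous fun y => ‖(Θ z (y, u)).1 - t z‖ ^ 2 := by fun_prop
    exact (hc.tendsto y').comp hlim
  have hεφ : Tendsto (fun m => ε (φ m)) atTop (𝓝 0) := hεlim.comp hφ.tendsto_atTop
  have hl2 : Tendsto (fun m => κ * ε (φ m) ^ 2 + D * z / s₁) atTop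
      (𝓝 (κ * 0 ^ 2 + D * z / s₁)) := ((hεφ.pow 2).const_mul κ).add_const _
  have := le_of_tendsto_of_tendsto hl1 hl2 (by
    filter_upwards [hεφ.eventually_lt_const hz.1] with m hm
    exact hy (φ m) z ⟨hm.le, hz.2⟩)
  refine this.trans_eq ?_
  ring

/-- At a singular end, a solution approaching `ι w` at the rate `s^(1/2)` has a covariant
derivative with a limit. -/
theorem Regular.tendsto_of_close {L : ℝ} (hL : 0 < L) (h : Y.Regular 0 L) {U : ℝ → Mn n} {lam : ℝ}
    (he : Y.SingularEnd ι 0 (𝓝[>] 0) U lam) (hv : Y.IsSol (Ioo 0 L) v η) {w : Vn k} {K : ℝ}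
    (hK : ∀ᶠ z in 𝓝[>] (0 : ℝ), ‖v z - U z (ι w)‖ ^ 2 ≤ K * z) :
    Tendsto v (𝓝[>] 0) (𝓝 (ι w)) ∧ ∃ d, Tendsto η (𝓝[>] 0) (𝓝 d) := by
  -- In the parallel frame the connection disappears: `V' = H` and `H' = M V`.
  set V : ℝ → Vn n := fun z => star (U z) (v z) with hVdef
  set H : ℝ → Vn n := fun z => star (U z) (η z) with hHdef
  set M : ℝ → Mn n := fun z => star (U z) * Y.N z * U z with hMdef
  have hreg : ∀ᶠ z in 𝓝[>] (0 : ℝ), z ∈ Ioo 0 L := Ioo_mem_nhdsGT hL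
  have hUstar : ∀ᶠ z in 𝓝[>] (0 : ℝ), HasDerivAt (fun z => star (U z)) (star (U z) * Y.P z) z := by
    filter_upwards [he.frame, hreg] with z hz hz'
    refine hz.2.star.congr_deriv ?_
    have := h.skew z hz'
    rw [← ContinuousLinearMap.star_eq_adjoint] at this
    rw [star_neg, star_mul, this]
    exact neg_eq_iff_eq_neg.2 (mul_neg (star (U z)) (Y.P z))
  have hVd : ∀ᶠ z in 𝓝[>] (0 : ℝ), HasDerivAt V (H z) z := by
    filter_upwards [hUstar, hreg] with z hz hz'
    refine (hasDerivAt_clm_apply hz (hv z hz').1).congr_deriv ?_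
    rw [map_sub, mul_apply_eq_comp]
    exact add_sub_cancel _ _
  have hUV : ∀ᶠ z in 𝓝[>] (0 : ℝ), v z = U z (V z) ∧ η z = U z (H z) := by
    filter_upwards [he.frame] with z hz
    have h1 : U z * star (U z) = 1 := (Unitary.mem_iff.1 hz.1).2
    have h2 : ∀ x, U z (star (U z) x) = x := fun x => by
      rw [← mul_apply_eq_comp, h1, one_apply_eq_self]
    exact ⟨(h2 _).symm, (h2 _).symm⟩
  have hHd : ∀ᶠ z in 𝓝[>] (0 : ℝ), HasDerivAt H (M z (V z)) z := by
    filter_upwards [hUstar, hreg, hUV] with z hz hz' hz''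
    refine (hasDerivAt_clm_apply hz (hv z hz').2).congr_deriv ?_
    rw [map_sub, mul_apply_eq_comp, hMdef]
    simp only [mul_apply_eq_comp]
    rw [← hz''.1]
    exact add_sub_cancel _ _
  have hVb : (fun z => V z - ι w) =O[𝓝[>] (0 : ℝ)] fun z => z ^ (1 / 2 : ℝ) := by
    refine IsBigO.of_bound √K ?_
    filter_upwards [hK, he.frame, self_mem_nhdsWithin] with z hz hz' hz0
    have hz0' : 0 < z := hz0
    have h1 : star (U z) (U z (ι w)) = ι w := by
      rw [← mul_apply_eq_comp, (Unitary.mem_iff.1 hz'.1).1,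
        one_apply_eq_self]
    have h2 : V z - ι w = star (U z) (v z - U z (ι w)) := by rw [map_sub, h1]
    rw [h2, norm_star_apply_of_unitary hz'.1, Real.norm_of_nonneg (by positivity),
      ← Real.sqrt_eq_rpow]
    have h3 := Real.sqrt_le_sqrt hz
    rwa [Real.sqrt_sq (norm_nonneg _), Real.sqrt_mul' _ hz0'.le] at h3
  have hhalf : Tendsto (fun z : ℝ => z ^ (1 / 2 : ℝ)) (𝓝[>] 0) (𝓝 0) := by
    have := (Real.continuous_rpow_const (q := (1 / 2 : ℝ)) (by norm_num)).tendsto 0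
    rw [Real.zero_rpow (by norm_num)] at this
    exact this.mono_left nhdsWithin_le_nhds
  have hVlim : Tendsto V (𝓝[>] 0) (𝓝 (ι w)) := by
    have := (hVb.trans_tendsto hhalf).add_const (ι w)
    simpa using this
  have hclm : ∀ {f : ℝ → Vn n} {x : Vn n}, Tendsto f (𝓝[>] 0) (𝓝 x) →
      Tendsto (fun z => U z (f z)) (𝓝[>] 0) (𝓝 x) := fun {f x} hf => by
    have h1 := (isBoundedBilinearMap_apply (𝕜 := ℂ) (E := Vn n) (F := Vn n)).continuous.tendsto
      ((1 : Mn n), x)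
    exact h1.comp (he.frame_lim.prodMk_nhds hf)
  have hvlim : Tendsto v (𝓝[>] 0) (𝓝 (ι w)) :=
    (hclm hVlim).congr' (hUV.mono fun z hz => hz.1.symm)
  refine ⟨hvlim, ?_⟩
  set Q : Mn n := projQ ι
  set W : ℝ → Vn n := fun z => Q (V z) with hWdef
  -- `Q` annihilates the limit `ι w`, so the rate `s^(1/2)` passes to `W`. It is exactly what brings
  -- the `O(s⁻¹)` error of the potential down to an integrable `O(s^(-1/2))`.
  have hWb : W =O[𝓝[>] (0 : ℝ)] fun z => z ^ (1 / 2 : ℝ) := by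
    have h1 : W = fun z => Q (V z - ι w) := by
      ext1 z
      rw [map_sub, projQ_inj, sub_zero]
    rw [h1]
    exact (Q.isBigO_comp _ _).trans hVb
  set E : ℝ → Mn n := fun z => M z * Q - (lam * (|z - 0| ^ 2)⁻¹) • Q with hEdef
  -- Everything in `M V` apart from the leading pole: the `im ι` part, controlled by `he.off`, and
  -- the error on `ker π`, controlled by `he.pole`.
  set f : ℝ → Vn n := fun z => ((M z).comp (inj ι)) (surj ι (V z)) + E z (W z) with hfdef
  have habs : ∀ᶠ z in 𝓝[>] (0 : ℝ), |z - 0| = z := by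
    filter_upwards [self_mem_nhdsWithin] with z hz
    rw [sub_zero, abs_of_pos hz]
  have hfb : f =O[𝓝[>] (0 : ℝ)] fun s => s ^ (-(1 / 2) : ℝ) := by
    refine IsBigO.add ?_ ?_
    · have h1 : (fun z => surj ι (V z)) =O[𝓝[>] (0 : ℝ)] fun _ => (1 : ℝ) :=
        (((surj ι).continuous.tendsto _).comp hVlim).isBigO_one ℝ
      refine (isBigO_clm_apply he.off h1).congr' EventuallyEq.rfl ?_
      filter_upwards [habs] with z hz
      rw [hz, mul_one]
    · refine (isBigO_clm_apply he.pole hWb).congr' EventuallyEq.rfl ?_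
      filter_upwards [habs, self_mem_nhdsWithin] with z hz hz0
      rw [hz, ← Real.rpow_neg_one, ← Real.rpow_add hz0]
      norm_num
  have hMV : ∀ᶠ z in 𝓝[>] (0 : ℝ), M z (V z) = (lam * (z ^ 2)⁻¹) • W z + f z := by
    filter_upwards [habs] with z hz
    have h1 : E z (W z) = M z (W z) - (lam * (z ^ 2)⁻¹) • W z := by
      have hQW : Q (W z) = W z := projQ_projQ ι (V z)
      simp only [hEdef, hz]
      rw [sub_apply, mul_apply_eq_comp, hQW,
        smul_apply, hQW]
    have h2 : M z (V z) = M z (ι (surj ι (V z))) + M z (W z) := by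
      rw [← map_add, inj_surj_add_projQ]
    rw [h2, hfdef]
    simp only [h1, ContinuousLinearMap.comp_apply, inj_apply]
    abel
  have hWd : ∀ᶠ z in 𝓝[>] (0 : ℝ), HasDerivAt W (Q (H z)) z :=
    hVd.mono fun z hz => hasDerivAt_clm_const_apply Q hz
  have hQHd : ∀ᶠ z in 𝓝[>] (0 : ℝ),
      HasDerivAt (fun z => Q (H z)) ((lam * (z ^ 2)⁻¹) • W z + Q (f z)) z := by
    filter_upwards [hHd, hMV] with z hz hz'
    have hQW : Q (W z) = W z := projQ_projQ ι (V z)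
    refine (hasDerivAt_clm_const_apply Q hz).congr_deriv ?_
    rw [hz', map_add, ContinuousLinearMap.map_smul_of_tower, hQW]
  have hsHd : ∀ᶠ z in 𝓝[>] (0 : ℝ), HasDerivAt (fun z => surj ι (H z)) (surj ι (f z)) z := by
    filter_upwards [hHd, hMV] with z hz hz'
    have hQW : surj ι (W z) = 0 := surj_projQ ι (V z)
    refine (hasDerivAt_clm_const_apply (surj ι) hz).congr_deriv ?_
    rw [hz', map_add, ContinuousLinearMap.map_smul_of_tower, hQW, smul_zero, zero_add]
  obtain ⟨d₁, hd₁⟩ := exists_tendsto_of_deriv_isBigO hsHd (((surj ι).isBigO_comp _ _).trans hfb)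
  obtain ⟨d₂, hd₂⟩ : ∃ d, Tendsto (fun z => Q (H z)) (𝓝[>] 0) (𝓝 d) := by
    have hQf := (Q.isBigO_comp f (𝓝[>] (0 : ℝ))).trans hfb
    -- For `λ = 0` the pole is absent and `Q H` has an integrable derivative; for `λ > 0` the
    -- indicial analysis applies and the limit is `0`.
    rcases he.lam_nonneg.eq_or_lt with h0 | h0
    · refine exists_tendsto_of_deriv_isBigO (f' := fun z => Q (f z)) ?_ hQf
      filter_upwards [hQHd] with z hz
      simpa [← h0] using hz
    · exact ⟨0, tendsto_deriv_of_singular h0 hWd hQHd hQf (hWb.trans (hhalf.isBigO_one ℝ))⟩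
  have hHlim : Tendsto H (𝓝[>] 0) (𝓝 (ι d₁ + d₂)) := by
    have h1 := ((ι.continuous.tendsto d₁).comp hd₁).add hd₂
    refine h1.congr fun z => ?_
    exact inj_surj_add_projQ ι (H z)
  exact ⟨_, (hclm hHlim).congr' (hUV.mono fun z hz => hz.2.symm)⟩

end ODESystem

end

/-! ### Transport of the results from `0` to both ends of an interval. -/

noncomputable section

namespace ODESystem

variable {k n : ℕ} {Y : ODESystem n} {a b : ℝ} {v η : ℝ → Vn n} {ι : Vn k →ₗᵢ[ℂ] Vn n}

/-- The system in the variable `s`, where `z = c + σ s` and `σ = ± 1`. -/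
def reparam (Y : ODESystem n) (c σ : ℝ) : ODESystem n :=
  ⟨fun s => σ • Y.P (c + σ * s), fun i s => Y.S i (c + σ * s)⟩

theorem reparam_N (Y : ODESystem n) (c σ s : ℝ) : (Y.reparam c σ).N s = Y.N (c + σ * s) := rfl

theorem hasDerivAt_affine (c σ s : ℝ) : HasDerivAt (fun s => c + σ * s) σ s := by
  simpa using ((hasDerivAt_id s).const_mul σ).const_add c

theorem Regular.reparam {c σ L : ℝ} (h : Y.Regular a b)
    (hmap : ∀ s ∈ Ioo 0 L, c + σ * s ∈ Ioo a b) : (Y.reparam c σ).Regular 0 L := by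
  have hc : ContinuousOn (fun s => c + σ * s) (Ioo 0 L) := by fun_prop
  refine ⟨(h.contP.comp hc hmap).const_smul σ, fun i => (h.contS i).comp hc hmap, fun s hs => ?_⟩
  change ContinuousLinearMap.adjoint (σ • Y.P (c + σ * s)) = -(σ • Y.P (c + σ * s))
  have h1 : σ • Y.P (c + σ * s) = (σ : ℂ) • Y.P (c + σ * s) := by
    ext v i
    simp
  rw [h1, map_smulₛₗ, h.skew _ (hmap s hs), Complex.conj_ofReal]
  exact smul_neg (σ : ℂ) (Y.P (c + σ * s))

/-- The estimates involve only `|z - c|`, so reflections are allowed as well as translations, and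
one analysis at `0` serves both ends. -/
theorem SingularEnd.reparam {c σ lam : ℝ} {l : Filter ℝ} {U : ℝ → Mn n} (hσ : |σ| = 1)
    (he : Y.SingularEnd ι c l U lam) (hl : Tendsto (fun s => c + σ * s) (𝓝[>] 0) l) :
    (Y.reparam c σ).SingularEnd ι 0 (𝓝[>] 0) (fun s => U (c + σ * s)) lam := by
  have habs : ∀ s : ℝ, |c + σ * s - c| = |s - 0| := fun s => by
    rw [add_sub_cancel_left, abs_mul, hσ, one_mul, sub_zero]
  refine ⟨?_, he.frame_lim.comp hl, he.lam_nonneg, fun i => (he.bdd i).comp_tendsto hl, ?_, ?_⟩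
  · filter_upwards [hl.eventually he.frame] with s hs
    refine ⟨hs.1, (hs.2.scomp s (hasDerivAt_affine c σ s)).congr_deriv ?_⟩
    change σ • (-(Y.P (c + σ * s) * U (c + σ * s))) = -(σ • Y.P (c + σ * s) * U (c + σ * s))
    exact smul_neg σ (Y.P (c + σ * s) * U (c + σ * s))
  · have := he.off.comp_tendsto hl
    simp only [Function.comp_def, habs] at this
    exact this
  · have := he.pole.comp_tendsto hl
    simp only [Function.comp_def, habs] at this
    exact this

/-- `d/ds = σ d/dz`, so the covariant derivative and `P` acquire a factor `σ`; the second order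
equation keeps its potential since `σ² = 1`. -/
theorem IsSol.of_reparam {c σ L : ℝ} (hσ : σ * σ = 1)
    (hv : (Y.reparam c σ).IsSol (Ioo 0 L) v η) :
    Y.IsSol {z | σ * (z - c) ∈ Ioo 0 L} (fun z => v (σ * (z - c)))
      (fun z => σ • η (σ * (z - c))) := by
  intro z hz
  have hz' : c + σ * (σ * (z - c)) = z := by
    rw [← mul_assoc, hσ]; ring
  have hd : HasDerivAt (fun z => σ * (z - c)) σ z := by
    simpa using ((hasDerivAt_id z).sub_const c).const_mul σ
  obtain ⟨h1, h2⟩ := hv _ hz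
  rw [reparam_N, hz'] at h2
  have hP : (Y.reparam c σ).P (σ * (z - c)) = σ • Y.P z := by
    change σ • Y.P (c + σ * (σ * (z - c))) = _
    rw [hz']
  rw [hP] at h1 h2
  refine ⟨(h1.scomp z hd).congr_deriv ?_, ((h2.scomp z hd).const_smul σ).congr_deriv ?_⟩
  · rw [smul_sub, smul_apply, smul_smul, hσ, one_smul]
  · rw [smul_smul, hσ, one_smul, smul_apply, ContinuousLinearMap.map_smul_of_tower]

theorem Regular.exists_sol_reparam {c σ lam : ℝ} {l : Filter ℝ} {U : ℝ → Mn n} (hσ : |σ| = 1)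
    (hab : a < b) (h : Y.Regular a b) (he : Y.SingularEnd ι c l U lam)
    (hl : Tendsto (fun s => c + σ * s) (𝓝[>] 0) l)
    (hl' : Tendsto (fun z => σ * (z - c)) l (𝓝[>] 0))
    (hmap : ∀ s ∈ Ioo 0 (b - a), c + σ * s ∈ Ioo a b)
    (hmap' : ∀ z ∈ Ioo a b, σ * (z - c) ∈ Ioo 0 (b - a)) {z₀ : ℝ} (hz₀ : z₀ ∈ Ioo a b)
    (u : Vn n) (w : Vn k) :
    ∃ v η, Y.IsSol (Ioo a b) v η ∧ v z₀ = u ∧ Tendsto v l (𝓝 (ι w)) ∧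
      ∃ d, Tendsto η l (𝓝 d) := by
  have hσ2 : σ * σ = 1 := by rw [← abs_mul_abs_self, hσ, one_mul]
  have hR := h.reparam hmap
  have hE := he.reparam hσ hl
  obtain ⟨v, η, hv, hv0, K, hK⟩ := hR.exists_sol_close hE (hmap' z₀ hz₀) u w
  obtain ⟨hlim, d, hd⟩ := hR.tendsto_of_close (sub_pos.2 hab) hE hv hK
  exact ⟨_, _, (IsSol.of_reparam hσ2 hv).mono hmap', hv0, hlim.comp hl', σ • d,
    (hd.comp hl').const_smul σ⟩

/-- Solutions with a given value at an inner point and a given limit at a singular right end. -/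
theorem Regular.exists_sol_right {lam : ℝ} {U : ℝ → Mn n} (h : Y.Regular a b)
    (he : Y.SingularEnd ι b (𝓝[<] b) U lam) {z₀ : ℝ} (hz₀ : z₀ ∈ Ioo a b) (u : Vn n) (w : Vn k) :
    ∃ v η, Y.IsSol (Ioo a b) v η ∧ v z₀ = u ∧ Tendsto v (𝓝[<] b) (𝓝 (ι w)) ∧
      ∃ d, Tendsto η (𝓝[<] b) (𝓝 d) := by
  refine h.exists_sol_reparam (σ := -1) (by simp) (hz₀.1.trans hz₀.2) he ?_ ?_
    (fun s hs => ⟨by linarith [hs.2], by linarith [hs.1]⟩)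
    (fun z hz => ⟨by linarith [hz.2], by linarith [hz.1]⟩) hz₀ u w
  · refine tendsto_nhdsWithin_of_tendsto_nhds_of_eventually_within _ ?_ ?_
    · have : Continuous fun s : ℝ => b + -1 * s := by fun_prop
      simpa using (this.tendsto 0).mono_left nhdsWithin_le_nhds
    · filter_upwards [self_mem_nhdsWithin] with s hs
      have : 0 < s := hs
      exact mem_Iio.2 (by linarith)
  · refine tendsto_nhdsWithin_of_tendsto_nhds_of_eventually_within _ ?_ ?_
    · have : Continuous fun s : ℝ => -1 * (s - b) := by fun_prop
      simpa using (this.tendsto b).mono_left nhdsWithin_le_nhds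
    · filter_upwards [self_mem_nhdsWithin] with s hs
      have : s < b := hs
      exact mem_Ioi.2 (by linarith)

/-- Solutions with a given value at an inner point and a given limit at a singular left end. -/
theorem Regular.exists_sol_left {lam : ℝ} {U : ℝ → Mn n} (h : Y.Regular a b)
    (he : Y.SingularEnd ι a (𝓝[>] a) U lam) {z₀ : ℝ} (hz₀ : z₀ ∈ Ioo a b) (u : Vn n) (w : Vn k) :
    ∃ v η, Y.IsSol (Ioo a b) v η ∧ v z₀ = u ∧ Tendsto v (𝓝[>] a) (𝓝 (ι w)) ∧
      ∃ d, Tendsto η (𝓝[>] a) (𝓝 d) := by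
  refine h.exists_sol_reparam (σ := 1) (by simp) (hz₀.1.trans hz₀.2) he ?_ ?_
    (fun s hs => ⟨by linarith [hs.1], by linarith [hs.2]⟩)
    (fun z hz => ⟨by linarith [hz.1], by linarith [hz.2]⟩) hz₀ u w
  · refine tendsto_nhdsWithin_of_tendsto_nhds_of_eventually_within _ ?_ ?_
    · have : Continuous fun s : ℝ => a + 1 * s := by fun_prop
      simpa using (this.tendsto 0).mono_left nhdsWithin_le_nhds
    · filter_upwards [self_mem_nhdsWithin] with s hs
      have : 0 < s := hs
      exact mem_Ioi.2 (by linarith)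
  · refine tendsto_nhdsWithin_of_tendsto_nhds_of_eventually_within _ ?_ ?_
    · have : Continuous fun s : ℝ => 1 * (s - a) := by fun_prop
      simpa using (this.tendsto a).mono_left nhdsWithin_le_nhds
    · filter_upwards [self_mem_nhdsWithin] with s hs
      have : a < s := hs
      exact mem_Ioi.2 (by linarith)

end ODESystem

/-! ### The Casimir operator of the residues. -/

section Casimir

variable {k n : ℕ} {ι : Vn k →ₗᵢ[ℂ] Vn n} {ρ : Fin 3 → Mn n}

theorem mem_ker_surj {v : Vn n} : v ∈ LinearMap.ker (surj ι).toLinearMap ↔ surj ι v = 0 :=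
  LinearMap.mem_ker

theorem IsIrredSU2.apply_projQ (h : IsIrredSU2 ι ρ) (i : Fin 3) (v : Vn n) :
    ρ i (projQ ι v) = ρ i v := by
  have h1 : ρ i v = projQ ι (ρ i (projQ ι v)) := by
    conv_lhs => rw [← h.supp i]
    rfl
  have h2 : ρ i (projQ ι v) = projQ ι (ρ i (projQ ι (projQ ι v))) := by
    conv_lhs => rw [← h.supp i]
    rfl
  rw [h2, h1, projQ_projQ]

theorem IsIrredSU2.surj_apply (h : IsIrredSU2 ι ρ) (i : Fin 3) (v : Vn n) :
    surj ι (ρ i v) = 0 := by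
  have h1 : ρ i v = projQ ι (ρ i (projQ ι v)) := by
    conv_lhs => rw [← h.supp i]
    rfl
  rw [h1, surj_projQ]

/-- The Casimir operator commutes with the representation. -/
theorem casimir_commute {R : Type*} [Ring R] {e : Fin 3 → R}
    (h : ∀ i : Fin 3, ⁅e i, e (i + 1)⁆ = -e (i + 2)) (i : Fin 3) :
    (∑ l, e l * e l) * e i = e i * ∑ l, e l * e l := by
  have h0 : e 0 * e 1 - e 1 * e 0 = -e 2 := h 0
  have h1 : e 1 * e 2 - e 2 * e 1 = -e 0 := h 1
  have h2 : e 2 * e 0 - e 0 * e 2 = -e 1 := h 2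
  rw [Fin.sum_univ_three]
  fin_cases i
  · change _ * e 0 = e 0 * _
    linear_combination (norm := noncomm_ring) -(e 1 * h0) - h0 * e 1 + e 2 * h2 + h2 * e 2
  · change _ * e 1 = e 1 * _
    linear_combination (norm := noncomm_ring) -(e 2 * h1) - h1 * e 2 + e 0 * h0 + h0 * e 0
  · change _ * e 2 = e 2 * _
    linear_combination (norm := noncomm_ring) -(e 0 * h2) - h2 * e 0 + e 1 * h1 + h1 * e 1

/-- For an irreducible representation of `su(2)` by skew-adjoint endomorphisms the Casimir operator
is a nonpositive scalar. -/
theorem IsIrredSU2.exists_casimir (h : IsIrredSU2 ι ρ) (hkn : k < n)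
    (hskew : ∀ i, ContinuousLinearMap.adjoint (ρ i) = -ρ i) :
    ∃ lam : ℝ, 0 ≤ lam ∧ ∑ i, ρ i * ρ i = -(lam • projQ ι) := by
  set C : Mn n := ∑ i, ρ i * ρ i with hC
  set Z : Submodule ℂ (Vn n) := LinearMap.ker (surj ι).toLinearMap with hZ
  have hCapp : ∀ v, C v = ∑ i, ρ i (ρ i v) := fun v => by simp [hC]
  have hCZ : ∀ v, surj ι (C v) = 0 := fun v => by
    rw [hCapp, map_sum]
    exact Finset.sum_eq_zero fun i _ => h.surj_apply i _
  have hcomm : ∀ i v, C (ρ i v) = ρ i (C v) := fun i v =>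
    congrArg (fun A : Mn n => A v) (casimir_commute h.bracket i)
  have hZnt : Nontrivial Z := by
    rw [Submodule.nontrivial_iff_ne_bot]
    exact LinearMap.ker_ne_bot_of_finrank_lt (by simpa using hkn)
  set f : Z →ₗ[ℂ] Z := C.toLinearMap.restrict (fun v _ => mem_ker_surj.2 (hCZ v)) with hf
  obtain ⟨μ, hμ⟩ := Module.End.exists_eigenvalue f
  obtain ⟨x, hx⟩ := hμ.exists_hasEigenvector
  have hx0 : (x : Vn n) ≠ 0 := fun h0 => hx.2 (Subtype.ext h0)
  have hCx : C x = μ • (x : Vn n) := congrArg Subtype.val hx.apply_eq_smul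
  -- Schur's lemma: an eigenspace of the Casimir operator inside `ker π` is invariant, nonzero,
  -- hence all of `ker π`.
  have hinv : ∀ i, ∀ v ∈ Z ⊓ LinearMap.ker (C.toLinearMap - μ • LinearMap.id),
      ρ i v ∈ Z ⊓ LinearMap.ker (C.toLinearMap - μ • LinearMap.id) := fun i v hv => by
    refine ⟨mem_ker_surj.2 (h.surj_apply i v), LinearMap.mem_ker.2 ?_⟩
    have h1 : C v - μ • v = 0 := LinearMap.mem_ker.1 hv.2
    change C (ρ i v) - μ • ρ i v = 0
    rw [hcomm, ← map_smul, ← map_sub, h1, map_zero]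
  have hall : ∀ v, surj ι v = 0 → C v = μ • v := by
    rcases h.irred _ inf_le_left hinv with h0 | h0
    · exfalso
      have : (x : Vn n) ∈ (⊥ : Submodule ℂ (Vn n)) := by
        rw [← h0]
        refine ⟨x.2, LinearMap.mem_ker.2 ?_⟩
        change C x - μ • (x : Vn n) = 0
        rw [hCx, sub_self]
      exact hx0 ((Submodule.mem_bot ℂ).1 this)
    · intro v hv
      have : v ∈ Z ⊓ LinearMap.ker (C.toLinearMap - μ • LinearMap.id) := by
        rw [h0]; exact mem_ker_surj.2 hv
      exact sub_eq_zero.1 (LinearMap.mem_ker.1 this.2 : C v - μ • v = 0)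
  have hxn : ‖(x : Vn n)‖ ^ 2 ≠ 0 := by simpa using hx0
  -- Evaluating `⟨x, C x⟩` through the skewness of the `ρ i` identifies the eigenvalue as a
  -- nonpositive real number.
  have hinner : (μ : ℂ) * (‖(x : Vn n)‖ ^ 2 : ℝ) = -((∑ i, ‖ρ i x‖ ^ 2 : ℝ) : ℂ) := by
    have e1 : inner ℂ (x : Vn n) (C x) = μ * (‖(x : Vn n)‖ ^ 2 : ℝ) := by
      rw [hCx, inner_smul_right, inner_self_eq_norm_sq_to_K, Complex.ofReal_pow]
      rfl
    have e2 : inner ℂ (x : Vn n) (C x) = -((∑ i, ‖ρ i x‖ ^ 2 : ℝ) : ℂ) := by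
      rw [hCapp, inner_sum, Complex.ofReal_sum, ← Finset.sum_neg_distrib]
      refine Finset.sum_congr rfl fun i _ => ?_
      rw [← ContinuousLinearMap.adjoint_inner_left, hskew, neg_apply, inner_neg_left,
        inner_self_eq_norm_sq_to_K]
      norm_cast
    rw [← e1, e2]
  refine ⟨(∑ i, ‖ρ i x‖ ^ 2) / ‖(x : Vn n)‖ ^ 2,
    div_nonneg (Finset.sum_nonneg fun i _ => sq_nonneg _) (sq_nonneg _), ?_⟩
  have hμ' : μ = -(((∑ i, ‖ρ i x‖ ^ 2) / ‖(x : Vn n)‖ ^ 2 : ℝ) : ℂ) := by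
    rw [Complex.ofReal_div, ← neg_div, ← hinner, mul_div_cancel_right₀]
    exact_mod_cast hxn
  refine ContinuousLinearMap.ext fun v => ?_
  have h1 : C v = C (projQ ι v) := by
    rw [hCapp, hCapp]
    exact Finset.sum_congr rfl fun i _ => by rw [h.apply_projQ]
  have h2 : ∀ (c : ℝ) (w : Vn n), (-(c : ℂ)) • w = -(c • w) := fun c w => by
    ext i
    simp
  rw [h1, hall _ (surj_projQ ι v), hμ', h2]
  rfl

/-- A one-dimensional representation of `su(2)` is trivial. -/
theorem IsIrredSU2.eq_zero (h : IsIrredSU2 ι ρ) (hkn : n = k + 1) (i : Fin 3) : ρ i = 0 := by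
  have hsurj : Function.Surjective (surj ι).toLinearMap := fun u => ⟨ι u, surj_inj ι u⟩
  have hrank : Module.finrank ℂ (LinearMap.ker (surj ι).toLinearMap) = 1 := by
    have := LinearMap.finrank_range_add_finrank_ker (surj ι).toLinearMap
    rw [LinearMap.range_eq_top.2 hsurj, finrank_top] at this
    simp only [finrank_euclideanSpace, Fintype.card_fin] at this
    omega
  obtain ⟨x, -, hx⟩ := finrank_eq_one_iff'.1 hrank
  have hx' : ∀ v, surj ι v = 0 → ∃ c : ℂ, v = c • (x : Vn n) := fun v hv => by
    obtain ⟨c, hc⟩ := hx ⟨v, mem_ker_surj.2 hv⟩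
    exact ⟨c, (congrArg Subtype.val hc).symm⟩
  -- On a line all operators are scalars and commute, so the bracket relation makes each of them
  -- vanish.
  choose c hc using fun i => hx' (ρ i x) (h.surj_apply i x)
  have hzero : ρ i x = 0 := by
    have e : i + 1 + 2 = i := by fin_cases i <;> rfl
    have h1 := congrArg (fun A : Mn n => A x) (h.bracket (i + 1))
    rw [e] at h1
    have h2 : ρ (i + 1) (ρ (i + 1 + 1) x) - ρ (i + 1 + 1) (ρ (i + 1) x) = -ρ i x := h1
    rw [hc (i + 1 + 1), hc (i + 1), map_smul, map_smul, hc (i + 1), hc (i + 1 + 1), smul_comm,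
      sub_self] at h2
    exact neg_eq_zero.1 h2.symm
  refine ContinuousLinearMap.ext fun v => ?_
  obtain ⟨d, hd⟩ := hx' (projQ ι v) (surj_projQ ι v)
  rw [← h.apply_projQ, hd, map_smul, hzero, smul_zero, zero_apply]

end Casimir

end

/-! ### The boundary condition produces a singular end. -/

noncomputable section

section RpowBigO

variable {α E F G : Type*} [NormedAddCommGroup E] [NormedSpace ℂ E] [NormedAddCommGroup F]
  [NormedSpace ℂ F] [NormedAddCommGroup G] [NormedSpace ℂ G] {l : Filter α} {p : α → ℝ}

theorem isBigO_comp_rpow (hp : ∀ᶠ z in l, 0 < p z) {L : α → F →L[ℂ] G} {L' : α → E →L[ℂ] F}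
    {r s t : ℝ} (ht : r + s = t) (hL : L =O[l] fun z => p z ^ r)
    (hL' : L' =O[l] fun z => p z ^ s) :
    (fun z => (L z).comp (L' z)) =O[l] fun z => p z ^ t := by
  have h1 : (fun z => (L z).comp (L' z)) =O[l] fun z => ‖L z‖ * ‖L' z‖ :=
    IsBigO.of_bound 1 (Eventually.of_forall fun z => by
      rw [one_mul, Real.norm_of_nonneg (by positivity)]
      exact (L z).opNorm_comp_le (L' z))
  refine (h1.trans (hL.norm_left.mul hL'.norm_left)).congr' EventuallyEq.rfl ?_
  filter_upwards [hp] with z hz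
  rw [← Real.rpow_add hz, ht]

theorem isBigO_rpow_rpow (hp : ∀ᶠ z in l, 0 < p z) (hp' : ∀ᶠ z in l, p z ≤ 1) {r s : ℝ}
    (hrs : r ≤ s) : (fun z => p z ^ s) =O[l] fun z => p z ^ r := by
  refine IsBigO.of_bound 1 ?_
  filter_upwards [hp, hp'] with z hz hz'
  rw [one_mul, Real.norm_of_nonneg (by positivity), Real.norm_of_nonneg (by positivity)]
  exact Real.rpow_le_rpow_of_exponent_ge hz hz' hrs

end RpowBigO

/-- The system `(d/dz + P)² v = ∑ Sᵢ* Sᵢ v` with `P = T₀ - i μ₀ x₀` and `Sᵢ = Tᵢ - i xᵢ`, which is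
the equation `D₁* D₁ v = 0` for a solution `T` of Nahm's equations. -/
def nahmSystem {n : ℕ} (μ₀ : ℝ) (T : Fin 4 → ℝ → Mn n) (x : Fin 4 → ℝ) : ODESystem n :=
  ⟨fun z => T 0 z - (Complex.I * ((μ₀ * x 0 : ℝ) : ℂ)) • (1 : Mn n),
    fun i z => T i.succ z - (Complex.I * ((x i.succ : ℝ) : ℂ)) • (1 : Mn n)⟩

theorem adjoint_sub_I_smul_one {n : ℕ} {A : Mn n} (hA : ContinuousLinearMap.adjoint A = -A)
    (r : ℝ) : ContinuousLinearMap.adjoint (A - (Complex.I * (r : ℂ)) • (1 : Mn n))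
      = -(A - (Complex.I * (r : ℂ)) • (1 : Mn n)) := by
  rw [map_sub, map_smulₛₗ, hA]
  have : ContinuousLinearMap.adjoint (1 : Mn n) = 1 := by
    rw [← ContinuousLinearMap.star_eq_adjoint, star_one]
  rw [this]
  ext v i
  simp
  ring

section Blocks

variable {k n : ℕ} (ι : Vn k →ₗᵢ[ℂ] Vn n)

theorem apply_projQ_eq_blocks (G : Mn n) (v : Vn n) :
    G (projQ ι v) = ι (surj ι (G (projQ ι v))) + (projQ ι * G * projQ ι) v :=
  (inj_surj_add_projQ ι (G (projQ ι v))).symm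

/-- Writing the `ker π` block as `E + r ρ` isolates `r² ρ²`. With `r = (z - c)⁻¹` and `E` bounded
this is the only double pole; every other term will turn out to be `O(|z - c|⁻¹)`. -/
theorem sq_apply_projQ (G ρ : Mn n) (r : ℝ) (v : Vn n) :
    G (G (projQ ι v)) = G (ι (surj ι (G (projQ ι v))))
      + ι (surj ι (G (projQ ι ((projQ ι * G * projQ ι) v))))
      + (projQ ι * G * projQ ι - r • ρ) ((projQ ι * G * projQ ι - r • ρ) v)
      + r • (ρ ((projQ ι * G * projQ ι - r • ρ) v) + (projQ ι * G * projQ ι - r • ρ) (ρ v))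
      + (r * r) • ρ (ρ v) := by
  set D : Mn n := projQ ι * G * projQ ι with hD
  set E : Mn n := D - r • ρ with hE
  have hDE : ∀ w, D w = E w + r • ρ w := fun w => by
    rw [hE, sub_apply, smul_apply, sub_add_cancel]
  have hQD : projQ ι (D v) = D v := projQ_projQ ι _
  have h1 : G (projQ ι v) = ι (surj ι (G (projQ ι v))) + D v := apply_projQ_eq_blocks ι G v
  have h2 : G (D v) = ι (surj ι (G (projQ ι (D v)))) + D (D v) := by
    conv_lhs => rw [← hQD]
    exact apply_projQ_eq_blocks ι G (D v)
  have h3 : D (D v) = E (E v) + r • (ρ (E v) + E (ρ v)) + (r * r) • ρ (ρ v) := by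
    rw [hDE (D v), hDE v, map_add, map_add, ContinuousLinearMap.map_smul_of_tower,
      ContinuousLinearMap.map_smul_of_tower]
    module
  conv_lhs => rw [h1, map_add, h2, h3]
  module

/-- The same expansion with the remainder as a single operator, the form needed for norm estimates.
-/
theorem sq_apply_projQ_comp (G ρ : Mn n) (r : ℝ) (v : Vn n) :
    G (G (projQ ι v)) = ((G.comp (inj ι)).comp ((surj ι).comp (G.comp (projQ ι)))
        + ((inj ι).comp ((surj ι).comp (G.comp (projQ ι)))).comp (projQ ι * G * projQ ι)
        + (projQ ι * G * projQ ι - r • ρ).comp (projQ ι * G * projQ ι - r • ρ)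
        + r • (ρ.comp (projQ ι * G * projQ ι - r • ρ)
          + (projQ ι * G * projQ ι - r • ρ).comp ρ)) v + (r * r) • ρ (ρ v) := by
  rw [sq_apply_projQ ι G ρ r v]
  generalize projQ ι * G * projQ ι - r • ρ = E
  generalize projQ ι * G * projQ ι = D
  rfl

/-- Only the last term, the `ker π` block applied to the off-diagonal one, can be unbounded at the
pole; the decay of the off-diagonal block has to compensate for it. -/
theorem sq_apply_inj (G : Mn n) (u : Vn k) :
    G (G (ι u)) = G (ι (surj ι (G (ι u)))) + ι (surj ι (G (projQ ι (projQ ι (G (ι u))))))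
      + (projQ ι * G * projQ ι) (projQ ι (G (ι u))) := by
  have h1 := inj_surj_add_projQ ι (G (ι u))
  have h2 := apply_projQ_eq_blocks ι G (projQ ι (G (ι u)))
  conv_lhs => rw [← h1, map_add, ← projQ_projQ, h2]
  module

end Blocks

set_option maxHeartbeats 1000000 in
/-- The singular behaviour of `D₁* D₁` at an end of the large interval. -/
theorem LargeSideBC.singularEnd {k j : ℕ} (hj : 0 < j) {T : Fin 4 → ℝ → Mn (k + j)}
    {ι : Vn k →ₗᵢ[ℂ] Vn (k + j)} {Tlim : Fin 3 → Mn k} {c : ℝ} {l : Filter ℝ} [NeBot l]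
    (h : LargeSideBC j T ι Tlim c l) (hl : l ≤ 𝓝[≠] c)
    (hskew : ∀ᶠ z in l, ∀ i, ContinuousLinearMap.adjoint (T i z) = -T i z) (μ₀ : ℝ)
    (x : Fin 4 → ℝ) : ∃ U lam, (nahmSystem μ₀ T x).SingularEnd ι c l U lam := by
  obtain ⟨U, ρ, hU, hUlim, hρ, hT⟩ := h
  set Q : Mn (k + j) := projQ ι with hQdef
  set Y := nahmSystem μ₀ T x with hY
  set p : ℝ → ℝ := fun z => |z - c| with hpdef
  have hplim : Tendsto p l (𝓝 0) := by
    have : Continuous p := by fun_prop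
    have h0 : p c = 0 := by simp [hpdef]
    have h1 := this.tendsto c
    rw [h0] at h1
    exact h1.mono_left (hl.trans nhdsWithin_le_nhds)
  have hne : ∀ᶠ z in l, z - c ≠ 0 := by
    filter_upwards [hl self_mem_nhdsWithin] with z hz using sub_ne_zero.2 hz
  have hp0 : ∀ᶠ z in l, 0 < p z := hne.mono fun z hz => abs_pos.2 hz
  have hp1 : ∀ᶠ z in l, p z ≤ 1 := (hplim.eventually_lt_const one_pos).mono fun z hz => hz.le
  set e : ℝ := ((j : ℝ) - 1) / 2 with he
  have he0 : 0 ≤ e := by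
    have : (1 : ℝ) ≤ j := by exact_mod_cast hj
    rw [he]; linarith
  have hmono : ∀ {r s : ℝ}, r ≤ s → (fun z => p z ^ s) =O[l] fun z => p z ^ r :=
    fun hrs => isBigO_rpow_rpow hp0 hp1 hrs
  have hone : (fun _ : ℝ => (1 : ℝ)) = fun z => p z ^ (0 : ℝ) := by simp
  have hconst : ∀ {a b : ℕ} (A : Vn a →L[ℂ] Vn b),
      (fun _ : ℝ => A) =O[l] fun z => p z ^ (0 : ℝ) := fun A => by
    rw [← hone]; exact isBigO_const_const A one_ne_zero l
  set X : Fin 3 → ℝ → Mn (k + j) := fun i z => star (U z) * T i.succ z * U z with hX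
  set G : Fin 3 → ℝ → Mn (k + j) :=
    fun i z => X i z - (Complex.I * ((x i.succ : ℝ) : ℂ)) • (1 : Mn (k + j)) with hG
  have hpG : ∀ i, (fun z => (surj ι).comp ((G i z).comp (inj ι))) =O[l]
      fun z => p z ^ (0 : ℝ) := fun i => by
    have h1 : (fun z => (surj ι).comp ((X i z).comp (inj ι))) =O[l] fun z => p z ^ (0 : ℝ) := by
      rw [← hone]; exact (hT i).1.isBigO_one ℝ
    refine (h1.sub (hconst ((Complex.I * ((x i.succ : ℝ) : ℂ)) • (surj ι).comp (inj ι)))).congr'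
      (Eventually.of_forall fun z => ?_) EventuallyEq.rfl
    refine ContinuousLinearMap.ext fun v => ?_
    change surj ι (X i z (ι v)) - (Complex.I * ((x i.succ : ℝ) : ℂ)) • surj ι (ι v)
      = surj ι (X i z (ι v) - (Complex.I * ((x i.succ : ℝ) : ℂ)) • ι v)
    rw [map_sub, map_smul]
  have hB : ∀ i, (fun z => (surj ι).comp ((G i z).comp Q)) =O[l] fun z => p z ^ e := fun i => by
    refine (hT i).2.1.congr' (Eventually.of_forall fun z => ?_) EventuallyEq.rfl
    refine ContinuousLinearMap.ext fun v => ?_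
    change surj ι (X i z (Q v))
      = surj ι (X i z (Q v) - (Complex.I * ((x i.succ : ℝ) : ℂ)) • Q v)
    rw [map_sub, map_smul, surj_projQ, smul_zero, sub_zero]
  have hC : ∀ i, (fun z => Q.comp ((G i z).comp (inj ι))) =O[l] fun z => p z ^ e := fun i => by
    refine (hT i).2.2.1.congr' (Eventually.of_forall fun z => ?_) EventuallyEq.rfl
    refine ContinuousLinearMap.ext fun v => ?_
    change Q (X i z (ι v)) = Q (X i z (ι v) - (Complex.I * ((x i.succ : ℝ) : ℂ)) • ι v)
    rw [map_sub, map_smul, projQ_inj, smul_zero, sub_zero]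
  have hE : ∀ i, (fun z => Q * G i z * Q - (z - c)⁻¹ • ρ i) =O[l] fun z => p z ^ (0 : ℝ) :=
    fun i => by
    have h1 := (hT i).2.2.2
    rw [hone] at h1
    refine (h1.sub (hconst ((Complex.I * ((x i.succ : ℝ) : ℂ)) • Q))).congr'
      (Eventually.of_forall fun z => ?_) EventuallyEq.rfl
    refine ContinuousLinearMap.ext fun v => ?_
    change Q (X i z (Q v)) - (z - c)⁻¹ • ρ i v - (Complex.I * ((x i.succ : ℝ) : ℂ)) • Q v
      = Q (X i z (Q v) - (Complex.I * ((x i.succ : ℝ) : ℂ)) • Q v) - (z - c)⁻¹ • ρ i v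
    rw [map_sub, map_smul, projQ_projQ, sub_right_comm]
  have hinvp : (fun z => (z - c)⁻¹) =O[l] fun z => p z ^ (-1 : ℝ) := by
    refine IsBigO.of_bound 1 (hp0.mono fun z hz => ?_)
    rw [one_mul, Real.rpow_neg_one, norm_inv, norm_inv, Real.norm_eq_abs, Real.norm_eq_abs,
      hpdef, abs_abs]
  have hsm : ∀ {L : ℝ → Mn (k + j)}, L =O[l] (fun z => p z ^ (0 : ℝ)) →
      (fun z => (z - c)⁻¹ • L z) =O[l] fun z => p z ^ (-1 : ℝ) := fun hL => by
    refine (hinvp.smul hL).congr' EventuallyEq.rfl (hp0.mono fun z hz => ?_)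
    simp
  have hD : ∀ i, (fun z => Q * G i z * Q) =O[l] fun z => p z ^ (-1 : ℝ) := fun i => by
    refine (((hE i).trans (hmono (by norm_num))).add (hsm (hconst (ρ i)))).congr'
      (Eventually.of_forall fun z => ?_) EventuallyEq.rfl
    exact sub_add_cancel _ _
  -- The residue is the limit of `(z - c) Q X Q`, a real multiple of a skew-adjoint operator.
  have hρskew : ∀ i, ContinuousLinearMap.adjoint (ρ i) = -ρ i := by
    intro i
    have hlim : Tendsto (fun z => (z - c) • (Q * X i z * Q)) l (𝓝 (ρ i)) := by
      have h1 : (fun z => (z - c) • (Q * X i z * Q - (z - c)⁻¹ • ρ i)) =O[l] p := by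
        have h2 : (fun z : ℝ => z - c) =O[l] p := IsBigO.of_bound 1
          (Eventually.of_forall fun z => by simp [hpdef])
        simpa using h2.smul (hT i).2.2.2
      have h3 := (h1.trans_tendsto hplim).add_const (ρ i)
      rw [zero_add] at h3
      refine h3.congr' (hne.mono fun z hz => ?_)
      rw [smul_sub, smul_smul, mul_inv_cancel₀ hz, one_smul]
      exact sub_add_cancel _ _
    have hQadj : ContinuousLinearMap.adjoint Q = Q := by
      have h1 : ContinuousLinearMap.adjoint (1 : Mn (k + j)) = 1 := by
        rw [← ContinuousLinearMap.star_eq_adjoint, star_one]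
      rw [hQdef, projQ, map_sub, h1, ContinuousLinearMap.adjoint_comp, surj,
        ContinuousLinearMap.adjoint_adjoint]
    have h4 := (ContinuousLinearMap.adjoint.continuous.tendsto (ρ i)).comp hlim
    refine tendsto_nhds_unique (h4.congr' ?_) hlim.neg
    filter_upwards [hskew] with z hz
    have h5 : star (T i.succ z) = -T i.succ z := by
      rw [ContinuousLinearMap.star_eq_adjoint]; exact hz i.succ
    have h6 : star (Q * X i z * Q) = -(Q * X i z * Q) := by
      have h7 : star Q = Q := by rw [ContinuousLinearMap.star_eq_adjoint]; exact hQadj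
      simp only [hX, star_mul, star_star, h5, h7]
      refine ContinuousLinearMap.ext fun v => ?_
      change Q (star (U z) ((-T i.succ z) (U z (Q v)))) = -Q (star (U z) (T i.succ z (U z (Q v))))
      rw [neg_apply, map_neg, map_neg]
    have h8 : (z - c) • (Q * X i z * Q) = ((z - c : ℝ) : ℂ) • (Q * X i z * Q) := by
      ext v i
      simp
    change ContinuousLinearMap.adjoint ((z - c) • (Q * X i z * Q)) = _
    rw [h8, map_smulₛₗ, Complex.conj_ofReal, ← ContinuousLinearMap.star_eq_adjoint, h6]
    exact smul_neg _ (Q * X i z * Q)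
  obtain ⟨lam, hlam0, hlam⟩ := hρ.exists_casimir (by omega) hρskew
  set θ : ℝ := μ₀ * x 0 with hθ
  -- The phase makes `ex • U` parallel for `P = T₀ - i μ₀ x₀` instead of `T₀`; it is normalised to
  -- be `1` at `c` and cancels in every conjugate `star (V z) * A * V z`.
  set ex : ℝ → ℂ := fun z => Complex.exp (Complex.I * (θ : ℂ) * ((z - c : ℝ) : ℂ)) with hex
  have hexn : ∀ z, (starRingEnd ℂ) (ex z) * ex z = 1 := fun z => by
    rw [hex, ← Complex.exp_conj, ← Complex.exp_add]
    simp
  have hexd : ∀ z, HasDerivAt ex (Complex.I * (θ : ℂ) * ex z) z := fun z => by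
    have h1 : HasDerivAt (fun z : ℝ => ((z - c : ℝ) : ℂ)) 1 z :=
      ((hasDerivAt_id z).sub_const c).ofReal_comp
    have h2 := (h1.const_mul (Complex.I * (θ : ℂ))).cexp
    refine h2.congr_deriv ?_
    rw [hex]
    ring
  set V : ℝ → Mn (k + j) := fun z => ex z • U z with hV
  have hVuni : ∀ᶠ z in l, V z ∈ unitary (Mn (k + j)) := by
    filter_upwards [hU] with z hz
    have h1 := Unitary.mem_iff.1 hz.1
    refine Unitary.mem_iff.2 ⟨?_, ?_⟩
    · rw [hV, star_smul, smul_mul_smul_comm, h1.1]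
      change ((starRingEnd ℂ) (ex z) * ex z) • (1 : Mn (k + j)) = 1
      rw [hexn, one_smul]
    · rw [hV, star_smul, smul_mul_smul_comm, h1.2]
      change (ex z * (starRingEnd ℂ) (ex z)) • (1 : Mn (k + j)) = 1
      rw [mul_comm, hexn, one_smul]
  have hVd : ∀ᶠ z in l, HasDerivAt V (-(Y.P z * V z)) z := by
    filter_upwards [hU] with z hz
    refine ((hexd z).smul hz.2).congr_deriv ?_
    refine ContinuousLinearMap.ext fun v => ?_
    change ex z • (-(T 0 z (U z v))) + (Complex.I * (θ : ℂ) * ex z) • U z v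
      = -(T 0 z (ex z • U z v) - (Complex.I * (θ : ℂ)) • (ex z • U z v))
    rw [map_smul]
    module
  have hVlim : Tendsto V l (𝓝 1) := by
    have h1 : Continuous ex := by fun_prop
    have h2 : ex c = 1 := by simp [hex]
    have h3 := h1.tendsto c
    rw [h2] at h3
    have h4 := (h3.mono_left (hl.trans nhdsWithin_le_nhds)).smul hUlim
    rwa [one_smul] at h4
  have hGV : ∀ᶠ z in l, ∀ i, star (V z) * Y.S i z * V z = G i z := by
    filter_upwards [hU] with z hz i
    have h1 := (Unitary.mem_iff.1 hz.1).1
    refine ContinuousLinearMap.ext fun v => ?_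
    have h2 : star (V z) = (starRingEnd ℂ) (ex z) • star (U z) := star_smul _ _
    have h3 : star (U z) (U z v) = v := by
      rw [← mul_apply_eq_comp, h1, one_apply_eq_self]
    rw [h2]
    change (starRingEnd ℂ) (ex z) • star (U z) (T i.succ z (ex z • U z v)
      - (Complex.I * ((x i.succ : ℝ) : ℂ)) • (ex z • U z v))
      = star (U z) (T i.succ z (U z v)) - (Complex.I * ((x i.succ : ℝ) : ℂ)) • v
    rw [map_sub, map_smul, map_smul, map_smul, map_smul, h3, smul_sub, smul_smul, hexn, one_smul,
      smul_comm, smul_smul, smul_smul, mul_assoc (Complex.I * ((x i.succ : ℝ) : ℂ)), hexn,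
      mul_one]
  have hGV' : ∀ᶠ z in l, ∀ i v, Y.S i z (V z v) = V z (G i z v) := by
    filter_upwards [hGV, hVuni] with z hz hz' i v
    have h1 := (Unitary.mem_iff.1 hz').2
    rw [← hz i]
    change _ = V z (star (V z) (Y.S i z (V z v)))
    rw [← mul_apply_eq_comp (V z), h1, one_apply_eq_self]
  -- The `Sᵢ` are skew-adjoint, so the potential is minus the sum of their squares, to which the
  -- block expansions apply.
  have hM : ∀ᶠ z in l, ∀ v, (star (V z) * Y.N z * V z) v = -∑ i, G i z (G i z v) := by
    filter_upwards [hGV', hVuni, hskew] with z hz hz' hz'' v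
    have h1 := (Unitary.mem_iff.1 hz').1
    have h2 : ∀ i w, ContinuousLinearMap.adjoint (Y.S i z) w = -Y.S i z w := fun i w => by
      have := adjoint_sub_I_smul_one (hz'' i.succ) (x i.succ)
      exact congrArg (fun A : Mn (k + j) => A w) this
    change star (V z) (Y.N z (V z v)) = _
    have h3 : Y.N z (V z v) = -V z (∑ i, G i z (G i z v)) := by
      rw [map_sum, ODESystem.N, sum_apply, ← Finset.sum_neg_distrib]
      refine Finset.sum_congr rfl fun i _ => ?_
      rw [mul_apply_eq_comp, h2, hz, hz]
    rw [h3, map_neg, ← mul_apply_eq_comp (star (V z)), h1, one_apply_eq_self]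
  have hAO : ∀ i, (fun z => (G i z).comp (inj ι)) =O[l] fun z => p z ^ (0 : ℝ) := fun i => by
    have h1 := isBigO_comp_rpow hp0 (add_zero (0 : ℝ)) (hconst (inj ι)) (hpG i)
    refine (h1.add ((hC i).trans (hmono he0))).congr' (Eventually.of_forall fun z => ?_)
      EventuallyEq.rfl
    refine ContinuousLinearMap.ext fun v => ?_
    exact inj_surj_add_projQ ι (G i z (ι v))
  have hιB : ∀ i, (fun z => (inj ι).comp ((surj ι).comp ((G i z).comp Q))) =O[l]
      fun z => p z ^ (0 : ℝ) := fun i =>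
    (isBigO_comp_rpow hp0 (zero_add e) (hconst (inj ι)) (hB i)).trans (hmono he0)
  refine ⟨V, lam, ⟨hVuni.and hVd, hVlim, hlam0, fun i => ?_, ?_, ?_⟩⟩
  · rw [hone]
    have hVO : V =O[l] fun z => p z ^ (0 : ℝ) := by rw [← hone]; exact hVlim.isBigO_one ℝ
    refine (isBigO_comp_rpow hp0 (add_zero (0 : ℝ)) hVO (hAO i)).congr' ?_ EventuallyEq.rfl
    filter_upwards [hGV'] with z hz
    refine ContinuousLinearMap.ext fun v => ?_
    exact (hz i (ι v)).symm
  -- A pole of order one times `O(|z - c|^((j-1)/2))`. For `j ≥ 2` the exponent is at least `-1/2`;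
  -- for `j = 1` there is no decay, but then `ρ = 0` and the block is bounded.
  · have hDC : ∀ i, (fun z => (Q * G i z * Q).comp (Q.comp ((G i z).comp (inj ι)))) =O[l]
        fun z => p z ^ (-(1 / 2) : ℝ) := fun i => by
      rcases (Nat.succ_le_of_lt hj).eq_or_lt with h1 | h1
      · have hρ0 : ρ i = 0 := hρ.eq_zero (by rw [← h1]) i
        have h2 : (fun z => Q * G i z * Q) =O[l] fun z => p z ^ (0 : ℝ) := by
          refine (hE i).congr' (Eventually.of_forall fun z => ?_) EventuallyEq.rfl
          refine ContinuousLinearMap.ext fun v => ?_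
          rw [sub_apply, smul_apply, hρ0, zero_apply, smul_zero, sub_zero]
        exact (isBigO_comp_rpow hp0 (zero_add e) h2 (hC i)).trans (hmono (by linarith))
      · refine (isBigO_comp_rpow hp0 rfl (hD i) (hC i)).trans (hmono ?_)
        have : (2 : ℝ) ≤ j := by exact_mod_cast h1
        rw [he]; linarith
    have hsum : ∀ i, (fun z => ((G i z).comp (inj ι)).comp ((surj ι).comp ((G i z).comp (inj ι)))
        + ((inj ι).comp ((surj ι).comp ((G i z).comp Q))).comp (Q.comp ((G i z).comp (inj ι)))
        + (Q * G i z * Q).comp (Q.comp ((G i z).comp (inj ι)))) =O[l]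
        fun z => p z ^ (-(1 / 2) : ℝ) := fun i => by
      refine IsBigO.add (IsBigO.add ?_ ?_) (hDC i)
      · exact (isBigO_comp_rpow hp0 (add_zero (0 : ℝ)) (hAO i) (hpG i)).trans
          (hmono (by norm_num))
      · exact (isBigO_comp_rpow hp0 (zero_add e) (hιB i) (hC i)).trans (hmono (by linarith))
    refine (IsBigO.sum (s := Finset.univ) fun i _ => hsum i).neg_left.congr' ?_ EventuallyEq.rfl
    filter_upwards [hM] with z hz
    refine ContinuousLinearMap.ext fun v => ?_
    refine Eq.trans ?_ (hz (ι v)).symm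
    rw [neg_apply, Finset.sum_apply, sum_apply]
    refine congrArg Neg.neg (Finset.sum_congr rfl fun i _ => ?_)
    exact (sq_apply_inj ι (G i z) v).symm
  · have hinv : (fun z => |z - c|⁻¹) = fun z => p z ^ (-1 : ℝ) := by
      ext z; rw [Real.rpow_neg_one]
    rw [hinv]
    -- What remains of `G²` on `ker π` after removing `(z - c)⁻² ρ²`. The removed squares sum to the
    -- Casimir operator and give `λ |z - c|⁻²`.
    have hsum : ∀ i, (fun z => ((G i z).comp (inj ι)).comp ((surj ι).comp ((G i z).comp Q))
        + ((inj ι).comp ((surj ι).comp ((G i z).comp Q))).comp (Q * G i z * Q)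
        + (Q * G i z * Q - (z - c)⁻¹ • ρ i).comp (Q * G i z * Q - (z - c)⁻¹ • ρ i)
        + (z - c)⁻¹ • ((ρ i).comp (Q * G i z * Q - (z - c)⁻¹ • ρ i)
          + (Q * G i z * Q - (z - c)⁻¹ • ρ i).comp (ρ i))) =O[l]
        fun z => p z ^ (-1 : ℝ) := fun i => by
      refine IsBigO.add (IsBigO.add (IsBigO.add ?_ ?_) ?_) (hsm (IsBigO.add ?_ ?_))
      · exact (isBigO_comp_rpow hp0 (zero_add e) (hAO i) (hB i)).trans (hmono (by linarith))
      · exact isBigO_comp_rpow hp0 (zero_add (-1 : ℝ)) (hιB i) (hD i)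
      · exact (isBigO_comp_rpow hp0 (add_zero (0 : ℝ)) (hE i) (hE i)).trans
          (hmono (by norm_num))
      · exact isBigO_comp_rpow hp0 (add_zero (0 : ℝ)) (hconst (ρ i)) (hE i)
      · exact isBigO_comp_rpow hp0 (add_zero (0 : ℝ)) (hE i) (hconst (ρ i))
    refine (IsBigO.sum (s := Finset.univ) fun i _ => hsum i).neg_left.congr' ?_ EventuallyEq.rfl
    filter_upwards [hM] with z hz
    refine ContinuousLinearMap.ext fun v => ?_
    have h1 : (star (V z) * Y.N z * V z * Q) v = -∑ i, G i z (G i z (Q v)) := hz (Q v)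
    have h2 : ∑ i, ρ i (ρ i v) = -(lam • Q v) := by
      have := congrArg (fun A : Mn (k + j) => A v) hlam
      simpa using this
    have h3 : ((z - c)⁻¹ * (z - c)⁻¹) • ∑ i, ρ i (ρ i v) = -((lam * (|z - c| ^ 2)⁻¹) • Q v) := by
      rw [h2, sq_abs, sq, mul_inv, smul_neg, smul_smul, mul_comm lam]
    rw [neg_apply, Finset.sum_apply, sum_apply, sub_apply, h1, smul_apply]
    rw [Finset.sum_congr rfl fun i _ => sq_apply_projQ_comp ι (G i z) (ρ i) (z - c)⁻¹ v,
      Finset.sum_add_distrib, ← Finset.smul_sum, h3, neg_add, neg_neg, add_sub_cancel_right]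

end

/-! ### The du Bois-Reymond lemma and regularity of weak solutions. -/

noncomputable section

section DuBoisReymond

open MeasureTheory

variable {F : Type*} [NormedAddCommGroup F] [NormedSpace ℝ F] {a b : ℝ} {ψ : ℝ → ℝ}

/-- Real-valued smooth test functions with compact support in the open interval `(a, b)`. -/
structure IsRealTest (a b : ℝ) (ψ : ℝ → ℝ) : Prop where
  smooth : ContDiff ℝ ∞ ψ
  compact : HasCompactSupport ψ
  supp : tsupport ψ ⊆ Ioo a b

theorem IsRealTest.derivative (h : IsRealTest a b ψ) : IsRealTest a b (deriv ψ) :=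
  ⟨(contDiff_infty_iff_deriv.1 h.smooth).2, h.compact.deriv,
    (tsupport_deriv_subset (𝕜 := ℝ)).trans h.supp⟩

theorem IsRealTest.hasDerivAt (h : IsRealTest a b ψ) (z : ℝ) : HasDerivAt ψ (deriv ψ z) z :=
  ((contDiff_infty_iff_deriv.1 h.smooth).1 z).hasDerivAt

theorem exists_Ioo_of_compact {K : Set ℝ} (hK : IsCompact K) (hab : a < b) (hKab : K ⊆ Ioo a b) :
    ∃ c d, a < c ∧ c < d ∧ d < b ∧ K ⊆ Ioo c d := by
  rcases K.eq_empty_or_nonempty with rfl | hne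
  · obtain ⟨c, hc, hcb⟩ := exists_between hab
    obtain ⟨d, hd, hdb⟩ := exists_between hcb
    exact ⟨c, d, hc, hd, hdb, empty_subset _⟩
  · obtain ⟨m, hm, hm'⟩ := hK.exists_isLeast hne
    obtain ⟨M, hM, hM'⟩ := hK.exists_isGreatest hne
    obtain ⟨c, hc, hcm⟩ := exists_between (hKab hm).1
    obtain ⟨d, hd, hdM⟩ := exists_between (hKab hM).2
    exact ⟨c, d, hc, hcm.trans_le ((hm' hM).trans hd.le), hdM,
      fun z hz => ⟨hcm.trans_le (hm' hz), (hM' hz).trans_lt hd⟩⟩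

/-- `V` is controlled only inside the interval, but `ψ` vanishes near every outside point, so the
product is continuous on the line with compact support. -/
theorem IsRealTest.integrable_smul (h : IsRealTest a b ψ) {V : ℝ → F}
    (hV : ContinuousOn V (Ioo a b)) : Integrable fun z => ψ z • V z := by
  have h1 : tsupport (fun z => ψ z • V z) ⊆ tsupport ψ := closure_mono fun z hz => by
    intro h0
    exact hz (by simp [h0])
  have h2 : ContinuousOn (fun z => ψ z • V z) (Ioo a b) :=
    h.smooth.continuous.continuousOn.smul hV
  have h3 : Continuous fun z => ψ z • V z :=
    continuous_iff_continuousAt.2 fun z => by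
      by_cases hz : z ∈ Ioo a b
      · exact h2.continuousAt (isOpen_Ioo.mem_nhds hz)
      · have h4 : z ∉ tsupport ψ := fun h' => hz (h.supp h')
        have h5 : (fun z => ψ z • V z) =ᶠ[𝓝 z] fun _ => 0 := by
          filter_upwards [notMem_tsupport_iff_eventuallyEq.1 h4] with w hw
          rw [hw]; simp
        exact continuousAt_const.congr h5.symm
  exact h3.integrable_of_hasCompactSupport (h.compact.mono' (subset_closure.trans h1))

/-- Integration by parts against a test function. -/
theorem IsRealTest.integral_smul_deriv (h : IsRealTest a b ψ) {V V' : ℝ → F}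
    (hV : ∀ z ∈ Ioo a b, HasDerivAt V (V' z) z) (hV' : ContinuousOn V' (Ioo a b)) :
    ∫ z, ψ z • V' z = -∫ z, deriv ψ z • V z := by
  have hVc : ContinuousOn V (Ioo a b) := fun z hz => (hV z hz).continuousAt.continuousWithinAt
  have h1 := h.derivative.integrable_smul hVc
  have h2 := h.integrable_smul hV'
  have h3 : ∫ z, (ψ z • V' z + deriv ψ z • V z) = 0 := by
    refine integral_eq_zero_of_hasDerivAt_of_integrable (f := fun z => ψ z • V z) (fun z => ?_)
      (h2.add h1) (h.integrable_smul hVc)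
    by_cases hz : z ∈ Ioo a b
    · exact (h.hasDerivAt z).smul (hV z hz)
    · have h4 : z ∉ tsupport ψ := fun h' => hz (h.supp h')
      have h5 : (fun z => ψ z • V z) =ᶠ[𝓝 z] fun _ => 0 := by
        filter_upwards [notMem_tsupport_iff_eventuallyEq.1 h4] with w hw
        rw [hw]; simp
      have h6 : z ∉ tsupport (deriv ψ) := fun h' => hz (h.derivative.supp h')
      have h7 : ψ z • V' z + deriv ψ z • V z = 0 := by
        rw [image_eq_zero_of_notMem_tsupport h4, image_eq_zero_of_notMem_tsupport h6]; simp
      rw [h7]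
      exact (hasDerivAt_const z (0 : F)).congr_of_eventuallyEq h5
  rw [integral_add h2 h1] at h3
  exact eq_neg_of_add_eq_zero_left h3

theorem exists_hasDerivAt_of_continuousOn [CompleteSpace F] {G : ℝ → F}
    (hG : ContinuousOn G (Ioo a b)) :
    ∃ W : ℝ → F, ∀ z ∈ Ioo a b, HasDerivAt W (G z) z := by
  rcases (Ioo a b).eq_empty_or_nonempty with h0 | ⟨z₀, hz₀⟩
  · exact ⟨0, fun z hz => by simp [h0] at hz⟩
  · refine ⟨fun z => ∫ t in z₀..z, G t, fun z hz => ?_⟩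
    refine intervalIntegral.integral_hasDerivAt_right ?_ ?_ (hG.continuousAt (isOpen_Ioo.mem_nhds hz))
    · exact (hG.mono (ordConnected_Ioo.uIcc_subset hz₀ hz)).intervalIntegrable
    · exact hG.stronglyMeasurableAtFilter isOpen_Ioo z hz

/-- A test function with integral zero is the derivative of a test function. -/
theorem IsRealTest.exists_primitive (h : IsRealTest a b ψ) (hab : a < b) (h0 : ∫ z, ψ z = 0) :
    ∃ χ, IsRealTest a b χ ∧ deriv χ = ψ := by
  obtain ⟨c, d, hc, hcd, hd, hsub⟩ := exists_Ioo_of_compact h.compact.isCompact hab h.supp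
  have hψ : ∀ z ∉ Ioo c d, ψ z = 0 := fun z hz =>
    image_eq_zero_of_notMem_tsupport fun h' => hz (hsub h')
  have hder : ∀ z, HasDerivAt (fun z => ∫ t in c..z, ψ t) (ψ z) z := fun z =>
    intervalIntegral.integral_hasDerivAt_right (h.smooth.continuous.intervalIntegrable _ _)
      (h.smooth.continuous.stronglyMeasurableAtFilter _ _) h.smooth.continuous.continuousAt
  have hdeq : deriv (fun z => ∫ t in c..z, ψ t) = ψ := funext fun z => (hder z).deriv
  -- The vanishing total integral is what makes the primitive zero to the right of the support.
  have hsupp : Function.support (fun z => ∫ t in c..z, ψ t) ⊆ Icc c d := by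
    intro z hz
    by_contra hz'
    apply hz
    rcases lt_or_ge z c with h1 | h1
    · change ∫ t in c..z, ψ t = 0
      rw [intervalIntegral.integral_symm, neg_eq_zero]
      refine intervalIntegral.integral_zero_ae (Eventually.of_forall fun t ht => hψ t ?_)
      rw [uIoc_of_le h1.le] at ht
      exact fun h2 => absurd ht.2 (not_le.2 h2.1)
    · have h2 : d < z := by
        by_contra h3
        exact hz' ⟨h1, not_lt.1 h3⟩
      change ∫ t in c..z, ψ t = 0
      rw [intervalIntegral.integral_eq_integral_of_support_subset, h0]
      intro t ht
      by_contra h3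
      exact ht (hψ t fun h4 => h3 ⟨h4.1, (h4.2.trans h2).le⟩)
  refine ⟨_, ⟨contDiff_infty_iff_deriv.2 ⟨fun z => (hder z).differentiableAt, ?_⟩, ?_, ?_⟩, hdeq⟩
  · rw [hdeq]; exact h.smooth
  · exact HasCompactSupport.intro isCompact_Icc fun z hz => by
      by_contra h1
      exact hz (hsupp h1)
  · exact (closure_minimal hsupp isClosed_Icc).trans (Icc_subset_Ioo hc hd)

theorem exists_isRealTest_integral_eq_one (hab : a < b) :
    ∃ θ, IsRealTest a b θ ∧ ∫ z, θ z = 1 := by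
  obtain ⟨m, hm⟩ := exists_between hab
  obtain ⟨f, hf, hfc, hfd, hf01, hfm⟩ :=
    exists_contDiff_tsupport_subset (n := ⊤) (isOpen_Ioo.mem_nhds hm)
  have hpos : 0 < ∫ z, f z := by
    refine hfd.continuous.integral_pos_of_hasCompactSupport_nonneg_nonzero hfc (x := m) ?_ ?_
    · intro z; exact (hf01 (mem_range_self z)).1
    · rw [hfm]; exact one_ne_zero
  refine ⟨fun z => (∫ z, f z)⁻¹ * f z, ⟨contDiff_const.mul hfd, hfc.mul_left, ?_⟩, ?_⟩
  · exact (tsupport_mul_subset_right).trans hf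
  · rw [integral_const_mul, inv_mul_cancel₀ hpos.ne']

/-- The lemma of du Bois-Reymond. -/
theorem eqOn_const_of_integral_deriv_smul [CompleteSpace F] (hab : a < b) {V : ℝ → F}
    (hV : ContinuousOn V (Ioo a b))
    (h : ∀ ψ, IsRealTest a b ψ → ∫ z, deriv ψ z • V z = 0) : ∃ c, ∀ z ∈ Ioo a b, V z = c := by
  obtain ⟨θ, hθ, hθ1⟩ := exists_isRealTest_integral_eq_one hab
  set c : F := ∫ z, θ z • V z with hc
  refine ⟨c, ?_⟩
  have hVc : ContinuousOn (fun z => V z - c) (Ioo a b) := hV.sub continuousOn_const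
  have hae := isOpen_Ioo.ae_eq_zero_of_integral_contDiff_smul_eq_zero (μ := volume)
    (hVc.locallyIntegrableOn measurableSet_Ioo) fun g hg hgc hgs => by
      have hgt : IsRealTest a b g := ⟨hg, hgc, hgs⟩
      set r : ℝ := ∫ z, g z with hr
      -- Subtracting `r θ` removes the mean of `g`, so the difference is the derivative of a test
      -- function.
      have ht : IsRealTest a b fun z => g z - r * θ z :=
        ⟨hg.sub (contDiff_const.mul hθ.smooth), hgc.sub hθ.compact.mul_left,
          (tsupport_sub g _).trans (union_subset hgs (tsupport_mul_subset_right.trans hθ.supp))⟩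
      have hgi : Integrable g := hg.continuous.integrable_of_hasCompactSupport hgc
      have hθi : Integrable θ := hθ.smooth.continuous.integrable_of_hasCompactSupport hθ.compact
      have h0 : ∫ z, (g z - r * θ z) = 0 := by
        rw [integral_sub hgi (hθi.const_mul r), integral_const_mul, hθ1, mul_one, sub_self]
      obtain ⟨χ, hχ, hχd⟩ := ht.exists_primitive hab h0
      have h1 := h χ hχ
      rw [hχd] at h1
      have h2 : ∫ z, (g z - r * θ z) • V z = (∫ z, g z • V z) - r • c := by
        simp only [sub_smul, mul_smul]
        have i1 : Integrable fun z => r • θ z • V z := (hθ.integrable_smul hV).smul r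
        rw [integral_sub (hgt.integrable_smul hV) i1, integral_smul]
      rw [h2] at h1
      simp only [smul_sub]
      rw [integral_sub (hgt.integrable_smul hV) (hgi.smul_const c), integral_smul_const]
      exact h1
  have heq : (fun z => V z - c) =ᵐ[volume.restrict (Ioo a b)] fun _ => 0 :=
    (ae_restrict_iff' measurableSet_Ioo).2 hae
  intro z hz
  exact sub_eq_zero.1 (Measure.eqOn_open_of_ae_eq heq isOpen_Ioo hVc continuousOn_const hz)

/-- Regularity of continuous weak solutions of a second order equation. -/
theorem exists_hasDerivAt_of_weak [CompleteSpace F] (hab : a < b) {V G H : ℝ → F}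
    (hV : ContinuousOn V (Ioo a b)) (hG : ContinuousOn G (Ioo a b)) (hH : ContinuousOn H (Ioo a b))
    (h : ∀ ψ, IsRealTest a b ψ →
      ∫ z, (deriv (deriv ψ) z • V z + deriv ψ z • G z + ψ z • H z) = 0) :
    ∃ E : ℝ → F, ∀ z ∈ Ioo a b, HasDerivAt V (G z + E z) z ∧ HasDerivAt E (-H z) z := by
  obtain ⟨H₁, hH₁⟩ := exists_hasDerivAt_of_continuousOn hH
  have hH₁c : ContinuousOn H₁ (Ioo a b) := fun z hz => (hH₁ z hz).continuousAt.continuousWithinAt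
  -- Two integrations by parts move `G` and `H` under `ψ''`: with `H₁' = H` and `K' = G - H₁` the
  -- hypothesis says `(V - K)'' = 0` weakly.
  obtain ⟨K, hK⟩ := exists_hasDerivAt_of_continuousOn (hG.sub hH₁c)
  have hKc : ContinuousOn K (Ioo a b) := fun z hz => (hK z hz).continuousAt.continuousWithinAt
  have key : ∀ ψ, IsRealTest a b ψ → ∫ z, deriv (deriv ψ) z • (V z - K z) = 0 := fun ψ hψ => by
    have h1 := h ψ hψ
    have i1 := hψ.derivative.derivative.integrable_smul hV
    have i2 := hψ.derivative.integrable_smul hG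
    have i3 := hψ.integrable_smul hH
    have i12 : Integrable fun z => deriv (deriv ψ) z • V z + deriv ψ z • G z := i1.add i2
    rw [integral_add i12 i3, integral_add i1 i2, hψ.integral_smul_deriv hH₁ hH] at h1
    have h2 := hψ.derivative.integral_smul_deriv hK (hG.sub hH₁c)
    simp only [Pi.sub_apply, smul_sub] at h2
    rw [integral_sub i2 (hψ.derivative.integrable_smul hH₁c)] at h2
    simp only [smul_sub]
    rw [integral_sub i1 (hψ.derivative.derivative.integrable_smul hKc), ← neg_neg (∫ z, _ • K z), ← h2,
      sub_neg_eq_add, ← h1]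
    abel
  obtain ⟨θ, hθ, hθ1⟩ := exists_isRealTest_integral_eq_one hab
  have hVK : ContinuousOn (fun z => V z - K z) (Ioo a b) := hV.sub hKc
  -- The slope of the affine function `V - K`, read off by pairing with `θ'` since `∫ θ = 1`.
  set e : F := -∫ z, deriv θ z • (V z - K z) with he
  have hlin : ∀ z : ℝ, HasDerivAt (fun z : ℝ => z • e) e z := fun z => by
    simpa using (hasDerivAt_id z).smul_const e
  have hlinc : ContinuousOn (fun z : ℝ => z • e) (Ioo a b) := by fun_prop
  obtain ⟨c, hc⟩ := eqOn_const_of_integral_deriv_smul hab (V := fun z => V z - K z - z • e)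
    (hVK.sub hlinc) fun ψ hψ => by
      set r : ℝ := ∫ z, ψ z with hr
      have ht : IsRealTest a b fun z => ψ z - r * θ z :=
        ⟨hψ.smooth.sub (contDiff_const.mul hθ.smooth), hψ.compact.sub hθ.compact.mul_left,
          (tsupport_sub ψ _).trans (union_subset hψ.supp (tsupport_mul_subset_right.trans hθ.supp))⟩
      have hgi : Integrable ψ := hψ.smooth.continuous.integrable_of_hasCompactSupport hψ.compact
      have hθi : Integrable θ := hθ.smooth.continuous.integrable_of_hasCompactSupport hθ.compact
      have h0 : ∫ z, (ψ z - r * θ z) = 0 := by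
        rw [integral_sub hgi (hθi.const_mul r), integral_const_mul, hθ1, mul_one, sub_self]
      obtain ⟨χ, hχ, hχd⟩ := ht.exists_primitive hab h0
      have h1 := key χ hχ
      have h2 : deriv (deriv χ) = fun z => deriv ψ z - r * deriv θ z := by
        rw [hχd]
        exact funext fun z => ((hψ.hasDerivAt z).sub ((hθ.hasDerivAt z).const_mul r)).deriv
      rw [h2] at h1
      simp only [sub_smul, mul_smul] at h1
      have i1 : Integrable fun z => r • deriv θ z • (V z - K z) :=
        (hθ.derivative.integrable_smul hVK).smul r
      rw [integral_sub (hψ.derivative.integrable_smul hVK) i1, integral_smul] at h1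
      have h3 : ∫ z, deriv ψ z • z • e = -(r • e) := by
        have := hψ.integral_smul_deriv (fun z _ => hlin z) (continuousOn_const (c := e))
        rw [integral_smul_const] at this
        rw [← hr] at this
        rw [this, neg_neg]
      have h4 : ∀ z, deriv ψ z • (V z - K z - z • e)
          = deriv ψ z • (V z - K z) - deriv ψ z • z • e := fun z => smul_sub _ _ _
      simp only [h4]
      rw [integral_sub (hψ.derivative.integrable_smul hVK) (hψ.derivative.integrable_smul hlinc), h3, ← h1, he]
      simp
  refine ⟨fun z => e - H₁ z, fun z hz => ⟨?_, ?_⟩⟩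
  · have h1 : HasDerivAt (fun z => K z + z • e + c) (G z - H₁ z + e) z :=
      ((hK z hz).add (hlin z)).add_const c
    have h2 : V =ᶠ[𝓝 z] fun z => K z + z • e + c := by
      filter_upwards [isOpen_Ioo.mem_nhds hz] with w hw
      rw [← hc w hw]; abel
    exact (h1.congr_of_eventuallyEq h2).congr_deriv (by change _ = G z + (e - H₁ z); abel)
  · exact (hH₁ z hz).const_sub e

end DuBoisReymond

end

/-! ### The operator `D₁* D₁` for a solution of Nahm's equations. -/

noncomputable section

variable {n : ℕ} {μ₀ : ℝ} {T : Fin 4 → ℝ → Mn n} {x : Fin 4 → ℝ} {a b : ℝ}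

theorem nahmSystem_P (z : ℝ) : (nahmSystem μ₀ T x).P z
    = T 0 z - (Complex.I * ((μ₀ * x 0 : ℝ) : ℂ)) • (1 : Mn n) := rfl

theorem nahmSystem_S (i : Fin 3) (z : ℝ) : (nahmSystem μ₀ T x).S i z
    = T i.succ z - (Complex.I * ((x i.succ : ℝ) : ℂ)) • (1 : Mn n) := rfl

theorem NahmOn.regular (h : NahmOn T a b) (μ₀ : ℝ) (x : Fin 4 → ℝ) :
    (nahmSystem μ₀ T x).Regular a b :=
  ⟨(h.smooth 0).continuousOn.sub continuousOn_const,
    fun i => (h.smooth i.succ).continuousOn.sub continuousOn_const,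
    fun z hz => adjoint_sub_I_smul_one (h.skew 0 z hz) _⟩

theorem NahmOn.adjoint_S (h : NahmOn T a b) (i : Fin 3) {z : ℝ} (hz : z ∈ Ioo a b) :
    ContinuousLinearMap.adjoint ((nahmSystem μ₀ T x).S i z) = -(nahmSystem μ₀ T x).S i z :=
  adjoint_sub_I_smul_one (h.skew i.succ z hz) _

theorem NahmOn.hasDerivAt (h : NahmOn T a b) (i : Fin 4) {z : ℝ} (hz : z ∈ Ioo a b) :
    HasDerivAt (T i) (deriv (T i) z) z :=
  (((h.smooth i).differentiableOn (by simp)).differentiableAt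
    (isOpen_Ioo.mem_nhds hz)).hasDerivAt

theorem NahmOn.hasDerivAt_P (h : NahmOn T a b) {z : ℝ} (hz : z ∈ Ioo a b) :
    HasDerivAt (nahmSystem μ₀ T x).P (deriv (T 0) z) z :=
  (h.hasDerivAt 0 hz).sub_const _

theorem NahmOn.continuousOn_deriv (h : NahmOn T a b) : ContinuousOn (deriv (T 0)) (Ioo a b) :=
  (h.smooth 0).continuousOn_deriv_of_isOpen isOpen_Ioo (by simp)

theorem NahmOn.adjoint_deriv (h : NahmOn T a b) {z : ℝ} (hz : z ∈ Ioo a b) :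
    ContinuousLinearMap.adjoint (deriv (T 0) z) = -deriv (T 0) z := by
  have h1 : HasDerivAt (fun z => ContinuousLinearMap.adjoint (T 0 z))
      (ContinuousLinearMap.adjoint (deriv (T 0) z)) z :=
    (h.hasDerivAt 0 hz).star
  refine h1.unique ((h.hasDerivAt 0 hz).neg.congr_of_eventuallyEq ?_)
  filter_upwards [isOpen_Ioo.mem_nhds hz] with w hw
  exact h.skew 0 w hw

theorem sub_smul_one_commutator (A B : Mn n) (r s : ℂ) (v : Vn n) :
    (A - r • (1 : Mn n)) ((B - s • (1 : Mn n)) v) - (B - s • (1 : Mn n)) ((A - r • (1 : Mn n)) v)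
      = A (B v) - B (A v) := by
  change A (B v - s • v) - r • (B v - s • v) - (B (A v - r • v) - s • (A v - r • v)) = _
  rw [map_sub, map_sub, map_smul, map_smul]
  module

/-- The Nahm equation for `T₃`; the scalar shifts `i xᵢ` and `i μ₀ x₀` drop out of the commutators.
-/
theorem NahmOn.hasDerivAt_S_two (h : NahmOn T a b) {z : ℝ} (hz : z ∈ Ioo a b) :
    ∃ S', HasDerivAt ((nahmSystem μ₀ T x).S 2) S' z ∧ ∀ v,
      S' v = (nahmSystem μ₀ T x).S 0 z ((nahmSystem μ₀ T x).S 1 z v)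
        - (nahmSystem μ₀ T x).S 1 z ((nahmSystem μ₀ T x).S 0 z v)
        - ((nahmSystem μ₀ T x).P z ((nahmSystem μ₀ T x).S 2 z v)
          - (nahmSystem μ₀ T x).S 2 z ((nahmSystem μ₀ T x).P z v)) := by
  refine ⟨deriv (T 3) z, (h.hasDerivAt 3 hz).sub_const _, fun v => ?_⟩
  have h1 := congrArg (fun A : Mn n => A v) (h.nahm 2 z hz)
  have h2 : deriv (T 3) z v + (T 0 z (T 3 z v) - T 3 z (T 0 z v))
      = T 1 z (T 2 z v) - T 2 z (T 1 z v) := h1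
  rw [eq_sub_of_add_eq h2]
  simp only [nahmSystem_S, nahmSystem_P, sub_smul_one_commutator]
  rfl

/-- The parameter `y` splits: `μ₀ x₀` shifts the connection and `x₃` shifts `T₃`. -/
theorem coeffA_eq (z : ℝ) : coeffA μ₀ T x z
    = (nahmSystem μ₀ T x).P z - Complex.I • (nahmSystem μ₀ T x).S 2 z := by
  rw [nahmSystem_P, nahmSystem_S, coeffA]
  change _ = _ - Complex.I • (T 3 z - (Complex.I * ((x 3 : ℝ) : ℂ)) • (1 : Mn n))
  refine ContinuousLinearMap.ext fun v => ?_
  change T 0 z v - Complex.I • T 3 z v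
      - (Complex.I * ((μ₀ * x 0 : ℝ) - Complex.I * (x 3 : ℝ)) : ℂ) • v
    = T 0 z v - (Complex.I * ((μ₀ * x 0 : ℝ) : ℂ)) • v
      - Complex.I • (T 3 z v - (Complex.I * ((x 3 : ℝ) : ℂ)) • v)
  rw [smul_sub, smul_smul]
  module

theorem coeffB_eq (z : ℝ) : coeffB T x z
    = -((nahmSystem μ₀ T x).S 0 z + Complex.I • (nahmSystem μ₀ T x).S 1 z) := by
  rw [nahmSystem_S, nahmSystem_S, coeffB]
  change _ = -(T 1 z - (Complex.I * ((x 1 : ℝ) : ℂ)) • (1 : Mn n)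
    + Complex.I • (T 2 z - (Complex.I * ((x 2 : ℝ) : ℂ)) • (1 : Mn n)))
  refine ContinuousLinearMap.ext fun v => ?_
  change -(T 1 z v + Complex.I • T 2 z v)
      + (Complex.I * ((x 1 : ℝ) + Complex.I * (x 2 : ℝ)) : ℂ) • v
    = -(T 1 z v - (Complex.I * ((x 1 : ℝ) : ℂ)) • v
      + Complex.I • (T 2 z v - (Complex.I * ((x 2 : ℝ) : ℂ)) • v))
  rw [smul_sub, smul_smul]
  module

theorem NahmOn.adjoint_coeffA_apply (h : NahmOn T a b) {z : ℝ} (hz : z ∈ Ioo a b) (v : Vn n) :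
    ContinuousLinearMap.adjoint (coeffA μ₀ T x z) v
      = -((nahmSystem μ₀ T x).P z v) - Complex.I • (nahmSystem μ₀ T x).S 2 z v := by
  rw [coeffA_eq, map_sub, map_smulₛₗ, h.adjoint_S 2 hz, (h.regular μ₀ x).skew z hz, Complex.conj_I]
  change -((nahmSystem μ₀ T x).P z v) - (-Complex.I) • (-(nahmSystem μ₀ T x).S 2 z v) = _
  module

theorem NahmOn.adjoint_coeffB_apply (h : NahmOn T a b) {z : ℝ} (hz : z ∈ Ioo a b) (v : Vn n) :
    ContinuousLinearMap.adjoint (coeffB T x z) v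
      = (nahmSystem μ₀ T x).S 0 z v - Complex.I • (nahmSystem μ₀ T x).S 1 z v := by
  rw [coeffB_eq (μ₀ := μ₀), map_neg, map_add, map_smulₛₗ, h.adjoint_S 0 hz, h.adjoint_S 1 hz,
    Complex.conj_I]
  change -(-((nahmSystem μ₀ T x).S 0 z v)
    + (-Complex.I) • (-(nahmSystem μ₀ T x).S 1 z v)) = _
  module

theorem NahmOn.N_apply (h : NahmOn T a b) {z : ℝ} (hz : z ∈ Ioo a b) (v : Vn n) :
    (nahmSystem μ₀ T x).N z v
      = -∑ i, (nahmSystem μ₀ T x).S i z ((nahmSystem μ₀ T x).S i z v) := by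
  rw [ODESystem.N, sum_apply, ← Finset.sum_neg_distrib]
  refine Finset.sum_congr rfl fun i _ => ?_
  rw [mul_apply_eq_comp, h.adjoint_S i hz, neg_apply]

/-- The operator `D₁* D₁` in terms of the covariant derivative and the endomorphisms `Sᵢ`. -/
theorem NahmOn.opD1Star_opD1 (h : NahmOn T a b) {z : ℝ} (hz : z ∈ Ioo a b) {φ : ℝ → Vn n}
    (hφ : ContDiff ℝ ∞ φ) :
    opD1Star μ₀ T x (opD1 μ₀ T x φ) z
      = -(deriv (deriv φ) z + (nahmSystem μ₀ T x).P z (deriv φ z)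
          + (nahmSystem μ₀ T x).P z (deriv φ z) + deriv (T 0) z (φ z)
          + (nahmSystem μ₀ T x).P z ((nahmSystem μ₀ T x).P z (φ z)))
        + (nahmSystem μ₀ T x).N z (φ z) := by
  obtain ⟨S', hS', hS'v⟩ := h.hasDerivAt_S_two (μ₀ := μ₀) (x := x) hz
  set Y := nahmSystem μ₀ T x with hY
  have h0 : HasDerivAt φ (deriv φ z) z := ((contDiff_infty_iff_deriv.1 hφ).1 z).hasDerivAt
  have h1 : HasDerivAt (deriv φ) (deriv (deriv φ) z) z :=
    ((contDiff_infty_iff_deriv.1 (contDiff_infty_iff_deriv.1 hφ).2).1 z).hasDerivAt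
  have hP : HasDerivAt Y.P (deriv (T 0) z) z := h.hasDerivAt_P hz
  have h2 : HasDerivAt (fun t => Complex.I • (deriv φ t + coeffA μ₀ T x t (φ t)))
      (Complex.I • (deriv (deriv φ) z + ((deriv (T 0) z (φ z) + Y.P z (deriv φ z))
        - Complex.I • (S' (φ z) + Y.S 2 z (deriv φ z))))) z := by
    have h3 : (fun t => Complex.I • (deriv φ t + coeffA μ₀ T x t (φ t)))
        = fun t => Complex.I • (deriv φ t + (Y.P t (φ t) - Complex.I • Y.S 2 t (φ t))) := by
      ext1 t
      rw [coeffA_eq]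
      rfl
    rw [h3]
    exact (h1.add ((hasDerivAt_clm_apply hP h0).sub
      ((hasDerivAt_clm_apply hS' h0).const_smul Complex.I))).const_smul Complex.I
  have hA : coeffA μ₀ T x z (φ z) = Y.P z (φ z) - Complex.I • Y.S 2 z (φ z) := by
    rw [coeffA_eq]; rfl
  have hB : coeffB T x z (φ z) = -(Y.S 0 z (φ z) + Complex.I • Y.S 1 z (φ z)) := by
    rw [coeffB_eq (μ₀ := μ₀)]; rfl
  change Complex.I • (deriv (fun t => Complex.I • (deriv φ t + coeffA μ₀ T x t (φ t))) z
      - ContinuousLinearMap.adjoint (coeffA μ₀ T x z)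
        (Complex.I • (deriv φ z + coeffA μ₀ T x z (φ z))))
    + ContinuousLinearMap.adjoint (coeffB T x z) (coeffB T x z (φ z)) = _
  -- After inserting the derivative of `S 2`, the commutators `[S 0, S 1]` and `[P, S 2]` cancel
  -- against the cross terms of the product.
  rw [h2.deriv, hA, hB, h.adjoint_coeffA_apply hz, h.adjoint_coeffB_apply (μ₀ := μ₀) hz,
    h.N_apply hz, hS'v, Fin.sum_univ_three, ← hY]
  simp only [map_add, map_sub, map_neg, map_smul, smul_add, smul_sub, smul_neg, smul_smul,
    Complex.I_mul_I]
  simp only [mul_neg, Complex.I_mul_I, neg_smul, one_smul, mul_one]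
  abel

/-- Locality, which needs no regularity of `T` and thus holds also outside the interval on which `T`
is controlled. -/
theorem opD1Star_opD1_eq_zero {z : ℝ} {φ : ℝ → Vn n} (hz : z ∉ tsupport φ) :
    opD1Star μ₀ T x (opD1 μ₀ T x φ) z = 0 := by
  have h1 : φ =ᶠ[𝓝 z] fun _ => 0 := notMem_tsupport_iff_eventuallyEq.1 hz
  have h2 : opD1 μ₀ T x φ =ᶠ[𝓝 z] fun _ => 0 := by
    filter_upwards [h1, h1.deriv] with w hw hw'
    rw [opD1, hw, hw']
    simp
  have h3 : (fun t => (opD1 μ₀ T x φ t).1) =ᶠ[𝓝 z] fun _ => 0 :=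
    h2.mono fun w hw => congrArg Prod.fst hw
  rw [opD1Star, h3.deriv_eq, h2.self_of_nhds]
  simp

end

/-! ### Distributional and classical solutions. -/

noncomputable section

/-- `v` solves `(d/dz + P)² v = N v` on `(a, b)` away from `p`, it is continuous at `p` and its
covariant derivative jumps by `-u` at `p`. On the left of `p` it is given by `(v₁, η₁)`, and on the
right by `(v₂, η₂)`. -/
structure ODESystem.IsGreen {n : ℕ} (Y : ODESystem n) (a b p : ℝ) (u : Vn n)
    (v v₁ η₁ v₂ η₂ : ℝ → Vn n) : Prop where
  left : Y.IsSol (Ioo a b) v₁ η₁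
  right : Y.IsSol (Ioo a b) v₂ η₂
  val : v₁ p = v₂ p
  jump : η₁ p - η₂ p = u
  eq_left : ∀ z ∈ Ioo a b, z ≤ p → v z = v₁ z
  eq_right : ∀ z ∈ Ioo a b, p ≤ z → v z = v₂ z

section WeakForm

open MeasureTheory

variable {n : ℕ} {μ₀ : ℝ} {T : Fin 4 → ℝ → Mn n} {x : Fin 4 → ℝ} {a b p : ℝ} {u : Vn n}
  {v η v₁ η₁ v₂ η₂ φ : ℝ → Vn n}

/-- Green's formula in differential form: paired with a solution, `D₁* D₁ φ` is a total derivative,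
so integrals reduce to boundary terms. -/
theorem NahmOn.hasDerivAt_green (h : NahmOn T a b) {z : ℝ} (hz : z ∈ Ioo a b)
    (hφ : ContDiff ℝ ∞ φ) (hv : (nahmSystem μ₀ T x).IsSol {z} v η) :
    HasDerivAt (fun z => inner ℂ (φ z) (η z)
        - inner ℂ (deriv φ z + (nahmSystem μ₀ T x).P z (φ z)) (v z))
      (inner ℂ (opD1Star μ₀ T x (opD1 μ₀ T x φ) z) (v z)) z := by
  have hreg := h.regular μ₀ x
  rw [h.opD1Star_opD1 hz hφ]
  have h0 : HasDerivAt φ (deriv φ z) z := ((contDiff_infty_iff_deriv.1 hφ).1 z).hasDerivAt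
  have h1 : HasDerivAt (deriv φ) (deriv (deriv φ) z) z :=
    ((contDiff_infty_iff_deriv.1 (contDiff_infty_iff_deriv.1 hφ).2).1 z).hasDerivAt
  have h2 := h1.add (hasDerivAt_clm_apply (h.hasDerivAt_P (μ₀ := μ₀) (x := x) hz) h0)
  obtain ⟨hv1, hv2⟩ := hv z rfl
  refine ((h0.inner ℂ hv2).sub (h2.inner ℂ hv1)).congr_deriv ?_
  simp only [inner_add_left, inner_sub_right, inner_neg_left, hreg.inner_P hz,
    ODESystem.inner_N_left, ODESystem.inner_N, Pi.add_apply]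
  ring

theorem eq_zero_of_notMem_tsupport {z : ℝ} (hz : z ∉ tsupport φ) :
    φ z = 0 ∧ deriv φ z = 0 := by
  have h1 : φ =ᶠ[𝓝 z] fun _ => 0 := notMem_tsupport_iff_eventuallyEq.1 hz
  exact ⟨h1.self_of_nhds, by rw [h1.deriv_eq]; simp⟩

theorem NahmOn.continuousOn_opD1Star_opD1 (h : NahmOn T a b) (hφ : ContDiff ℝ ∞ φ) :
    ContinuousOn (opD1Star μ₀ T x (opD1 μ₀ T x φ)) (Ioo a b) := by
  have hP := (h.regular μ₀ x).contP
  have hN := (h.regular μ₀ x).contN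
  have h0 : ContinuousOn φ (Ioo a b) := hφ.continuous.continuousOn
  have hφ1 := (contDiff_infty_iff_deriv.1 hφ).2
  have h1 : ContinuousOn (deriv φ) (Ioo a b) := hφ1.continuous.continuousOn
  have h2 : ContinuousOn (deriv (deriv φ)) (Ioo a b) :=
    (contDiff_infty_iff_deriv.1 hφ1).2.continuous.continuousOn
  exact ((((h2.add (hP.clm_apply h1)).add (hP.clm_apply h1)).add
    (h.continuousOn_deriv.clm_apply h0)).add (hP.clm_apply (hP.clm_apply h0))).neg.add
      (hN.clm_apply h0) |>.congr fun z hz => h.opD1Star_opD1 hz hφ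

/-- A continuous solution with the right jump is a solution in the sense of distributions. -/
theorem NahmOn.weakEq_of_isGreen (h : NahmOn T a b) (hp : p ∈ Ioo a b)
    (hv : (nahmSystem μ₀ T x).IsGreen a b p u v v₁ η₁ v₂ η₂) :
    WeakEq μ₀ T x a b v (diracAt p u) := by
  intro φ hφ
  have hab : a < b := hp.1.trans hp.2
  -- Including `p` lets the integral be split there even when `p` lies outside the support of `φ`.
  obtain ⟨c, d, hc, hcd, hd, hsub⟩ := exists_Ioo_of_compact
    (hφ.compact.isCompact.insert p) hab (insert_subset hp hφ.supp)
  have hpcd : p ∈ Ioo c d := hsub (mem_insert _ _)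
  have hsupp : tsupport φ ⊆ Ioo c d := (subset_insert _ _).trans hsub
  have hIcc : Icc c d ⊆ Ioo a b := Icc_subset_Ioo hc hd
  set f : ℝ → ℂ := fun z => inner ℂ (opD1Star μ₀ T x (opD1 μ₀ T x φ) z) (v z) with hf
  have hsf : Function.support f ⊆ Ioo c d := fun z hz => by
    by_contra h1
    exact hz (by rw [hf]; simp [opD1Star_opD1_eq_zero fun h2 => h1 (hsupp h2)])
  have hint : ∫ z in a..b, f z = ∫ z in c..d, f z := by
    rw [intervalIntegral.integral_eq_integral_of_support_subset
        (hsf.trans ((Ioo_subset_Ioo hc.le hd.le).trans Ioo_subset_Ioc_self)),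
      intervalIntegral.integral_eq_integral_of_support_subset (hsf.trans Ioo_subset_Ioc_self)]
  set G : (ℝ → Vn n) → (ℝ → Vn n) → ℝ → ℂ := fun v η z => inner ℂ (φ z) (η z)
        - inner ℂ (deriv φ z + (nahmSystem μ₀ T x).P z (φ z)) (v z) with hG
  have hG0 : ∀ v η z, z ∉ Ioo c d → G v η z = 0 := fun v η z hz => by
    obtain ⟨h1, h2⟩ := eq_zero_of_notMem_tsupport fun h2 => hz (hsupp h2)
    rw [hG]
    simp [h1, h2]
  -- The boundary terms vanish at `c` and `d`; at `p` the two sides leave `⟨φ p, η₁ p - η₂ p⟩`, the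
  -- delta distribution.
  have piece : ∀ {w θ : ℝ → Vn n} {s t : ℝ}, Icc s t ⊆ Ioo a b → s ≤ t →
      (nahmSystem μ₀ T x).IsSol (Ioo a b) w θ → (∀ z ∈ Icc s t, v z = w z) →
      (∫ z in s..t, f z = G w θ t - G w θ s) ∧ IntervalIntegrable f volume s t := by
    intro w θ s t hst hle hw hvw
    have h1 : ContinuousOn f (uIcc s t) := by
      rw [uIcc_of_le hle]
      have h2 : ContinuousOn (fun z => inner ℂ (opD1Star μ₀ T x (opD1 μ₀ T x φ) z) (w z))
          (Icc s t) :=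
        ((h.continuousOn_opD1Star_opD1 hφ.smooth).inner hw.continuousOn).mono hst
      exact h2.congr fun z hz => by rw [hf]; simp only [hvw z hz]
    refine ⟨intervalIntegral.integral_eq_sub_of_hasDerivAt (fun z hz => ?_)
      h1.intervalIntegrable, h1.intervalIntegrable⟩
    rw [uIcc_of_le hle] at hz
    rw [hf]
    simp only [hvw z hz]
    exact h.hasDerivAt_green (hst hz) hφ.smooth (hw.mono (singleton_subset_iff.2 (hst hz)))
  obtain ⟨e1, i1⟩ := piece (s := c) (t := p)
    ((Icc_subset_Icc_right hpcd.2.le).trans hIcc) hpcd.1.le hv.left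
    fun z hz => hv.eq_left z (hIcc ⟨hz.1, hz.2.trans hpcd.2.le⟩) hz.2
  obtain ⟨e2, i2⟩ := piece (s := p) (t := d)
    ((Icc_subset_Icc_left hpcd.1.le).trans hIcc) hpcd.2.le hv.right
    fun z hz => hv.eq_right z (hIcc ⟨hpcd.1.le.trans hz.1, hz.2⟩) hz.1
  rw [hint, ← intervalIntegral.integral_add_adjacent_intervals i1 i2, e1, e2,
    hG0 _ _ c (fun h1 => lt_irrefl _ h1.1), hG0 _ _ d (fun h1 => lt_irrefl _ h1.2), diracAt,
    ← hv.jump, inner_sub_right, hG]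
  simp only [hv.val]
  ring

/-- A continuous solution of the homogeneous equation in the sense of distributions is a classical
solution. -/
theorem NahmOn.exists_isSol_of_weakEq (h : NahmOn T a b) (hab : a < b)
    (hv : ContinuousOn v (Ioo a b)) (hw : WeakEq μ₀ T x a b v zeroDistr) :
    ∃ η, (nahmSystem μ₀ T x).IsSol (Ioo a b) v η := by
  set Y := nahmSystem μ₀ T x with hY
  have hreg : Y.Regular a b := h.regular μ₀ x
  have hPv : ContinuousOn (fun z => Y.P z (v z)) (Ioo a b) := hreg.contP.clm_apply hv
  have hG : ContinuousOn (fun z => Y.P z (v z) + Y.P z (v z)) (Ioo a b) := hPv.add hPv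
  have hH : ContinuousOn (fun z => deriv (T 0) z (v z) - Y.P z (Y.P z (v z)) + Y.N z (v z))
      (Ioo a b) :=
    ((h.continuousOn_deriv.clm_apply hv).sub (hreg.contP.clm_apply hPv)).add
      (hreg.contN.clm_apply hv)
  -- Test functions `ψ e` with constant `e`: adjoints move the operator onto `v` and leave a
  -- vector-valued weak equation for `-v`.
  obtain ⟨E, hE⟩ := exists_hasDerivAt_of_weak hab hv.neg hG hH fun ψ hψ => by
    have i1 := hψ.derivative.derivative.integrable_smul hv.neg
    have i2 := hψ.derivative.integrable_smul hG
    have i3 := hψ.integrable_smul hH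
    have i12 := i1.add i2
    have i123 := i12.add i3
    refine ext_inner_left ℂ fun e => ?_
    rw [inner_zero_right]
    have h1 := ((innerSL ℂ e).restrictScalars ℝ).integral_comp_comm i123
    refine h1.symm.trans ?_
    have htest : IsTest a b fun z => ψ z • e := by
      have hs : Function.support (fun z => ψ z • e) ⊆ Function.support ψ := fun z hz h0 =>
        hz (by simp [h0])
      exact ⟨hψ.smooth.smul contDiff_const, hψ.compact.mono hs, (closure_mono hs).trans hψ.supp⟩
    have h2 := hw _ htest
    have hsupp : Function.support (fun z =>
        inner ℂ (opD1Star μ₀ T x (opD1 μ₀ T x fun z => ψ z • e) z) (v z)) ⊆ Ioo a b := by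
      intro z hz
      by_contra h3
      exact hz (by simp [opD1Star_opD1_eq_zero fun h4 => h3 (htest.supp h4)])
    rw [intervalIntegral.integral_eq_integral_of_support_subset
      (hsupp.trans Ioo_subset_Ioc_self)] at h2
    refine Eq.trans (integral_congr_ae (Eventually.of_forall fun z => ?_)) h2
    by_cases hz : z ∈ Ioo a b
    · have d1 : deriv (fun z => ψ z • e) = fun z => deriv ψ z • e :=
        funext fun z => ((hψ.hasDerivAt z).smul_const e).deriv
      have d2 : deriv (fun z => deriv ψ z • e) = fun z => deriv (deriv ψ) z • e :=
        funext fun z => ((hψ.derivative.hasDerivAt z).smul_const e).deriv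
      change inner ℂ e (deriv (deriv ψ) z • -(v z) + deriv ψ z • (Y.P z (v z) + Y.P z (v z))
        + ψ z • (deriv (T 0) z (v z) - Y.P z (Y.P z (v z)) + Y.N z (v z)))
        = inner ℂ (opD1Star μ₀ T x (opD1 μ₀ T x fun z => ψ z • e) z) (v z)
      have hT : ∀ w w' : Vn n, inner ℂ (deriv (T 0) z w) w' = -inner ℂ w (deriv (T 0) z w') :=
        fun w w' => by
          rw [← ContinuousLinearMap.adjoint_inner_right, h.adjoint_deriv hz, neg_apply,
            inner_neg_right]
      rw [h.opD1Star_opD1 hz htest.smooth, d1, d2, ← hY]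
      simp only [ContinuousLinearMap.map_smul_of_tower, inner_add_left, inner_neg_left,
        inner_add_right, inner_sub_right, inner_neg_right, ODESystem.inner_N_left,
        ODESystem.inner_N, inner_smul_left_eq_star_smul, inner_smul_right_eq_smul,
        hreg.inner_P hz, hT]
      simp
      ring
    · have h3 : z ∉ tsupport ψ := fun h4 => hz (hψ.supp h4)
      have h4 : z ∉ tsupport (deriv ψ) := fun h5 => hz (hψ.derivative.supp h5)
      have h5 : z ∉ tsupport (deriv (deriv ψ)) := fun h6 => hz (hψ.derivative.derivative.supp h6)
      have h6 : z ∉ tsupport fun z => ψ z • e := fun h7 => hz (htest.supp h7)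
      change inner ℂ e (deriv (deriv ψ) z • -(v z) + deriv ψ z • (Y.P z (v z) + Y.P z (v z))
        + ψ z • (deriv (T 0) z (v z) - Y.P z (Y.P z (v z)) + Y.N z (v z)))
        = inner ℂ (opD1Star μ₀ T x (opD1 μ₀ T x fun z => ψ z • e) z) (v z)
      rw [opD1Star_opD1_eq_zero h6, image_eq_zero_of_notMem_tsupport h3,
        image_eq_zero_of_notMem_tsupport h4, image_eq_zero_of_notMem_tsupport h5]
      simp
  -- The regularity lemma gives `-v' = 2 P v + E`, so the covariant derivative `v' + P v` is `-P v -
  -- E`.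
  refine ⟨fun z => -(Y.P z (v z)) - E z, fun z hz => ?_⟩
  obtain ⟨hE1, hE2⟩ := hE z hz
  have hv1 : HasDerivAt v (-(Y.P z (v z)) - E z - Y.P z (v z)) z := by
    have := hE1.neg
    simp only [Pi.neg_def, neg_neg] at this
    exact this.congr_deriv (by abel)
  refine ⟨hv1, ?_⟩
  refine ((hasDerivAt_clm_apply (h.hasDerivAt_P hz) hv1).neg.sub hE2).congr_deriv ?_
  rw [← hY]
  simp only [map_sub, map_neg]
  abel

/-- Linearity of the integral requires integrability up to the ends, where `T` may blow up; the
compact support of `φ` supplies it. -/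
theorem weakEq_sub (h : NahmOn T a b) {f g : ℝ → Vn n} {F G : (ℝ → Vn n) → ℂ}
    (hf : ContinuousOn f (Ioo a b)) (hg : ContinuousOn g (Ioo a b))
    (hF : WeakEq μ₀ T x a b f F) (hG : WeakEq μ₀ T x a b g G) :
    WeakEq μ₀ T x a b (fun z => f z - g z) fun φ => F φ - G φ := by
  intro φ hφ
  refine Eq.trans ?_ (congrArg₂ (· - ·) (hF φ hφ) (hG φ hφ))
  have key : ∀ {f : ℝ → Vn n}, ContinuousOn f (Ioo a b) →
      IntervalIntegrable (fun z => inner ℂ (opD1Star μ₀ T x (opD1 μ₀ T x φ) z) (f z)) volume a b := by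
    intro f hf
    have h1 : ContinuousOn (fun z => inner ℂ (opD1Star μ₀ T x (opD1 μ₀ T x φ) z) (f z))
        (Ioo a b) := (h.continuousOn_opD1Star_opD1 hφ.smooth).inner hf
    have hs : Function.support (fun z => inner ℂ (opD1Star μ₀ T x (opD1 μ₀ T x φ) z) (f z))
        ⊆ tsupport φ := fun z hz => by
      by_contra h2
      exact hz (by simp [opD1Star_opD1_eq_zero h2])
    have h3 := h1.continuous_of_tsupport_subset isOpen_Ioo
      ((closure_minimal hs (isClosed_tsupport φ)).trans hφ.supp)
    exact h3.intervalIntegrable _ _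
  rw [← intervalIntegral.integral_sub (key hf) (key hg)]
  simp only [inner_sub_right]

/-- Continuous solutions in the sense of distributions are piecewise classical solutions. -/
theorem NahmOn.exists_isGreen_of_weakEq (h : NahmOn T a b) (hp : p ∈ Ioo a b)
    (hv : ContinuousOn v (Ioo a b)) (hw : WeakEq μ₀ T x a b v (diracAt p u)) :
    ∃ v₁ η₁ v₂ η₂, (nahmSystem μ₀ T x).IsGreen a b p u v v₁ η₁ v₂ η₂ := by
  set Y := nahmSystem μ₀ T x with hY
  -- An explicit solution, zero to the left of `p` and with the right jump; subtracting it leaves a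
  -- homogeneous equation.
  obtain ⟨y, ζ, hy, hy0, hζ0⟩ := (h.regular μ₀ x).exists_sol hp 0 (-u)
  have hzero : Y.IsSol (Ioo a b) (fun _ => 0) fun _ => 0 := fun z _ => by
    constructor <;> simpa using hasDerivAt_const z (0 : Vn n)
  set g : ℝ → Vn n := fun z => if z ≤ p then 0 else y z with hg
  have hgreen : Y.IsGreen a b p u g (fun _ => 0) (fun _ => 0) y ζ :=
    ⟨hzero, hy, hy0.symm, by rw [hζ0]; simp, fun z _ hz => if_pos hz, fun z _ hz => by
      rcases hz.eq_or_lt with rfl | h1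
      · rw [hg]; simp [hy0]
      · exact if_neg (not_le.2 h1)⟩
  have hgc : ContinuousOn g (Ioo a b) := by
    refine ContinuousOn.if (p := fun z => z ≤ p) ?_ continuousOn_const
      (hy.continuousOn.mono inter_subset_left)
    rintro z ⟨-, hz⟩
    have hz' : z = p := by simpa using frontier_le_subset_eq continuous_id continuous_const hz
    rw [hz', hy0]
  have h1 := weakEq_sub h hv hgc hw (h.weakEq_of_isGreen hp hgreen)
  simp only [sub_self] at h1
  obtain ⟨η, hη⟩ := h.exists_isSol_of_weakEq (hp.1.trans hp.2) (hv.sub hgc) h1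
  have h2 := hη.add hy
  refine ⟨_, _, _, _, hη, h2, by simp [hy0], by simp [hζ0], fun z hz hzp => ?_, fun z hz hzp => ?_⟩
  · change v z = v z - g z
    rw [hgreen.eq_left z hz hzp, sub_zero]
  · change v z = v z - g z + y z
    rw [hgreen.eq_right z hz hzp, sub_add_cancel]

end WeakForm

end

/-! ### Gluing around the circle: uniqueness and existence. -/

noncomputable section

/-- The two maps squeeze `dim W` between two copies of `dim V`. This replaces a Fredholm alternative
when the dimension of `W` is not known beforehand. -/
theorem surjective_of_injective_of_surjective {V W : Type*} [AddCommGroup V] [Module ℂ V]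
    [AddCommGroup W] [Module ℂ W] [FiniteDimensional ℂ V] [FiniteDimensional ℂ W]
    {B R : W →ₗ[ℂ] V} (hB : Function.Injective B) (hR : Function.Surjective R) :
    Function.Surjective B := by
  have h1 := LinearMap.finrank_le_finrank_of_injective hB
  have h2 := LinearMap.finrank_le_finrank_of_surjective hR
  exact (LinearMap.injective_iff_surjective_of_finrank_eq_finrank (h1.antisymm h2)).1 hB

open ODESystem

/-- A system of size `m` on `(a, b)` and a system of size `k` on `[c, d]`, to be glued by isometric
injections at `b ~ c` and `d ~ a`. -/
structure GluedSystem (k m : ℕ) where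
  YL : ODESystem m
  YS : ODESystem k
  ιp : Vn k →ₗᵢ[ℂ] Vn m
  ιm : Vn k →ₗᵢ[ℂ] Vn m
  a : ℝ
  b : ℝ
  c : ℝ
  d : ℝ

namespace GluedSystem

variable {k m : ℕ}

/-- The small system is regular beyond `[c, d]`, the large one has singular ends, and there are no
nonzero parallel sections annihilated by the `Sᵢ`. -/
structure Admissible (C : GluedSystem k m) : Prop where
  hab : C.a < C.b
  hcd : C.c < C.d
  regL : C.YL.Regular C.a C.b
  regS : C.YS.Regular (C.c - 1) (C.d + 1)
  endp : ∃ U lam, C.YL.SingularEnd C.ιp C.b (𝓝[<] C.b) U lam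
  endm : ∃ U lam, C.YL.SingularEnd C.ιm C.a (𝓝[>] C.a) U lam
  nondeg : ∀ (vL : ℝ → Vn m) (vS : ℝ → Vn k),
    (∀ z ∈ Ioo C.a C.b, HasDerivAt vL (-C.YL.P z (vL z)) z ∧ ∀ i, C.YL.S i z (vL z) = 0) →
    (∀ z ∈ Ioo C.c C.d, HasDerivAt vS (-C.YS.P z (vS z)) z ∧ ∀ i, C.YS.S i z (vS z) = 0) →
    ContinuousOn vS (Icc C.c C.d) → Tendsto vL (𝓝[<] C.b) (𝓝 (C.ιp (vS C.c))) →
    Tendsto vL (𝓝[>] C.a) (𝓝 (C.ιm (vS C.d))) →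
    (∀ z ∈ Ioo C.a C.b, vL z = 0) ∧ ∀ z ∈ Ioo C.c C.d, vS z = 0

/-- The pieces of a section with one pole on each side, and the limits of its covariant derivative
at the two ends of the large side. -/
structure Pieces (k m : ℕ) where
  vL₁ : ℝ → Vn m
  ηL₁ : ℝ → Vn m
  vL₂ : ℝ → Vn m
  ηL₂ : ℝ → Vn m
  vS₁ : ℝ → Vn k
  ηS₁ : ℝ → Vn k
  vS₂ : ℝ → Vn k
  ηS₂ : ℝ → Vn k
  dp : Vn m
  dm : Vn m

/-- Continuous piecewise solutions, whose covariant derivative jumps by `-uL`, `-uS` at the poles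
`p` and `q`, and by `-ep`, `-em` at the gluing points. -/
structure IsTransmission (C : GluedSystem k m) (p q : ℝ) (uL : Vn m) (uS ep em : Vn k)
    (X : Pieces k m) : Prop where
  solL₁ : C.YL.IsSol (Ioo C.a C.b) X.vL₁ X.ηL₁
  solL₂ : C.YL.IsSol (Ioo C.a C.b) X.vL₂ X.ηL₂
  solS₁ : C.YS.IsSol (Ioo (C.c - 1) (C.d + 1)) X.vS₁ X.ηS₁
  solS₂ : C.YS.IsSol (Ioo (C.c - 1) (C.d + 1)) X.vS₂ X.ηS₂
  valL : X.vL₁ p = X.vL₂ p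
  jumpL : X.ηL₁ p - X.ηL₂ p = uL
  valS : X.vS₁ q = X.vS₂ q
  jumpS : X.ηS₁ q - X.ηS₂ q = uS
  limp : Tendsto X.vL₂ (𝓝[<] C.b) (𝓝 (C.ιp (X.vS₁ C.c)))
  limp' : Tendsto X.ηL₂ (𝓝[<] C.b) (𝓝 X.dp)
  limm : Tendsto X.vL₁ (𝓝[>] C.a) (𝓝 (C.ιm (X.vS₂ C.d)))
  limm' : Tendsto X.ηL₁ (𝓝[>] C.a) (𝓝 X.dm)
  jumpp : surj C.ιp X.dp - X.ηS₁ C.c = ep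
  jumpm : X.ηS₂ C.d - surj C.ιm X.dm = em

/-- The difference of two sections. -/
def Pieces.sub (X X' : Pieces k m) : Pieces k m where
  vL₁ z := X.vL₁ z - X'.vL₁ z
  ηL₁ z := X.ηL₁ z - X'.ηL₁ z
  vL₂ z := X.vL₂ z - X'.vL₂ z
  ηL₂ z := X.ηL₂ z - X'.ηL₂ z
  vS₁ z := X.vS₁ z - X'.vS₁ z
  ηS₁ z := X.ηS₁ z - X'.ηS₁ z
  vS₂ z := X.vS₂ z - X'.vS₂ z
  ηS₂ z := X.ηS₂ z - X'.ηS₂ z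
  dp := X.dp - X'.dp
  dm := X.dm - X'.dm

variable {C : GluedSystem k m} {p q : ℝ} {uL uL' : Vn m} {uS ep em uS' ep' em' : Vn k}
  {X X' : Pieces k m}

theorem IsTransmission.sub (h : C.IsTransmission p q uL uS ep em X)
    (h' : C.IsTransmission p q uL' uS' ep' em' X') :
    C.IsTransmission p q (uL - uL') (uS - uS') (ep - ep') (em - em') (X.sub X') where
  solL₁ := h.solL₁.sub h'.solL₁
  solL₂ := h.solL₂.sub h'.solL₂
  solS₁ := h.solS₁.sub h'.solS₁
  solS₂ := h.solS₂.sub h'.solS₂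
  valL := congrArg₂ (· - ·) h.valL h'.valL
  jumpL := by rw [← h.jumpL, ← h'.jumpL]; exact sub_sub_sub_comm _ _ _ _
  valS := congrArg₂ (· - ·) h.valS h'.valS
  jumpS := by rw [← h.jumpS, ← h'.jumpS]; exact sub_sub_sub_comm _ _ _ _
  limp := by
    have := h.limp.sub h'.limp
    rwa [← map_sub] at this
  limp' := h.limp'.sub h'.limp'
  limm := by
    have := h.limm.sub h'.limm
    rwa [← map_sub] at this
  limm' := h.limm'.sub h'.limm'
  jumpp := by
    rw [← h.jumpp, ← h'.jumpp]
    change surj C.ιp (X.dp - X'.dp) - (X.ηS₁ C.c - X'.ηS₁ C.c) = _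
    rw [map_sub, sub_sub_sub_comm]
  jumpm := by
    rw [← h.jumpm, ← h'.jumpm]
    change (X.ηS₂ C.d - X'.ηS₂ C.d) - surj C.ιm (X.dm - X'.dm) = _
    rw [map_sub, sub_sub_sub_comm]

theorem Admissible.c_mem (hC : C.Admissible) : C.c ∈ Ioo (C.c - 1) (C.d + 1) :=
  ⟨by linarith, by linarith [hC.hcd]⟩

theorem Admissible.d_mem (hC : C.Admissible) : C.d ∈ Ioo (C.c - 1) (C.d + 1) :=
  ⟨by linarith [hC.hcd], by linarith⟩

theorem Admissible.Icc_subset (_ : C.Admissible) : Icc C.c C.d ⊆ Ioo (C.c - 1) (C.d + 1) :=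
  Icc_subset_Ioo (by linarith) (by linarith)

theorem _root_.ODESystem.Regular.continuousOn_flux {n : ℕ} {Y : ODESystem n} {a b : ℝ}
    {v η : ℝ → Vn n} (_ : Y.Regular a b) (hv : Y.IsSol (Ioo a b) v η) :
    ContinuousOn (flux v η) (Ioo a b) :=
  Complex.continuous_re.comp_continuousOn (hv.continuousOn.inner hv.continuousOn')

/-- Because the limit of `v` lies in `im ι`, the `ker π` part of the derivative does not contribute;
hence matching under `π` suffices to match the fluxes. -/
theorem tendsto_flux {n : ℕ} {l : Filter ℝ} {ι : Vn k →ₗᵢ[ℂ] Vn n} {v η : ℝ → Vn n} {w : Vn k}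
    {δ : Vn n} (hv : Tendsto v l (𝓝 (ι w))) (hη : Tendsto η l (𝓝 δ)) :
    Tendsto (flux v η) l (𝓝 (inner ℂ w (surj ι δ)).re) := by
  rw [← inner_surj]
  exact (Complex.continuous_re.tendsto _).comp (hv.inner hη)

/-- A section without any jump vanishes. -/
theorem Admissible.eq_zero (hC : C.Admissible) (hp : p ∈ Ioo C.a C.b) (hq : q ∈ Ioo C.c C.d)
    (h : C.IsTransmission p q 0 0 0 0 X) :
    (∀ z ∈ Ioo C.a C.b, X.vL₁ z = 0 ∧ X.ηL₁ z = 0 ∧ X.vL₂ z = 0 ∧ X.ηL₂ z = 0) ∧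
    (∀ z ∈ Ioo (C.c - 1) (C.d + 1), X.vS₁ z = 0 ∧ X.ηS₁ z = 0 ∧ X.vS₂ z = 0 ∧ X.ηS₂ z = 0) ∧
    X.dp = 0 ∧ X.dm = 0 := by
  have hq' : q ∈ Ioo (C.c - 1) (C.d + 1) := hC.Icc_subset (Ioo_subset_Icc_self hq)
  obtain ⟨hL, hL'⟩ := hC.regL.eqOn hp h.solL₁ h.solL₂ h.valL (sub_eq_zero.1 h.jumpL)
  obtain ⟨hS, hS'⟩ := hC.regS.eqOn hq' h.solS₁ h.solS₂ h.valS (sub_eq_zero.1 h.jumpS)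
  have nb : Ioo C.a C.b ∈ 𝓝[<] C.b := Ioo_mem_nhdsLT hC.hab
  have na : Ioo C.a C.b ∈ 𝓝[>] C.a := Ioo_mem_nhdsGT hC.hab
  have lb : Tendsto X.vL₁ (𝓝[<] C.b) (𝓝 (C.ιp (X.vS₁ C.c))) :=
    h.limp.congr' (eventually_of_mem nb fun z hz => (hL hz).symm)
  have lb' : Tendsto X.ηL₁ (𝓝[<] C.b) (𝓝 X.dp) :=
    h.limp'.congr' (eventually_of_mem nb fun z hz => (hL' hz).symm)
  have la : Tendsto X.vL₁ (𝓝[>] C.a) (𝓝 (C.ιm (X.vS₁ C.d))) := by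
    rw [hS hC.d_mem]; exact h.limm
  have hjp := sub_eq_zero.1 h.jumpp
  have hjm : X.ηS₁ C.d = surj C.ιm X.dm := by
    rw [hS' hC.d_mem]; exact sub_eq_zero.1 h.jumpm
  have f1 := tendsto_flux lb lb'
  have f2 := tendsto_flux la h.limm'
  rw [hjp] at f1
  rw [← hjm] at f2
  change Tendsto _ _ (𝓝 (flux X.vS₁ X.ηS₁ C.c)) at f1
  change Tendsto _ _ (𝓝 (flux X.vS₁ X.ηS₁ C.d)) at f2
  -- The flux increases along the large side from its value at `d` to its value at `c`, and along
  -- the small side from `c` to `d`; all these are therefore equal.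
  have hle1 := hC.regL.flux_lim_le hC.hab h.solL₁ f2 f1
  have hle2 := hC.regS.monotoneOn_flux h.solS₁ hC.c_mem hC.d_mem hC.hcd.le
  have hparL := fun z hz => hC.regL.parallel_of_flux h.solL₁ f2 f1 hle2 (z := z) hz
  have hsub : Ioo C.c C.d ⊆ Ioo (C.c - 1) (C.d + 1) := Ioo_subset_Icc_self.trans hC.Icc_subset
  have cf := hC.regS.continuousOn_flux h.solS₁
  have g1 : Tendsto (flux X.vS₁ X.ηS₁) (𝓝[>] C.c) (𝓝 (flux X.vS₁ X.ηS₁ C.c)) :=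
    (cf.continuousAt (isOpen_Ioo.mem_nhds hC.c_mem)).mono_left nhdsWithin_le_nhds
  have g2 : Tendsto (flux X.vS₁ X.ηS₁) (𝓝[<] C.d) (𝓝 (flux X.vS₁ X.ηS₁ C.d)) :=
    (cf.continuousAt (isOpen_Ioo.mem_nhds hC.d_mem)).mono_left nhdsWithin_le_nhds
  have hparS := fun z hz => (hC.regS.mono hsub).parallel_of_flux (h.solS₁.mono hsub) g1 g2 hle1
    (z := z) hz
  obtain ⟨zL, zS⟩ := hC.nondeg X.vL₁ X.vS₁
    (fun z hz => ⟨(h.solL₁ z hz).1.congr_deriv (by rw [(hparL z hz).1, zero_sub]),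
      (hparL z hz).2⟩)
    (fun z hz => ⟨(h.solS₁ z (hsub hz)).1.congr_deriv (by rw [(hparS z hz).1, zero_sub]),
      (hparS z hz).2⟩)
    (h.solS₁.continuousOn.mono hC.Icc_subset) lb la
  have hzero : C.YS.IsSol (Ioo (C.c - 1) (C.d + 1)) (fun _ => 0) fun _ => 0 := fun z _ => by
    constructor <;> simpa using hasDerivAt_const z (0 : Vn k)
  obtain ⟨eS, eS'⟩ := hC.regS.eqOn hq' h.solS₁ hzero (zS q hq) (hparS q hq).1
  refine ⟨fun z hz => ⟨zL z hz, (hparL z hz).1, ?_, ?_⟩,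
    fun z hz => ⟨eS hz, eS' hz, ?_, ?_⟩, ?_, ?_⟩
  · rw [← hL hz]; exact zL z hz
  · rw [← hL' hz]; exact (hparL z hz).1
  · rw [← hS hz]; exact eS hz
  · rw [← hS' hz]; exact eS' hz
  · exact tendsto_nhds_unique lb'
      (tendsto_const_nhds.congr' (eventually_of_mem nb fun z hz => (hparL z hz).1.symm))
  · exact tendsto_nhds_unique h.limm'
      (tendsto_const_nhds.congr' (eventually_of_mem na fun z hz => (hparL z hz).1.symm))

/-- Existence of sections which are smooth on the small side, with prescribed jumps. -/
theorem Admissible.exists_smooth (hC : C.Admissible) (hp : p ∈ Ioo C.a C.b)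
    (hq : q ∈ Ioo C.c C.d) (uL : Vn m) (ep em : Vn k) :
    ∃ X, C.IsTransmission p q uL 0 ep em X := by
  obtain ⟨Φ, hΦ0, hΦ, hΦu⟩ := hC.regL.exists_flow hp
  obtain ⟨Ψ, hΨ0, hΨ, hΨu⟩ := hC.regS.exists_flow hC.c_mem
  -- Cauchy data of the two large pieces at `p`, of the small piece at `c`, and limits of the
  -- derivative at both ends, subject to continuity but not to any matching of derivatives.
  let W : Submodule ℂ
      (((Vn m × Vn m) × (Vn m × Vn m)) × (Vn k × Vn k) × (Vn m × Vn m)) :=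
    { carrier := {x | x.1.1.1 = x.1.2.1 ∧
        Tendsto (fun z => Φ z x.1.2) (𝓝[<] C.b) (𝓝 (C.ιp x.2.1.1, x.2.2.1)) ∧
        Tendsto (fun z => Φ z x.1.1) (𝓝[>] C.a) (𝓝 (C.ιm (Ψ C.d x.2.1).1, x.2.2.2))}
      zero_mem' := by simp [← Prod.zero_eq_mk]
      add_mem' := by
        rintro x y ⟨hx1, hx2, hx3⟩ ⟨hy1, hy2, hy3⟩
        refine ⟨congrArg₂ (· + ·) hx1 hy1, ?_, ?_⟩
        · refine ((hx2.add hy2).congr fun z => (map_add (Φ z) _ _).symm).trans (le_of_eq ?_)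
          exact congrArg 𝓝 (Prod.ext (map_add C.ιp _ _).symm rfl)
        · refine ((hx3.add hy3).congr fun z => (map_add (Φ z) _ _).symm).trans (le_of_eq ?_)
          refine congrArg 𝓝 (Prod.ext ?_ rfl)
          change _ = C.ιm (Ψ C.d (x.2.1 + y.2.1)).1
          rw [map_add (Ψ C.d)]
          exact (map_add C.ιm _ _).symm
      smul_mem' := by
        rintro r x ⟨hx1, hx2, hx3⟩
        refine ⟨congrArg (r • ·) hx1, ?_, ?_⟩
        · refine ((hx2.const_smul r).congr fun z => (map_smul (Φ z) _ _).symm).trans (le_of_eq ?_)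
          exact congrArg 𝓝 (Prod.ext (map_smul C.ιp _ _).symm rfl)
        · refine ((hx3.const_smul r).congr fun z => (map_smul (Φ z) _ _).symm).trans (le_of_eq ?_)
          refine congrArg 𝓝 (Prod.ext ?_ rfl)
          change _ = C.ιm (Ψ C.d (r • x.2.1)).1
          rw [map_smul (Ψ C.d)]
          exact (map_smul C.ιm _ _).symm }
  let B : W →ₗ[ℂ] Vn m × Vn k × Vn k :=
    { toFun := fun x => (x.1.1.1.2 - x.1.1.2.2, surj C.ιp x.1.2.2.1 - x.1.2.1.2,
        (Ψ C.d x.1.2.1).2 - surj C.ιm x.1.2.2.2)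
      map_add' := fun x y => by
        simp [add_sub_add_comm]
      map_smul' := fun r x => by
        simp [smul_sub] }
  -- The values at `p`, `c` and `d`: the target is that of the jump map `B`.
  let R : W →ₗ[ℂ] Vn m × Vn k × Vn k :=
    { toFun := fun x => (x.1.1.2.1, x.1.2.1.1, (Ψ C.d x.1.2.1).1)
      map_add' := fun x y => by simp
      map_smul' := fun r x => by simp }
  let toP : ((Vn m × Vn m) × (Vn m × Vn m)) × (Vn k × Vn k) × (Vn m × Vn m) → Pieces k m := fun x =>
    ⟨fun z => (Φ z x.1.1).1, fun z => (Φ z x.1.1).2, fun z => (Φ z x.1.2).1,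
      fun z => (Φ z x.1.2).2, fun z => (Ψ z x.2.1).1, fun z => (Ψ z x.2.1).2,
      fun z => (Ψ z x.2.1).1, fun z => (Ψ z x.2.1).2, x.2.2.1, x.2.2.2⟩
  have htr : ∀ x : W, C.IsTransmission p q (B x).1 0 (B x).2.1 (B x).2.2 (toP x.1) := by
    rintro ⟨x, hx1, hx2, hx3⟩
    exact
      { solL₁ := hΦ _
        solL₂ := hΦ _
        solS₁ := hΨ _
        solS₂ := hΨ _
        valL := by
          change (Φ p x.1.1).1 = (Φ p x.1.2).1
          rw [hΦ0]; exact hx1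
        jumpL := by
          change (Φ p x.1.1).2 - (Φ p x.1.2).2 = x.1.1.2 - x.1.2.2
          rw [hΦ0]; rfl
        valS := rfl
        jumpS := sub_self _
        limp := by
          have := hx2.fst_nhds
          change Tendsto _ _ (𝓝 (C.ιp (Ψ C.c x.2.1).1))
          rw [hΨ0]; exact this
        limp' := hx2.snd_nhds
        limm := hx3.fst_nhds
        limm' := hx3.snd_nhds
        jumpp := by
          change surj C.ιp x.2.2.1 - (Ψ C.c x.2.1).2 = surj C.ιp x.2.2.1 - x.2.1.2
          rw [hΨ0]; rfl
        jumpm := rfl }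
  have hBinj : Function.Injective B := by
    refine (injective_iff_map_eq_zero B).2 fun x hx => ?_
    have h1 := htr x
    rw [hx] at h1
    obtain ⟨z1, z2, z3, z4⟩ := hC.eq_zero hp hq h1
    obtain ⟨a1, a2, a3, a4⟩ := z1 p hp
    obtain ⟨b1, b2, -, -⟩ := z2 C.c hC.c_mem
    change (Φ p _).1 = 0 at a1
    change (Φ p _).2 = 0 at a2
    change (Φ p _).1 = 0 at a3
    change (Φ p _).2 = 0 at a4
    change (Ψ C.c _).1 = 0 at b1
    change (Ψ C.c _).2 = 0 at b2
    rw [hΦ0] at a1 a2 a3 a4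
    rw [hΨ0] at b1 b2
    exact Subtype.ext (Prod.ext (Prod.ext (Prod.ext a1 a2) (Prod.ext a3 a4))
      (Prod.ext (Prod.ext b1 b2) (Prod.ext z3 z4)))
  -- Prescribed values decouple the circle into three boundary value problems, two with a singular
  -- end and a regular one on the small side.
  have hRsurj : Function.Surjective R := by
    rintro ⟨u, wp, wm⟩
    obtain ⟨Up, lamp, hUp⟩ := hC.endp
    obtain ⟨Um, lamm, hUm⟩ := hC.endm
    obtain ⟨v₂, η₂, s₂, i₂, l₂, δp, l₂'⟩ := hC.regL.exists_sol_right hUp hp u wp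
    obtain ⟨v₁, η₁, s₁, i₁, l₁, δm, l₁'⟩ := hC.regL.exists_sol_left hUm hp u wm
    obtain ⟨Θ, hΘ, hΘb⟩ := hC.regS.exists_dirichlet_flow hC.c_mem hC.d_mem hC.hcd
    obtain ⟨t1, t2⟩ := hΘb (wp, wm)
    have hd := hΨu _ _ (hΘ (wp, wm)) C.d hC.d_mem
    have nb : Ioo C.a C.b ∈ 𝓝[<] C.b := Ioo_mem_nhdsLT hC.hab
    have na : Ioo C.a C.b ∈ 𝓝[>] C.a := Ioo_mem_nhdsGT hC.hab
    refine ⟨⟨(((v₁ p, η₁ p), (v₂ p, η₂ p)), Θ C.c (wp, wm), (δp, δm)), ?_, ?_, ?_⟩, ?_⟩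
    · exact i₁.trans i₂.symm
    · change Tendsto _ _ (𝓝 (C.ιp (Θ C.c (wp, wm)).1, δp))
      rw [t1]
      exact (l₂.prodMk_nhds l₂').congr' (eventually_of_mem nb fun z hz => hΦu _ _ s₂ z hz)
    · change Tendsto _ _ (𝓝 (C.ιm (Ψ C.d (Θ C.c (wp, wm))).1, δm))
      rw [← congrArg Prod.fst hd, t2]
      exact (l₁.prodMk_nhds l₁').congr' (eventually_of_mem na fun z hz => hΦu _ _ s₁ z hz)
    · change (v₂ p, (Θ C.c (wp, wm)).1, (Ψ C.d (Θ C.c (wp, wm))).1) = _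
      rw [i₂, t1, ← congrArg Prod.fst hd, t2]
  obtain ⟨x, hx⟩ := surjective_of_injective_of_surjective hBinj hRsurj (uL, ep, em)
  have h1 := htr x
  rw [hx] at h1
  exact ⟨_, h1⟩

end GluedSystem

end

/-! ### Poles on either side and the uniform bound. -/

noncomputable section

namespace ODESystem

variable {n : ℕ} {Y : ODESystem n} {a b : ℝ} {v η : ℝ → Vn n}

/-- Add to a homogeneous solution, to the right of `q` only, the one with zero value and derivative
`-u` at `q`; the boundary value at `d` is corrected beforehand. -/
theorem Regular.exists_green_dirichlet (h : Y.Regular a b) {c d q : ℝ} (hc : c ∈ Ioo a b)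
    (hd : d ∈ Ioo a b) (hcd : c < d) (hq : q ∈ Ioo a b) (u uc ud : Vn n) :
    ∃ v₁ η₁ v₂ η₂, Y.IsSol (Ioo a b) v₁ η₁ ∧ Y.IsSol (Ioo a b) v₂ η₂ ∧ v₁ q = v₂ q ∧
      η₁ q - η₂ q = u ∧ v₁ c = uc ∧ v₂ d = ud := by
  obtain ⟨y, ζ, hy, hy0, hζ0⟩ := h.exists_sol hq 0 (-u)
  obtain ⟨Θ, hΘ, hΘb⟩ := h.exists_dirichlet_flow hc hd hcd
  obtain ⟨t1, t2⟩ := hΘb (uc, ud - y d)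
  refine ⟨_, _, _, _, hΘ (uc, ud - y d), (hΘ (uc, ud - y d)).add hy, ?_, ?_, t1, ?_⟩
  · rw [hy0, add_zero]
  · rw [hζ0]; abel
  · rw [t2]; exact sub_add_cancel _ _

theorem Regular.wronskian_eq (h : Y.Regular a b) {x ξ : ℝ → Vn n} (hx : Y.IsSol (Ioo a b) x ξ)
    (hv : Y.IsSol (Ioo a b) v η) {s t : ℝ} (hs : s ∈ Ioo a b) (ht : t ∈ Ioo a b) :
    wronskian x ξ v η s = wronskian x ξ v η t := by
  refine (isOpen_Ioo (a := a) (b := b)).is_const_of_deriv_eq_zero isPreconnected_Ioo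
    (fun z hz => ?_) (fun z hz => ?_) hs ht
  · exact (h.hasDerivAt_wronskian hz (hx.mono (singleton_subset_iff.2 hz))
      (hv.mono (singleton_subset_iff.2 hz))).differentiableAt.differentiableWithinAt
  · exact (h.hasDerivAt_wronskian hz (hx.mono (singleton_subset_iff.2 hz))
      (hv.mono (singleton_subset_iff.2 hz))).deriv

/-- A bound for the flux is a bound for the growth of `‖v‖²`. -/
theorem Regular.normSq_sub_mem (h : Y.Regular a b) (hv : Y.IsSol (Ioo a b) v η) {s t γ₁ γ₂ : ℝ}
    (hst : Ioo s t ⊆ Ioo a b) (hγ : ∀ z ∈ Ioo s t, flux v η z ∈ Icc γ₁ γ₂) {w : ℝ → Vn n}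
    (hw : ContinuousOn w (Icc s t)) (hwv : EqOn w v (Ioo s t)) {y z : ℝ} (hy : y ∈ Icc s t)
    (hz : z ∈ Icc s t) (hyz : y ≤ z) :
    2 * γ₁ * (z - y) ≤ ‖w z‖ ^ 2 - ‖w y‖ ^ 2 ∧ ‖w z‖ ^ 2 - ‖w y‖ ^ 2 ≤ 2 * γ₂ * (z - y) := by
  rcases hyz.eq_or_lt with rfl | hlt
  · simp
  · have hsub : Ioo y z ⊆ Ioo s t := Ioo_subset_Ioo hy.1 hz.2
    obtain ⟨ξ, hξ, hs⟩ := exists_hasDerivAt_eq_slope (fun z => ‖w z‖ ^ 2)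
      (fun z => 2 * flux v η z) hlt
      ((hw.mono (Icc_subset_Icc hy.1 hz.2)).norm.pow 2) fun ξ hξ => by
        refine (h.hasDerivAt_normSq (hst (hsub hξ))
          (hv.mono (singleton_subset_iff.2 (hst (hsub hξ))))).congr_of_eventuallyEq ?_
        filter_upwards [isOpen_Ioo.mem_nhds (hsub hξ)] with r hr
        rw [hwv hr]
    have hpos : 0 < z - y := sub_pos.2 hlt
    rw [eq_div_iff hpos.ne'] at hs
    rw [← hs]
    obtain ⟨h1, h2⟩ := hγ ξ (hsub hξ)
    constructor
    · exact mul_le_mul_of_nonneg_right (by linarith) hpos.le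
    · exact mul_le_mul_of_nonneg_right (by linarith) hpos.le

end ODESystem

theorem le_and_le_of_split {f : ℝ → ℝ} {s p t κ₁ κ₂ : ℝ} (hp : p ∈ Icc s t)
    (h₁ : ∀ y ∈ Icc s p, ∀ z ∈ Icc s p, y ≤ z → κ₁ * (z - y) ≤ f z - f y ∧
      f z - f y ≤ κ₂ * (z - y))
    (h₂ : ∀ y ∈ Icc p t, ∀ z ∈ Icc p t, y ≤ z → κ₁ * (z - y) ≤ f z - f y ∧
      f z - f y ≤ κ₂ * (z - y)) :
    ∀ y ∈ Icc s t, ∀ z ∈ Icc s t, y ≤ z → κ₁ * (z - y) ≤ f z - f y ∧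
      f z - f y ≤ κ₂ * (z - y) := by
  intro y hy z hz hyz
  rcases le_total z p with hzp | hzp
  · exact h₁ y ⟨hy.1, hyz.trans hzp⟩ z ⟨hz.1, hzp⟩ hyz
  · rcases le_total p y with hpy | hpy
    · exact h₂ y ⟨hpy, hy.2⟩ z ⟨hzp, hz.2⟩ hyz
    · obtain ⟨i1, i2⟩ := h₁ y ⟨hy.1, hpy⟩ p ⟨hp.1, le_rfl⟩ hpy
      obtain ⟨j1, j2⟩ := h₂ p ⟨le_rfl, hp.2⟩ z ⟨hzp, hz.2⟩ hzp
      constructor <;> nlinarith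

open ODESystem

namespace GluedSystem

variable {k m : ℕ} {C : GluedSystem k m} {p q : ℝ} {uL : Vn m} {uS ep em e : Vn k}
  {X D : Pieces k m}

/-- Existence of sections with a pole on each side. -/
theorem Admissible.exists_transmission (hC : C.Admissible) (hp : p ∈ Ioo C.a C.b)
    (hq : q ∈ Ioo C.c C.d) (uL : Vn m) (uS : Vn k) :
    ∃ X, C.IsTransmission p q uL uS 0 0 X := by
  have hq' : q ∈ Ioo (C.c - 1) (C.d + 1) := hC.Icc_subset (Ioo_subset_Icc_self hq)
  -- The Dirichlet solution for the pole on the small side, extended by zero over the large side. It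
  -- creates derivative jumps at the gluing points, cancelled by a section smooth on the small side;
  -- the sign of `-uS` anticipates the subtraction.
  obtain ⟨v₁, η₁, v₂, η₂, h₁, h₂, hval, hjump, hc, hd⟩ :=
    hC.regS.exists_green_dirichlet hC.c_mem hC.d_mem hC.hcd hq' (-uS) 0 0
  obtain ⟨X, hX⟩ := hC.exists_smooth hp hq uL (-η₁ C.c) (η₂ C.d)
  have hzero : C.YL.IsSol (Ioo C.a C.b) (fun _ => 0) fun _ => 0 := fun z _ => by
    constructor <;> simpa using hasDerivAt_const z (0 : Vn m)
  have h := hX.sub (uL' := 0) (uS' := -uS) (ep' := -η₁ C.c) (em' := η₂ C.d)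
    (X' := ⟨fun _ => 0, fun _ => 0, fun _ => 0, fun _ => 0, v₁, η₁, v₂, η₂, 0, 0⟩)
    { solL₁ := hzero
      solL₂ := hzero
      solS₁ := h₁
      solS₂ := h₂
      valL := rfl
      jumpL := sub_self _
      valS := hval
      jumpS := hjump
      limp := by
        change Tendsto _ _ (𝓝 (C.ιp (v₁ C.c)))
        rw [hc, map_zero]; exact tendsto_const_nhds
      limp' := tendsto_const_nhds
      limm := by
        change Tendsto _ _ (𝓝 (C.ιm (v₂ C.d)))
        rw [hd, map_zero]; exact tendsto_const_nhds
      limm' := tendsto_const_nhds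
      jumpp := by
        change surj C.ιp 0 - η₁ C.c = _
        rw [map_zero, zero_sub]
      jumpm := by
        change η₂ C.d - surj C.ιm 0 = _
        rw [map_zero, sub_zero] }
  simp only [sub_zero, zero_sub, neg_neg, sub_self] at h
  exact ⟨_, h⟩

/-- The continuous section made of the given pieces. -/
structure IsSection (C : GluedSystem k m) (p q : ℝ) (X : Pieces k m) (vL : ℝ → Vn m)
    (vS : ℝ → Vn k) : Prop where
  contL : ContinuousOn vL (Icc C.a C.b)
  contS : ContinuousOn vS (Icc C.c C.d)
  eqL₁ : ∀ z ∈ Ioo C.a C.b, z ≤ p → vL z = X.vL₁ z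
  eqL₂ : ∀ z ∈ Ioo C.a C.b, p ≤ z → vL z = X.vL₂ z
  eqS₁ : ∀ z ∈ Icc C.c C.d, z ≤ q → vS z = X.vS₁ z
  eqS₂ : ∀ z ∈ Icc C.c C.d, q ≤ z → vS z = X.vS₂ z

theorem IsSection.glue_plus {vL : ℝ → Vn m} {vS : ℝ → Vn k} (hC : C.Admissible)
    (hp : p ∈ Ioo C.a C.b) (hq : q ∈ Ioo C.c C.d) (hX : C.IsTransmission p q uL uS ep em X)
    (h : C.IsSection p q X vL vS) : vL C.b = C.ιp (vS C.c) := by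
  rw [h.eqS₁ C.c (left_mem_Icc.2 hC.hcd.le) hq.1.le]
  have h1 := (h.contL C.b (right_mem_Icc.2 hC.hab.le)).mono_left
    (nhdsWithin_mono C.b (Ioo_subset_Icc_self))
  rw [nhdsWithin_Ioo_eq_nhdsLT hC.hab] at h1
  refine tendsto_nhds_unique h1 (hX.limp.congr' ?_)
  filter_upwards [Ioo_mem_nhdsLT hp.2] with z hz
  exact (h.eqL₂ z ⟨hp.1.trans hz.1, hz.2⟩ hz.1.le).symm

theorem IsSection.glue_minus {vL : ℝ → Vn m} {vS : ℝ → Vn k} (hC : C.Admissible)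
    (hp : p ∈ Ioo C.a C.b) (hq : q ∈ Ioo C.c C.d) (hX : C.IsTransmission p q uL uS ep em X)
    (h : C.IsSection p q X vL vS) : vL C.a = C.ιm (vS C.d) := by
  rw [h.eqS₂ C.d (right_mem_Icc.2 hC.hcd.le) hq.2.le]
  have h1 := (h.contL C.a (left_mem_Icc.2 hC.hab.le)).mono_left
    (nhdsWithin_mono C.a (Ioo_subset_Icc_self))
  rw [nhdsWithin_Ioo_eq_nhdsGT hC.hab] at h1
  refine tendsto_nhds_unique h1 (hX.limm.congr' ?_)
  filter_upwards [Ioo_mem_nhdsGT hp.1] with z hz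
  exact (h.eqL₁ z ⟨hz.1, hz.2.trans hp.2⟩ hz.2.le).symm

theorem Admissible.exists_isSection (hC : C.Admissible) (hp : p ∈ Ioo C.a C.b)
    (hX : C.IsTransmission p q uL uS ep em X) : ∃ vL vS, C.IsSection p q X vL vS := by
  set f : ℝ → Vn m := fun z => if z ≤ p then X.vL₁ z else X.vL₂ z with hf
  set g : ℝ → Vn k := fun z => if z ≤ q then X.vS₁ z else X.vS₂ z with hg
  have hf1 : ∀ z, z ≤ p → f z = X.vL₁ z := fun z hz => if_pos hz
  have hf2 : ∀ z, p ≤ z → f z = X.vL₂ z := fun z hz => by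
    rcases hz.eq_or_lt with rfl | h1
    · rw [hf1 _ le_rfl, hX.valL]
    · exact if_neg (not_le.2 h1)
  have hg1 : ∀ z, z ≤ q → g z = X.vS₁ z := fun z hz => if_pos hz
  have hg2 : ∀ z, q ≤ z → g z = X.vS₂ z := fun z hz => by
    rcases hz.eq_or_lt with rfl | h1
    · rw [hg1 _ le_rfl, hX.valS]
    · exact if_neg (not_le.2 h1)
  have hfc : ContinuousOn f (Ioo C.a C.b) := by
    refine ContinuousOn.if (p := fun z => z ≤ p) ?_
      (hX.solL₁.continuousOn.mono inter_subset_left) (hX.solL₂.continuousOn.mono inter_subset_left)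
    rintro z ⟨-, hz⟩
    have hz' : z = p := by simpa using frontier_le_subset_eq continuous_id continuous_const hz
    rw [hz', hX.valL]
  have hgc : ContinuousOn g (Ioo (C.c - 1) (C.d + 1)) := by
    refine ContinuousOn.if (p := fun z => z ≤ q) ?_
      (hX.solS₁.continuousOn.mono inter_subset_left) (hX.solS₂.continuousOn.mono inter_subset_left)
    rintro z ⟨-, hz⟩
    have hz' : z = q := by simpa using frontier_le_subset_eq continuous_id continuous_const hz
    rw [hz', hX.valS]
  have hfe : ∀ z ∈ Ioo C.a C.b, extendFrom (Ioo C.a C.b) f z = f z := fun z hz =>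
    extendFrom_extends hfc z hz
  refine ⟨extendFrom (Ioo C.a C.b) f, g, ⟨?_, hgc.mono hC.Icc_subset, fun z hz h1 => ?_,
    fun z hz h1 => ?_, fun z _ h1 => hg1 z h1, fun z _ h1 => hg2 z h1⟩⟩
  · refine continuousOn_Icc_extendFrom_Ioo hfc (hX.limm.congr' ?_) (hX.limp.congr' ?_)
    · filter_upwards [Ioo_mem_nhdsGT hp.1] with z hz using (hf1 z hz.2.le).symm
    · filter_upwards [Ioo_mem_nhdsLT hp.2] with z hz using (hf2 z hz.1.le).symm
  · rw [hfe z hz, hf1 z h1]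
  · rw [hfe z hz, hf2 z h1]

/-- As for the flux, values in `im ι` see only `π` of the derivatives, so Wronskians can be carried
across the gluing points. -/
theorem tendsto_wronskian {n : ℕ} {l : Filter ℝ} {ι : Vn k →ₗᵢ[ℂ] Vn n} {x ξ v η : ℝ → Vn n}
    {y w : Vn k} {δ ε : Vn n} (hx : Tendsto x l (𝓝 (ι y))) (hξ : Tendsto ξ l (𝓝 δ))
    (hv : Tendsto v l (𝓝 (ι w))) (hη : Tendsto η l (𝓝 ε)) :
    Tendsto (wronskian x ξ v η) l (𝓝 (inner ℂ (surj ι δ) w - inner ℂ y (surj ι ε))) := by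
  rw [← inner_surj, ← inner_surj_left]
  exact (hξ.inner hv).sub (hx.inner hη)

/-- Green's identity around the circle. -/
theorem IsTransmission.inner_eq (hC : C.Admissible) {p₀ q₀ : ℝ} (hp₀ : p₀ ∈ Ioo C.a C.b)
    (hq₀ : q₀ ∈ Ioo C.c C.d) (hD : C.IsTransmission p₀ q₀ 0 0 e 0 D) (hp : p ∈ Ioo C.a C.b)
    (hq : q ∈ Ioo C.c C.d) (hX : C.IsTransmission p q uL uS 0 0 X) :
    inner ℂ e (X.vS₁ C.c) = inner ℂ (D.vL₁ p) uL + inner ℂ (D.vS₁ q) uS := by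
  have hS : Ioo C.c C.d ⊆ Ioo (C.c - 1) (C.d + 1) := Ioo_subset_Icc_self.trans hC.Icc_subset
  obtain ⟨hL, hL'⟩ := hC.regL.eqOn hp₀ hD.solL₁ hD.solL₂ hD.valL (sub_eq_zero.1 hD.jumpL)
  obtain ⟨hT, hT'⟩ := hC.regS.eqOn (hS hq₀) hD.solS₁ hD.solS₂ hD.valS (sub_eq_zero.1 hD.jumpS)
  have nb : Ioo C.a C.b ∈ 𝓝[<] C.b := Ioo_mem_nhdsLT hC.hab
  have na : Ioo C.a C.b ∈ 𝓝[>] C.a := Ioo_mem_nhdsGT hC.hab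
  have w1 := tendsto_nhds_unique
    ((tendsto_const_nhds (x := wronskian D.vL₁ D.ηL₁ X.vL₁ X.ηL₁ p)).congr'
      (eventually_of_mem na fun z hz => hC.regL.wronskian_eq hD.solL₁ hX.solL₁ hp hz))
    (tendsto_wronskian hD.limm hD.limm' hX.limm hX.limm')
  have w2 := tendsto_nhds_unique
    ((tendsto_const_nhds (x := wronskian D.vL₂ D.ηL₂ X.vL₂ X.ηL₂ p)).congr'
      (eventually_of_mem nb fun z hz => hC.regL.wronskian_eq hD.solL₂ hX.solL₂ hp hz))
    (tendsto_wronskian hD.limp hD.limp' hX.limp hX.limp')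
  have w3 := hC.regS.wronskian_eq hD.solS₁ hX.solS₁ (hS hq) hC.c_mem
  have w4 := hC.regS.wronskian_eq hD.solS₂ hX.solS₂ (hS hq) hC.d_mem
  rw [← sub_eq_zero.1 hD.jumpm, ← sub_eq_zero.1 hX.jumpm] at w1
  rw [sub_eq_zero.1 hX.jumpp, eq_add_of_sub_eq hD.jumpp, inner_add_left] at w2
  rw [← hX.jumpL, ← hX.jumpS, inner_sub_right, inner_sub_right]
  simp only [wronskian] at w1 w2 w3 w4
  rw [← hL hp, ← hL' hp, ← hX.valL] at w2
  rw [← hT (hS hq), ← hT' (hS hq), ← hX.valS] at w4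
  -- The Wronskian is constant on each of the four arcs; going around the circle, only its jumps at
  -- `p`, `q` and `c` remain.
  linear_combination w1 - w2 + w3 - w4

/-- The value of a solution at one of the gluing points is bounded by the sizes of the jumps,
uniformly in the poles. -/
theorem Admissible.exists_bound_at (hC : C.Admissible) :
    ∃ M, 0 ≤ M ∧ ∀ p ∈ Ioo C.a C.b, ∀ q ∈ Ioo C.c C.d, ∀ uL uS X,
      C.IsTransmission p q uL uS 0 0 X → ‖X.vS₁ C.c‖ ≤ M * (‖uL‖ + ‖uS‖) := by
  obtain ⟨p₀, hp₀⟩ := exists_between hC.hab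
  obtain ⟨q₀, hq₀⟩ := exists_between hC.hcd
  have key : ∀ e : Vn k, ∃ K, 0 ≤ K ∧ ∀ p ∈ Ioo C.a C.b, ∀ q ∈ Ioo C.c C.d, ∀ uL uS X,
      C.IsTransmission p q uL uS 0 0 X → ‖inner ℂ e (X.vS₁ C.c)‖ ≤ K * (‖uL‖ + ‖uS‖) := by
    intro e
    -- Duality: this section, whose only jump `e` is at the gluing point, does not depend on `p` or
    -- `q`, and it is bounded, so Green's identity gives a constant independent of the poles.
    obtain ⟨D, hD⟩ := hC.exists_smooth hp₀ hq₀ 0 e 0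
    obtain ⟨xL, xS, hx⟩ := hC.exists_isSection hp₀ hD
    have hS : Ioo C.c C.d ⊆ Ioo (C.c - 1) (C.d + 1) := Ioo_subset_Icc_self.trans hC.Icc_subset
    obtain ⟨hL, -⟩ := hC.regL.eqOn hp₀ hD.solL₁ hD.solL₂ hD.valL (sub_eq_zero.1 hD.jumpL)
    obtain ⟨K₁, hK₁⟩ := isCompact_Icc.exists_bound_of_continuousOn hx.contL
    obtain ⟨K₂, hK₂⟩ := isCompact_Icc.exists_bound_of_continuousOn
      (hD.solS₁.continuousOn.mono hC.Icc_subset)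
    refine ⟨max (max K₁ K₂) 0, le_max_right _ _, fun p hp q hq uL uS X hX => ?_⟩
    rw [hD.inner_eq hC hp₀ hq₀ hp hq hX, mul_add]
    have b1 : ‖D.vL₁ p‖ ≤ max (max K₁ K₂) 0 := by
      refine le_trans ?_ ((le_max_left K₁ K₂).trans (le_max_left _ _))
      have h1 := hK₁ p (Ioo_subset_Icc_self hp)
      rcases le_total p p₀ with h2 | h2
      · rwa [hx.eqL₁ p hp h2] at h1
      · rwa [hx.eqL₂ p hp h2, ← hL hp] at h1
    have b2 : ‖D.vS₁ q‖ ≤ max (max K₁ K₂) 0 :=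
      (hK₂ q (Ioo_subset_Icc_self hq)).trans ((le_max_right K₁ K₂).trans (le_max_left _ _))
    refine (norm_add_le _ _).trans (add_le_add ?_ ?_)
    · exact (norm_inner_le_norm _ _).trans (mul_le_mul_of_nonneg_right b1 (norm_nonneg _))
    · exact (norm_inner_le_norm _ _).trans (mul_le_mul_of_nonneg_right b2 (norm_nonneg _))
  choose K hK0 hK using fun i : Fin k => key (EuclideanSpace.single i 1)
  refine ⟨∑ i, K i, Finset.sum_nonneg fun i _ => hK0 i, fun p hp q hq uL uS X hX => ?_⟩
  have h1 : X.vS₁ C.c = ∑ i, (X.vS₁ C.c i) • EuclideanSpace.single i (1 : ℂ) := by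
    ext i
    simp [Finset.sum_apply, Pi.single_apply]
  rw [h1, Finset.sum_mul]
  refine (norm_sum_le _ _).trans (Finset.sum_le_sum fun i _ => ?_)
  have h2 := hK i p hp q hq uL uS X hX
  rw [EuclideanSpace.inner_single_left] at h2
  rw [norm_smul]
  simpa using h2

/-- Cauchy–Schwarz at a pole: `v` is continuous there, so the flux jumps by `Re ⟨v, u⟩`. -/
theorem abs_flux_sub_le {n : ℕ} {v₁ η₁ v₂ η₂ : ℝ → Vn n} {z : ℝ} (h : v₁ z = v₂ z) :
    |flux v₁ η₁ z - flux v₂ η₂ z| ≤ ‖v₁ z‖ * ‖η₁ z - η₂ z‖ := by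
  rw [flux, flux, ← h, ← Complex.sub_re, ← inner_sub_right]
  exact (Complex.abs_re_le_norm _).trans (norm_inner_le_norm _ _)

/-- The oscillation of `‖v‖²` over the circle is bounded by the jumps of the flux. -/
theorem IsTransmission.normSq_le (hC : C.Admissible) (hp : p ∈ Ioo C.a C.b)
    (hq : q ∈ Ioo C.c C.d) (hX : C.IsTransmission p q uL uS 0 0 X) {vL : ℝ → Vn m}
    {vS : ℝ → Vn k} (hv : C.IsSection p q X vL vS) {K : ℝ} (hKL : ‖vL p‖ * ‖uL‖ ≤ K)
    (hKS : ‖vS q‖ * ‖uS‖ ≤ K) :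
    (∀ z ∈ Icc C.a C.b, ‖vL z‖ ^ 2 ≤ ‖vS C.c‖ ^ 2 + 8 * K * (C.b - C.a)) ∧
    ∀ z ∈ Icc C.c C.d, ‖vS z‖ ^ 2 ≤ ‖vS C.c‖ ^ 2 + 8 * K * (C.d - C.c) := by
  have hS : Icc C.c C.d ⊆ Ioo (C.c - 1) (C.d + 1) := hC.Icc_subset
  have hqI : q ∈ Icc C.c C.d := Ioo_subset_Icc_self hq
  have JL : |flux X.vL₁ X.ηL₁ p - flux X.vL₂ X.ηL₂ p| ≤ K := by
    refine (abs_flux_sub_le hX.valL).trans ?_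
    rw [hX.jumpL, ← hv.eqL₁ p hp le_rfl]
    exact hKL
  have JS : |flux X.vS₁ X.ηS₁ q - flux X.vS₂ X.ηS₂ q| ≤ K := by
    refine (abs_flux_sub_le hX.valS).trans ?_
    rw [hX.jumpS, ← hv.eqS₁ q hqI le_rfl]
    exact hKS
  have f1 := tendsto_flux hX.limm hX.limm'
  rw [← sub_eq_zero.1 hX.jumpm] at f1
  change Tendsto _ _ (𝓝 (flux X.vS₂ X.ηS₂ C.d)) at f1
  have f2 := tendsto_flux hX.limp hX.limp'
  rw [sub_eq_zero.1 hX.jumpp] at f2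
  change Tendsto _ _ (𝓝 (flux X.vS₁ X.ηS₁ C.c)) at f2
  have cL : ∀ {v η : ℝ → Vn m}, C.YL.IsSol (Ioo C.a C.b) v η → ContinuousAt (flux v η) p :=
    fun h => (hC.regL.continuousOn_flux h).continuousAt (isOpen_Ioo.mem_nhds hp)
  have iL1 : Ioo C.a p ⊆ Ioo C.a C.b := Ioo_subset_Ioo_right hp.2.le
  have iL2 : Ioo p C.b ⊆ Ioo C.a C.b := Ioo_subset_Ioo_left hp.1.le
  have rL1 := hC.regL.mono iL1
  have rL2 := hC.regL.mono iL2
  have gL1 := fun z hz => rL1.flux_mem_Icc (hX.solL₁.mono iL1) f1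
    ((cL hX.solL₁).mono_left nhdsWithin_le_nhds) (z := z) hz
  have gL2 := fun z hz => rL2.flux_mem_Icc (hX.solL₂.mono iL2)
    ((cL hX.solL₂).mono_left nhdsWithin_le_nhds) f2 (z := z) hz
  have lL1 := rL1.flux_lim_le hp.1 (hX.solL₁.mono iL1) f1
    ((cL hX.solL₁).mono_left nhdsWithin_le_nhds)
  have lL2 := rL2.flux_lim_le hp.2 (hX.solL₂.mono iL2)
    ((cL hX.solL₂).mono_left nhdsWithin_le_nhds) f2
  have mS1 := hC.regS.monotoneOn_flux hX.solS₁
  have mS2 := hC.regS.monotoneOn_flux hX.solS₂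
  have lS1 := mS1 hC.c_mem (hS hqI) hq.1.le
  have lS2 := mS2 (hS hqI) hC.d_mem hq.2.le
  have iS1 : Icc C.c q ⊆ Icc C.c C.d := Icc_subset_Icc_right hq.2.le
  have iS2 : Icc q C.d ⊆ Icc C.c C.d := Icc_subset_Icc_left hq.1.le
  set γ := flux X.vS₂ X.ηS₂ C.d with hγ
  rw [abs_le] at JL JS
  -- The flux starts at `γ`, increases around the circle apart from jumps of size at most `K` at `p`
  -- and `q`, and returns to `γ`; hence it never leaves `[γ - 2K, γ + 2K]`.
  have hL := le_and_le_of_split (f := fun z => ‖vL z‖ ^ 2) (κ₁ := 2 * (γ - 2 * K))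
    (κ₂ := 2 * (γ + 2 * K)) (Ioo_subset_Icc_self hp)
    (fun y hy z hz hyz => hC.regL.normSq_sub_mem hX.solL₁ iL1
      (fun w hw => ⟨by linarith [(gL1 w hw).1], by linarith [(gL1 w hw).2]⟩)
      (hv.contL.mono (Icc_subset_Icc_right hp.2.le))
      (fun w hw => hv.eqL₁ w (iL1 hw) hw.2.le) hy hz hyz)
    (fun y hy z hz hyz => hC.regL.normSq_sub_mem hX.solL₂ iL2
      (fun w hw => ⟨by linarith [(gL2 w hw).1], by linarith [(gL2 w hw).2]⟩)
      (hv.contL.mono (Icc_subset_Icc_left hp.1.le))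
      (fun w hw => hv.eqL₂ w (iL2 hw) hw.1.le) hy hz hyz)
  have hT := le_and_le_of_split (f := fun z => ‖vS z‖ ^ 2) (κ₁ := 2 * (γ - 2 * K))
    (κ₂ := 2 * (γ + 2 * K)) hqI
    (fun y hy z hz hyz => hC.regS.normSq_sub_mem hX.solS₁
      (Ioo_subset_Icc_self.trans (iS1.trans hS))
      (fun w hw => by
        have hw' := iS1 (Ioo_subset_Icc_self hw)
        have j1 := mS1 hC.c_mem (hS hw') hw.1.le
        have j2 := mS1 (hS hw') (hS hqI) hw.2.le
        exact ⟨by linarith, by linarith⟩)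
      (hv.contS.mono iS1)
      (fun w hw => hv.eqS₁ w (iS1 (Ioo_subset_Icc_self hw)) hw.2.le) hy hz hyz)
    (fun y hy z hz hyz => hC.regS.normSq_sub_mem hX.solS₂
      (Ioo_subset_Icc_self.trans (iS2.trans hS))
      (fun w hw => by
        have hw' := iS2 (Ioo_subset_Icc_self hw)
        have j1 := mS2 (hS hqI) (hS hw') hw.1.le
        have j2 := mS2 (hS hw') hC.d_mem hw.2.le
        exact ⟨by linarith, by linarith⟩)
      (hv.contS.mono iS2)
      (fun w hw => hv.eqS₂ w (iS2 (Ioo_subset_Icc_self hw)) hw.1.le) hy hz hyz)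
  have ab := hC.hab
  have cd := hC.hcd
  have ma : C.a ∈ Icc C.a C.b := left_mem_Icc.2 ab.le
  have mb : C.b ∈ Icc C.a C.b := right_mem_Icc.2 ab.le
  have mc : C.c ∈ Icc C.c C.d := left_mem_Icc.2 cd.le
  have md : C.d ∈ Icc C.c C.d := right_mem_Icc.2 cd.le
  have eb : ‖vL C.b‖ = ‖vS C.c‖ := by rw [hv.glue_plus hC hp hq hX, C.ιp.norm_map]
  have ea : ‖vL C.a‖ = ‖vS C.d‖ := by rw [hv.glue_minus hC hp hq hX, C.ιm.norm_map]
  obtain ⟨t1, t2⟩ := hL _ ma _ mb ab.le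
  obtain ⟨t3, t4⟩ := hT _ mc _ md cd.le
  simp only [ea, eb] at t1 t2
  have hlen : 0 < (C.b - C.a) + (C.d - C.c) := by linarith
  -- `‖v‖²` is the same after a full turn, so its slope bounds `2 (γ ± 2K)` cannot have a common
  -- strict sign. This gives `|γ| ≤ 2K`, flux at most `4K`, slope at most `8K`.
  have hlow : γ - 2 * K ≤ 0 := by
    by_contra h1
    have := mul_pos (not_le.1 h1) hlen
    linarith
  have hhigh : 0 ≤ γ + 2 * K := by
    by_contra h1
    have := mul_neg_of_neg_of_pos (not_le.1 h1) hlen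
    linarith
  have hK0 : 0 ≤ K := le_trans (by positivity) hKL
  constructor
  · intro z hz
    obtain ⟨s1, -⟩ := hL z hz _ mb hz.2
    simp only [eb] at s1
    have h1 : (γ - 2 * K + 4 * K) * (C.b - z) ≥ 0 :=
      mul_nonneg (by linarith) (by linarith [hz.2])
    have h2 : K * (z - C.a) ≥ 0 := mul_nonneg hK0 (by linarith [hz.1])
    nlinarith
  · intro z hz
    obtain ⟨-, s2⟩ := hT _ mc z hz hz.1
    have h1 : (4 * K - (γ + 2 * K)) * (z - C.c) ≥ 0 :=
      mul_nonneg (by linarith) (by linarith [hz.1])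
    have h2 : K * (C.d - z) ≥ 0 := mul_nonneg hK0 (by linarith [hz.2])
    nlinarith

/-- Solutions are bounded by the sizes of the jumps, uniformly in the poles. -/
theorem Admissible.exists_bound (hC : C.Admissible) :
    ∃ M, ∀ p ∈ Ioo C.a C.b, ∀ q ∈ Ioo C.c C.d, ∀ uL uS X vL vS,
      C.IsTransmission p q uL uS 0 0 X → C.IsSection p q X vL vS →
      (∀ z ∈ Icc C.a C.b, ‖vL z‖ ≤ M * (‖uL‖ + ‖uS‖)) ∧
      ∀ z ∈ Icc C.c C.d, ‖vS z‖ ≤ M * (‖uL‖ + ‖uS‖) := by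
  obtain ⟨M, hM0, hM⟩ := hC.exists_bound_at
  have ab := hC.hab
  have cd := hC.hcd
  set ℓ : ℝ := (C.b - C.a) + (C.d - C.c) with hℓ
  have hℓ0 : 0 < ℓ := by rw [hℓ]; linarith
  refine ⟨M + 8 * ℓ, fun p hp q hq uL uS X vL vS hX hv => ?_⟩
  set u : ℝ := ‖uL‖ + ‖uS‖ with hu
  have hu0 : 0 ≤ u := by positivity
  obtain ⟨zL, hzL, hmL⟩ := isCompact_Icc.exists_isMaxOn (nonempty_Icc.2 ab.le) hv.contL.norm
  obtain ⟨zS, hzS, hmS⟩ := isCompact_Icc.exists_isMaxOn (nonempty_Icc.2 cd.le) hv.contS.norm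
  set s : ℝ := max ‖vL zL‖ ‖vS zS‖ with hs
  have bL : ∀ z ∈ Icc C.a C.b, ‖vL z‖ ≤ s := fun z hz => (hmL hz).trans (le_max_left _ _)
  have bS : ∀ z ∈ Icc C.c C.d, ‖vS z‖ ≤ s := fun z hz => (hmS hz).trans (le_max_right _ _)
  have hs0 : 0 ≤ s := (norm_nonneg _).trans (le_max_left _ _)
  have mc : C.c ∈ Icc C.c C.d := left_mem_Icc.2 cd.le
  have hc : ‖vS C.c‖ ≤ M * u := by
    rw [hv.eqS₁ _ mc hq.1.le]; exact hM p hp q hq uL uS X hX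
  obtain ⟨nL, nS⟩ := hX.normSq_le hC hp hq hv (K := s * u)
    (mul_le_mul (bL p (Ioo_subset_Icc_self hp)) (le_add_of_nonneg_right (norm_nonneg _))
      (norm_nonneg _) hs0)
    (mul_le_mul (bS q (Ioo_subset_Icc_self hq)) (le_add_of_nonneg_left (norm_nonneg _))
      (norm_nonneg _) hs0)
  have hsu : 0 ≤ s * u := mul_nonneg hs0 hu0
  have hc2 : ‖vS C.c‖ ^ 2 ≤ (M * u) ^ 2 := pow_le_pow_left₀ (norm_nonneg _) hc 2
  have hss : s ^ 2 ≤ (M * u) ^ 2 + 8 * (s * u) * ℓ := by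
    have h1 := mul_nonneg hsu (sub_nonneg.2 ab.le)
    have h2 := mul_nonneg hsu (sub_nonneg.2 cd.le)
    rcases max_choice ‖vL zL‖ ‖vS zS‖ with h3 | h3
    · have := nL zL hzL
      rw [← h3] at this
      rw [hℓ]
      linarith
    · have := nS zS hzS
      rw [← h3] at this
      rw [hℓ]
      linarith
  -- If `s > (M + 8ℓ) u`, then `s²` would exceed `M u s + 8 ℓ u s`, which is at least `(M u)² + 8 s
  -- u ℓ`.
  have key : s ≤ (M + 8 * ℓ) * u := by
    by_contra h1
    have h2 := not_le.1 h1
    have h3 : 0 ≤ M * u := mul_nonneg hM0 hu0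
    have h4 : 0 ≤ ℓ * u := mul_nonneg hℓ0.le hu0
    have h5 : M * u ≤ s := by linarith
    have h6 : (M * u) ^ 2 ≤ M * u * s := by
      rw [sq]; exact mul_le_mul_of_nonneg_left h5 h3
    have h7 : 0 < s := lt_of_le_of_lt (mul_nonneg (by positivity) hu0) h2
    have h8 := mul_lt_mul_of_pos_right h2 h7
    nlinarith
  exact ⟨fun z hz => (bL z hz).trans key, fun z hz => (bS z hz).trans key⟩

end GluedSystem

end

/-! ### Application to the Nahm data. -/

noncomputable section

open ODESystem

/-- The data `T` on `[a, b]`, extended to the line by constants. -/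
def clampData {n : ℕ} (T : Fin 4 → ℝ → Mn n) (a b : ℝ) : Fin 4 → ℝ → Mn n :=
  fun i z => T i (max a (min b z))

section Clamp

variable {n : ℕ} {T : Fin 4 → ℝ → Mn n} {a b μ₀ : ℝ} {x : Fin 4 → ℝ} {v η : ℝ → Vn n}

theorem clampData_eq {z : ℝ} (hz : z ∈ Icc a b) (i : Fin 4) : clampData T a b i z = T i z := by
  rw [clampData, min_eq_right hz.2, max_eq_right hz.1]

theorem nahmSystem_P_eq {T T' : Fin 4 → ℝ → Mn n} {z : ℝ} (h : T 0 z = T' 0 z) :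
    (nahmSystem μ₀ T x).P z = (nahmSystem μ₀ T' x).P z := by
  rw [nahmSystem_P, nahmSystem_P, h]

theorem nahmSystem_S_eq {T T' : Fin 4 → ℝ → Mn n} {z : ℝ} {i : Fin 3}
    (h : T i.succ z = T' i.succ z) :
    (nahmSystem μ₀ T x).S i z = (nahmSystem μ₀ T' x).S i z := by
  rw [nahmSystem_S, nahmSystem_S, h]

theorem isSol_nahmSystem_congr {T T' : Fin 4 → ℝ → Mn n} {s : Set ℝ}
    (h : ∀ z ∈ s, ∀ i, T i z = T' i z) (hv : (nahmSystem μ₀ T x).IsSol s v η) :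
    (nahmSystem μ₀ T' x).IsSol s v η := fun z hz => by
  have hN : (nahmSystem μ₀ T' x).N z = (nahmSystem μ₀ T x).N z := by
    rw [ODESystem.N, ODESystem.N]
    exact Finset.sum_congr rfl fun i _ => by rw [nahmSystem_S_eq (h z hz i.succ)]
  rw [hN, ← nahmSystem_P_eq (h z hz 0)]
  exact hv z hz

/-- Extension by constants turns the ends of the small interval into interior points of a regular
system; skewness at the ends holds by continuity. -/
theorem NahmOn.regular_clampData (h : NahmOn T a b) (hab : a < b)
    (hc : ∀ i, ContinuousOn (T i) (Icc a b)) (μ₀ : ℝ) (x : Fin 4 → ℝ) (c d : ℝ) :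
    (nahmSystem μ₀ (clampData T a b) x).Regular c d := by
  have hmem : ∀ z : ℝ, max a (min b z) ∈ Icc a b := fun z =>
    ⟨le_max_left _ _, max_le hab.le (min_le_left _ _)⟩
  have hcl : ∀ i, Continuous (clampData T a b i) := fun i =>
    (hc i).comp_continuous (by fun_prop) hmem
  have hskew : EqOn (fun z => ContinuousLinearMap.adjoint (T 0 z)) (fun z => -T 0 z)
      (Icc a b) := by
    have h1 : EqOn (fun z => ContinuousLinearMap.adjoint (T 0 z)) (fun z => -T 0 z)
        (Ioo a b) := fun z hz => h.skew 0 z hz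
    exact h1.of_subset_closure (ContinuousLinearMap.adjoint.continuous.comp_continuousOn (hc 0))
      (hc 0).neg Ioo_subset_Icc_self (closure_Ioo hab.ne).ge
  exact ⟨((hcl 0).sub continuous_const).continuousOn,
    fun i => ((hcl i.succ).sub continuous_const).continuousOn,
    fun z _ => adjoint_sub_I_smul_one (hskew (hmem z)) _⟩

/-- Solutions on `(a, b)` extend to solutions for the extended data. -/
theorem NahmOn.exists_extension (h : NahmOn T a b) (hab : a < b)
    (hc : ∀ i, ContinuousOn (T i) (Icc a b)) (hv : (nahmSystem μ₀ T x).IsSol (Ioo a b) v η) :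
    ∃ v' η', (nahmSystem μ₀ (clampData T a b) x).IsSol (Ioo (a - 1) (b + 1)) v' η' ∧
      EqOn v v' (Ioo a b) ∧ EqOn η η' (Ioo a b) := by
  obtain ⟨m, hm⟩ := exists_between hab
  have hsub : Ioo a b ⊆ Ioo (a - 1) (b + 1) := Ioo_subset_Ioo (by linarith) (by linarith)
  obtain ⟨v', η', h1, h2, h3⟩ :=
    (h.regular_clampData hab hc μ₀ x (a - 1) (b + 1)).exists_sol (hsub hm) (v m) (η m)
  have h4 : (nahmSystem μ₀ (clampData T a b) x).IsSol (Ioo a b) v η :=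
    isSol_nahmSystem_congr (fun z hz i => (clampData_eq (Ioo_subset_Icc_self hz) i).symm) hv
  exact ⟨v', η', h1, (h.regular_clampData hab hc μ₀ x a b).eqOn hm h4 (h1.mono hsub)
    h2.symm h3.symm⟩

/-- The gluing condition is stated with `d/dz + T₀`, while `η` belongs to `P = T₀ - i μ₀ x₀`. The
difference is a scalar multiple of a continuous section, so it does not affect the matching. -/
theorem covDeriv_eq {s t : ℝ} (hv : (nahmSystem μ₀ T x).IsSol (Ioo s t) v η) {w : ℝ → Vn n}
    (hw : EqOn w v (Ioo s t)) {z : ℝ} (hz : z ∈ Ioo s t) :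
    covDeriv T w z = η z + (Complex.I * ((μ₀ * x 0 : ℝ) : ℂ)) • w z := by
  have h1 : w =ᶠ[𝓝 z] v := eventually_of_mem (isOpen_Ioo.mem_nhds hz) hw
  rw [covDeriv, h1.deriv_eq, (hv z hz).1.deriv, hw hz]
  change η z - (T 0 z (v z) - (Complex.I * ((μ₀ * x 0 : ℝ) : ℂ)) • v z) + T 0 z (v z) = _
  abel

/-- Lets every equation be treated as having one pole on each side, one of them possibly of strength
zero. -/
theorem zeroDistr_eq_diracAt (p : ℝ) : (zeroDistr : (ℝ → Vn n) → ℂ) = diracAt p 0 := by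
  ext φ
  rw [zeroDistr, diracAt, inner_zero_right]

end Clamp

section Interval

variable {n : ℕ} {T : Fin 4 → ℝ → Mn n} {a b p μ₀ : ℝ} {x : Fin 4 → ℝ} {u ua ub : Vn n}

/-- The Dirichlet problem for `D₁* D₁ v = δ_p u` on a regular interval. -/
theorem NahmOn.exists_solvesOnInterval (h : NahmOn T a b)
    (hc : ∀ i, ContinuousOn (T i) (Icc a b)) (hp : p ∈ Ioo a b) (u ua ub : Vn n) :
    ∃ v, SolvesOnInterval μ₀ T x a b ua ub (diracAt p u) v := by
  have hab : a < b := hp.1.trans hp.2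
  have hsub : Icc a b ⊆ Ioo (a - 1) (b + 1) := Icc_subset_Ioo (by linarith) (by linarith)
  obtain ⟨v₁, η₁, v₂, η₂, h₁, h₂, hval, hjump, ha, hb⟩ :=
    (h.regular_clampData hab hc μ₀ x (a - 1) (b + 1)).exists_green_dirichlet
      (hsub (left_mem_Icc.2 hab.le)) (hsub (right_mem_Icc.2 hab.le)) hab
      (hsub (Ioo_subset_Icc_self hp)) u ua ub
  have hcongr : ∀ {v η : ℝ → Vn n},
      (nahmSystem μ₀ (clampData T a b) x).IsSol (Ioo (a - 1) (b + 1)) v η →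
      (nahmSystem μ₀ T x).IsSol (Ioo a b) v η := fun hv =>
    isSol_nahmSystem_congr (fun z hz i => clampData_eq (Ioo_subset_Icc_self hz) i)
      (hv.mono (Ioo_subset_Icc_self.trans hsub))
  set f : ℝ → Vn n := fun z => if z ≤ p then v₁ z else v₂ z with hf
  have hf1 : ∀ z, z ≤ p → f z = v₁ z := fun z hz => if_pos hz
  have hf2 : ∀ z, p ≤ z → f z = v₂ z := fun z hz => by
    rcases hz.eq_or_lt with rfl | h1
    · rw [hf1 _ le_rfl, hval]
    · exact if_neg (not_le.2 h1)
  refine ⟨f, ⟨?_, by rw [hf1 a hp.1.le, ha], by rw [hf2 b hp.2.le, hb],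
    h.weakEq_of_isGreen hp ⟨hcongr h₁, hcongr h₂, hval, hjump, fun z _ h1 => hf1 z h1,
      fun z _ h1 => hf2 z h1⟩⟩⟩
  refine ContinuousOn.if (p := fun z => z ≤ p) ?_
    (h₁.continuousOn.mono (inter_subset_left.trans hsub))
    (h₂.continuousOn.mono (inter_subset_left.trans hsub))
  rintro z ⟨-, hz⟩
  have hz' : z = p := by simpa using frontier_le_subset_eq continuous_id continuous_const hz
  rw [hz', hval]

/-- The difference is a classical solution which extends past both ends, where the Dirichlet
uniqueness at interior points applies. -/
theorem NahmOn.solvesOnInterval_unique (h : NahmOn T a b) (hab : a < b)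
    (hc : ∀ i, ContinuousOn (T i) (Icc a b)) {F : (ℝ → Vn n) → ℂ} {v v' : ℝ → Vn n}
    (hv : SolvesOnInterval μ₀ T x a b ua ub F v) (hv' : SolvesOnInterval μ₀ T x a b ua ub F v') :
    EqOn v v' (Icc a b) := by
  have hsub : Icc a b ⊆ Ioo (a - 1) (b + 1) := Icc_subset_Ioo (by linarith) (by linarith)
  have hw := weakEq_sub h (hv.cont.mono Ioo_subset_Icc_self) (hv'.cont.mono Ioo_subset_Icc_self)
    hv.eqn hv'.eqn
  simp only [sub_self] at hw
  have hcont : ContinuousOn (fun z => v z - v' z) (Icc a b) := hv.cont.sub hv'.cont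
  obtain ⟨η, hη⟩ := h.exists_isSol_of_weakEq hab (hcont.mono Ioo_subset_Icc_self) hw
  obtain ⟨w, ζ, hwsol, hwe, -⟩ := h.exists_extension hab hc hη
  have hwe' : EqOn (fun z => v z - v' z) w (Icc a b) :=
    hwe.of_subset_closure hcont (hwsol.continuousOn.mono hsub) Ioo_subset_Icc_self
      (closure_Ioo hab.ne).ge
  have ma := left_mem_Icc.2 hab.le
  have mb := right_mem_Icc.2 hab.le
  have h0 := (h.regular_clampData hab hc μ₀ x (a - 1) (b + 1)).eq_zero_of_dirichlet hwsol
    (hsub ma) (hsub mb) hab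
    (by rw [← hwe' ma]; simp only [hv.left_value, hv'.left_value, sub_self])
    (by rw [← hwe' mb]; simp only [hv.right_value, hv'.right_value, sub_self])
  intro z hz
  exact sub_eq_zero.1 ((hwe' hz).trans (h0 z (hsub hz)).1)

end Interval

section Circle

variable {k j : ℕ} {μ₀ μ₁ : ℝ} {N : NahmData k j} {x : Fin 4 → ℝ}

/-- The glued system of a solution of Nahm's equations on the circle. -/
def gluedNahm (μ₀ μ₁ : ℝ) (N : NahmData k j) (x : Fin 4 → ℝ) : GluedSystem k (k + j) where
  YL := nahmSystem μ₀ N.TL x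
  YS := nahmSystem μ₀ (clampData N.TS μ₁ (μ₀ - μ₁)) x
  ιp := N.ιp
  ιm := N.ιm
  a := -μ₁
  b := μ₁
  c := μ₁
  d := μ₀ - μ₁

/-- The phase `exp (-i μ₀ x₀ z)` absorbs the scalar part of `P`, and `Sᵢ v = 0` says that `v` is an
eigenvector of `Tᵢ` with eigenvalue `i xᵢ`. -/
theorem IsInvariantParallel.of_gauge {n : ℕ} {T : Fin 4 → ℝ → Mn n} {a b : ℝ} {v : ℝ → Vn n}
    (hv : ContinuousOn v (Icc a b))
    (h : ∀ z ∈ Ioo a b, HasDerivAt v (-(nahmSystem μ₀ T x).P z (v z)) z ∧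
      ∀ i, (nahmSystem μ₀ T x).S i z (v z) = 0) :
    IsInvariantParallel T a b
      fun z => Complex.exp (((-(μ₀ * x 0 * z) : ℝ) : ℂ) * Complex.I) • v z := by
  set θ : ℝ := μ₀ * x 0 with hθ
  set ex : ℝ → ℂ := fun z => Complex.exp (((-(θ * z) : ℝ) : ℂ) * Complex.I) with hex
  have hexc : Continuous ex := by fun_prop
  have hexd : ∀ z, HasDerivAt ex (-(Complex.I * (θ : ℂ)) * ex z) z := fun z => by
    have h1 : HasDerivAt (fun z : ℝ => ((-(θ * z) : ℝ) : ℂ) * Complex.I)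
        (((-θ : ℝ) : ℂ) * Complex.I) z := by
      have h2 : HasDerivAt (fun z : ℝ => -(θ * z)) (-θ) z := by
        exact (((hasDerivAt_id z).const_mul θ).neg).congr_deriv (by rw [mul_one])
      exact h2.ofReal_comp.mul_const _
    refine h1.cexp.congr_deriv ?_
    rw [hex]
    push_cast
    ring
  refine ⟨hexc.continuousOn.smul hv, fun z hz => ?_, fun i z hz => ?_⟩
  · refine ((hexd z).smul (h z hz).1).congr_deriv ?_
    change ex z • (-(T 0 z (v z) - (Complex.I * (θ : ℂ)) • v z)) + (-(Complex.I * (θ : ℂ)) * ex z) • v z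
      = -(T 0 z (ex z • v z))
    rw [map_smul]
    module
  · refine ⟨Complex.I * ((x i.succ : ℝ) : ℂ), ?_⟩
    have h1 : T i.succ z (v z) - (Complex.I * ((x i.succ : ℝ) : ℂ)) • v z = 0 := (h z hz).2 i
    rw [map_smul, sub_eq_zero.1 h1, smul_comm]

theorem IsNahmSolution.admissible (hj : 0 < j) (hμ₁ : 0 < μ₁) (hμ : μ₁ < μ₀ - μ₁)
    (hN : IsNahmSolution μ₀ μ₁ N) (hirr : IsIrreducibleNahm μ₀ μ₁ N) (x : Fin 4 → ℝ) :
    (gluedNahm μ₀ μ₁ N x).Admissible := by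
  have hab : -μ₁ < μ₁ := by linarith
  refine ⟨hab, hμ, hN.large.regular μ₀ x,
    hN.small.regular_clampData hμ hN.small_limits μ₀ x _ _, ?_, ?_, ?_⟩
  · refine hN.bc_plus.singularEnd hj (nhdsWithin_mono _ fun z hz => ne_of_lt hz) ?_ μ₀ x
    filter_upwards [Ioo_mem_nhdsLT hab] with z hz i using hN.large.skew i z hz
  · refine hN.bc_minus.singularEnd hj (nhdsWithin_mono _ fun z hz => ne_of_gt hz) ?_ μ₀ x
    filter_upwards [Ioo_mem_nhdsGT hab] with z hz i using hN.large.skew i z hz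
  · intro vL vS hL hS hSc hlp hlm
    have hLc : ContinuousOn vL (Ioo (-μ₁) μ₁) := fun z hz =>
      (hL z hz).1.continuousAt.continuousWithinAt
    set wL : ℝ → Vn (k + j) := extendFrom (Ioo (-μ₁) μ₁) vL with hwL
    have hwe : EqOn wL vL (Ioo (-μ₁) μ₁) := fun z hz => extendFrom_extends hLc z hz
    have hwp : wL μ₁ = N.ιp (vS μ₁) := eq_lim_at_right_extendFrom_Ioo hab hlp
    have hwm : wL (-μ₁) = N.ιm (vS (μ₀ - μ₁)) := eq_lim_at_left_extendFrom_Ioo hab hlm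
    have pL := IsInvariantParallel.of_gauge (μ₀ := μ₀) (x := x) (T := N.TL) (v := wL)
      (continuousOn_Icc_extendFrom_Ioo hLc hlm hlp) fun z hz => by
        rw [hwe hz]
        exact ⟨(hL z hz).1.congr_of_eventuallyEq
          (eventually_of_mem (isOpen_Ioo.mem_nhds hz) hwe), (hL z hz).2⟩
    have pS := IsInvariantParallel.of_gauge (μ₀ := μ₀) (x := x) (T := N.TS) (v := vS) hSc
      fun z hz => by
        have h1 := fun i => clampData_eq (T := N.TS) (Ioo_subset_Icc_self hz) i
        refine ⟨?_, fun i => ?_⟩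
        · rw [← nahmSystem_P_eq (h1 0)]; exact (hS z hz).1
        · rw [← nahmSystem_S_eq (h1 i.succ)]; exact (hS z hz).2 i
    -- The gauge phase is not periodic: `μ₀ - μ₁` and `-μ₁` differ by `μ₀`, so the section closes up
    -- with holonomy `exp (i μ₀ x₀ μ₀)`. This is why irreducibility must allow a phase.
    obtain ⟨zL, zS⟩ := hirr (Complex.exp (((μ₀ * x 0 * μ₀ : ℝ) : ℂ) * Complex.I)) _ _
      (Complex.norm_exp_ofReal_mul_I _) pL pS
      (by
        rw [hwp, map_smul])
      (by
        rw [hwm, map_smul, smul_smul, ← Complex.exp_add]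
        congr 2
        push_cast
        ring)
    constructor
    · intro z hz
      have h1 := (smul_eq_zero.1 (zL z (Ioo_subset_Icc_self hz))).resolve_left (Complex.exp_ne_zero _)
      rwa [hwe hz] at h1
    · intro z hz
      exact (smul_eq_zero.1 (zS z (Ioo_subset_Icc_self hz))).resolve_left (Complex.exp_ne_zero _)

variable {p q : ℝ} {uL : Vn (k + j)} {uS : Vn k} {vL : ℝ → Vn (k + j)} {vS : ℝ → Vn k}

/-- Solutions on the circle in the sense of distributions are piecewise classical solutions. -/
theorem SolvesOnCircle.exists_transmission (hμ : μ₁ < μ₀ - μ₁) (hN : IsNahmSolution μ₀ μ₁ N)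
    (hp : p ∈ Ioo (-μ₁) μ₁) (hq : q ∈ Ioo μ₁ (μ₀ - μ₁))
    (h : SolvesOnCircle μ₀ μ₁ N x (diracAt p uL) (diracAt q uS) vL vS) :
    ∃ X, (gluedNahm μ₀ μ₁ N x).IsTransmission p q uL uS 0 0 X ∧
      (gluedNahm μ₀ μ₁ N x).IsSection p q X vL vS := by
  have hab : -μ₁ < μ₁ := hp.1.trans hp.2
  have hsub : Icc μ₁ (μ₀ - μ₁) ⊆ Ioo (μ₁ - 1) (μ₀ - μ₁ + 1) :=
    Icc_subset_Ioo (by linarith) (by linarith)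
  obtain ⟨L₁, ηL₁, L₂, ηL₂, gL⟩ := hN.large.exists_isGreen_of_weakEq hp
    (h.contL.mono Ioo_subset_Icc_self) h.eqL
  obtain ⟨S₁, ηS₁, S₂, ηS₂, gS⟩ := hN.small.exists_isGreen_of_weakEq hq
    (h.contS.mono Ioo_subset_Icc_self) h.eqS
  -- The pieces on the small side are continued past the ends, so that limits there become values.
  obtain ⟨S₁', ηS₁', s₁, e₁, e₁'⟩ := hN.small.exists_extension hμ hN.small_limits gS.left
  obtain ⟨S₂', ηS₂', s₂, e₂, e₂'⟩ := hN.small.exists_extension hμ hN.small_limits gS.right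
  have iS₁ : Icc μ₁ q ⊆ Icc μ₁ (μ₀ - μ₁) := Icc_subset_Icc_right hq.2.le
  have iS₂ : Icc q (μ₀ - μ₁) ⊆ Icc μ₁ (μ₀ - μ₁) := Icc_subset_Icc_left hq.1.le
  have oS₁ : Ioo μ₁ q ⊆ Ioo μ₁ (μ₀ - μ₁) := Ioo_subset_Ioo_right hq.2.le
  have oS₂ : Ioo q (μ₀ - μ₁) ⊆ Ioo μ₁ (μ₀ - μ₁) := Ioo_subset_Ioo_left hq.1.le
  have oL₁ : Ioo (-μ₁) p ⊆ Ioo (-μ₁) μ₁ := Ioo_subset_Ioo_right hp.2.le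
  have oL₂ : Ioo p μ₁ ⊆ Ioo (-μ₁) μ₁ := Ioo_subset_Ioo_left hp.1.le
  have E₁ : EqOn vS S₁' (Icc μ₁ q) :=
    EqOn.of_subset_closure (fun z hz => (gS.eq_left z (oS₁ hz) hz.2.le).trans (e₁ (oS₁ hz)))
      (h.contS.mono iS₁) (s₁.continuousOn.mono (iS₁.trans hsub)) Ioo_subset_Icc_self
      (closure_Ioo hq.1.ne).ge
  have E₂ : EqOn vS S₂' (Icc q (μ₀ - μ₁)) :=
    EqOn.of_subset_closure (fun z hz => (gS.eq_right z (oS₂ hz) hz.1.le).trans (e₂ (oS₂ hz)))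
      (h.contS.mono iS₂) (s₂.continuousOn.mono (iS₂.trans hsub)) Ioo_subset_Icc_self
      (closure_Ioo hq.2.ne).ge
  obtain ⟨dp, hdp, hdp'⟩ := h.dglue_plus
  obtain ⟨dm, hdm, hdm'⟩ := h.dglue_minus
  set r : ℂ := Complex.I * ((μ₀ * x 0 : ℝ) : ℂ) with hr
  have mc : μ₁ ∈ Icc μ₁ (μ₀ - μ₁) := left_mem_Icc.2 hμ.le
  have md : μ₀ - μ₁ ∈ Icc μ₁ (μ₀ - μ₁) := right_mem_Icc.2 hμ.le
  have vb : Tendsto vL (𝓝[<] μ₁) (𝓝 (N.ιp (vS μ₁))) := by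
    rw [← h.glue_plus, ← nhdsWithin_Ioo_eq_nhdsLT hab]
    exact (h.contL μ₁ (right_mem_Icc.2 hab.le)).mono_left (nhdsWithin_mono _ Ioo_subset_Icc_self)
  have va : Tendsto vL (𝓝[>] (-μ₁)) (𝓝 (N.ιm (vS (μ₀ - μ₁)))) := by
    rw [← h.glue_minus, ← nhdsWithin_Ioo_eq_nhdsGT hab]
    exact (h.contL (-μ₁) (left_mem_Icc.2 hab.le)).mono_left
      (nhdsWithin_mono _ Ioo_subset_Icc_self)
  have vc : Tendsto vS (𝓝[>] μ₁) (𝓝 (vS μ₁)) := by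
    rw [← nhdsWithin_Ioo_eq_nhdsGT hμ]
    exact (h.contS μ₁ mc).mono_left (nhdsWithin_mono _ Ioo_subset_Icc_self)
  have vd : Tendsto vS (𝓝[<] (μ₀ - μ₁)) (𝓝 (vS (μ₀ - μ₁))) := by
    rw [← nhdsWithin_Ioo_eq_nhdsLT hμ]
    exact (h.contS (μ₀ - μ₁) md).mono_left (nhdsWithin_mono _ Ioo_subset_Icc_self)
  have lb : Tendsto ηL₂ (𝓝[<] μ₁) (𝓝 (dp - r • N.ιp (vS μ₁))) := by
    refine (hdp.sub (vb.const_smul r)).congr' ?_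
    filter_upwards [Ioo_mem_nhdsLT hp.2] with z hz
    rw [covDeriv_eq (gL.right.mono oL₂) (fun w hw => gL.eq_right w (oL₂ hw) hw.1.le) hz]
    exact add_sub_cancel_right _ _
  have la : Tendsto ηL₁ (𝓝[>] (-μ₁)) (𝓝 (dm - r • N.ιm (vS (μ₀ - μ₁)))) := by
    refine (hdm.sub (va.const_smul r)).congr' ?_
    filter_upwards [Ioo_mem_nhdsGT hp.1] with z hz
    rw [covDeriv_eq (gL.left.mono oL₁) (fun w hw => gL.eq_left w (oL₁ hw) hw.2.le) hz]
    exact add_sub_cancel_right _ _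
  have lc : ηS₁' μ₁ = surj N.ιp dp - r • vS μ₁ := by
    have h1 : Tendsto ηS₁' (𝓝[>] μ₁) (𝓝 (ηS₁' μ₁)) :=
      (s₁.continuousOn'.continuousAt (isOpen_Ioo.mem_nhds (hsub mc))).mono_left nhdsWithin_le_nhds
    refine tendsto_nhds_unique h1 ((hdp'.sub (vc.const_smul r)).congr' ?_)
    filter_upwards [Ioo_mem_nhdsGT hq.1] with z hz
    rw [covDeriv_eq (gS.left.mono oS₁) (fun w hw => gS.eq_left w (oS₁ hw) hw.2.le) hz,
      e₁' (oS₁ hz)]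
    exact add_sub_cancel_right _ _
  have ld : ηS₂' (μ₀ - μ₁) = surj N.ιm dm - r • vS (μ₀ - μ₁) := by
    have h1 : Tendsto ηS₂' (𝓝[<] (μ₀ - μ₁)) (𝓝 (ηS₂' (μ₀ - μ₁))) :=
      (s₂.continuousOn'.continuousAt (isOpen_Ioo.mem_nhds (hsub md))).mono_left nhdsWithin_le_nhds
    refine tendsto_nhds_unique h1 ((hdm'.sub (vd.const_smul r)).congr' ?_)
    filter_upwards [Ioo_mem_nhdsLT hq.2] with z hz
    rw [covDeriv_eq (gS.right.mono oS₂) (fun w hw => gS.eq_right w (oS₂ hw) hw.1.le) hz,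
      e₂' (oS₂ hz)]
    exact add_sub_cancel_right _ _
  have Ec : vS μ₁ = S₁' μ₁ := E₁ (left_mem_Icc.2 hq.1.le)
  have Ed : vS (μ₀ - μ₁) = S₂' (μ₀ - μ₁) := E₂ (right_mem_Icc.2 hq.2.le)
  refine ⟨⟨L₁, ηL₁, L₂, ηL₂, S₁', ηS₁', S₂', ηS₂', dp - r • N.ιp (vS μ₁),
    dm - r • N.ιm (vS (μ₀ - μ₁))⟩, ?_, ?_⟩
  · exact
      { solL₁ := gL.left
        solL₂ := gL.right
        solS₁ := s₁
        solS₂ := s₂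
        valL := gL.val
        jumpL := gL.jump
        valS := (e₁ hq).symm.trans (gS.val.trans (e₂ hq))
        jumpS := by
          change ηS₁' q - ηS₂' q = uS
          rw [← e₁' hq, ← e₂' hq]; exact gS.jump
        limp := by
          change Tendsto L₂ (𝓝[<] μ₁) (𝓝 (N.ιp (S₁' μ₁)))
          rw [← Ec]
          refine vb.congr' ?_
          filter_upwards [Ioo_mem_nhdsLT hp.2] with z hz using gL.eq_right z (oL₂ hz) hz.1.le
        limp' := lb
        limm := by
          change Tendsto L₁ (𝓝[>] (-μ₁)) (𝓝 (N.ιm (S₂' (μ₀ - μ₁))))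
          rw [← Ed]
          refine va.congr' ?_
          filter_upwards [Ioo_mem_nhdsGT hp.1] with z hz using gL.eq_left z (oL₁ hz) hz.2.le
        limm' := la
        jumpp := by
          change surj N.ιp (dp - r • N.ιp (vS μ₁)) - ηS₁' μ₁ = 0
          rw [lc, map_sub, map_smul, surj_inj, sub_self]
        jumpm := by
          change ηS₂' (μ₀ - μ₁) - surj N.ιm (dm - r • N.ιm (vS (μ₀ - μ₁))) = 0
          rw [ld, map_sub, map_smul, surj_inj, sub_self] }
  · exact ⟨h.contL, h.contS, gL.eq_left, gL.eq_right, fun z hz h1 => E₁ ⟨hz.1, h1⟩,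
      fun z hz h1 => E₂ ⟨h1, hz.2⟩⟩

/-- Piecewise classical solutions are solutions on the circle in the sense of distributions. -/
theorem GluedSystem.IsTransmission.solvesOnCircle
    (hC : (gluedNahm μ₀ μ₁ N x).Admissible) (hN : IsNahmSolution μ₀ μ₁ N)
    (hp : p ∈ Ioo (-μ₁) μ₁) (hq : q ∈ Ioo μ₁ (μ₀ - μ₁)) {X : GluedSystem.Pieces k (k + j)}
    (hX : (gluedNahm μ₀ μ₁ N x).IsTransmission p q uL uS 0 0 X)
    (hv : (gluedNahm μ₀ μ₁ N x).IsSection p q X vL vS) :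
    SolvesOnCircle μ₀ μ₁ N x (diracAt p uL) (diracAt q uS) vL vS := by
  have hab : -μ₁ < μ₁ := hp.1.trans hp.2
  have hμ : μ₁ < μ₀ - μ₁ := hq.1.trans hq.2
  have hsub : Icc μ₁ (μ₀ - μ₁) ⊆ Ioo (μ₁ - 1) (μ₀ - μ₁ + 1) :=
    Icc_subset_Ioo (by linarith) (by linarith)
  have gp : vL μ₁ = N.ιp (vS μ₁) := hv.glue_plus hC hp hq hX
  have gm : vL (-μ₁) = N.ιm (vS (μ₀ - μ₁)) := hv.glue_minus hC hp hq hX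
  have hcongr : ∀ {v η : ℝ → Vn k}, (nahmSystem μ₀ (clampData N.TS μ₁ (μ₀ - μ₁)) x).IsSol
      (Ioo (μ₁ - 1) (μ₀ - μ₁ + 1)) v η → (nahmSystem μ₀ N.TS x).IsSol (Ioo μ₁ (μ₀ - μ₁)) v η :=
    fun hv => isSol_nahmSystem_congr (fun z hz i => clampData_eq (Ioo_subset_Icc_self hz) i)
      (hv.mono (Ioo_subset_Icc_self.trans hsub))
  have oS₁ : Ioo μ₁ q ⊆ Ioo μ₁ (μ₀ - μ₁) := Ioo_subset_Ioo_right hq.2.le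
  have oS₂ : Ioo q (μ₀ - μ₁) ⊆ Ioo μ₁ (μ₀ - μ₁) := Ioo_subset_Ioo_left hq.1.le
  have oL₁ : Ioo (-μ₁) p ⊆ Ioo (-μ₁) μ₁ := Ioo_subset_Ioo_right hp.2.le
  have oL₂ : Ioo p μ₁ ⊆ Ioo (-μ₁) μ₁ := Ioo_subset_Ioo_left hp.1.le
  have t₁ := hcongr hX.solS₁
  have t₂ := hcongr hX.solS₂
  set r : ℂ := Complex.I * ((μ₀ * x 0 : ℝ) : ℂ) with hr
  have mc : μ₁ ∈ Icc μ₁ (μ₀ - μ₁) := left_mem_Icc.2 hμ.le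
  have md : μ₀ - μ₁ ∈ Icc μ₁ (μ₀ - μ₁) := right_mem_Icc.2 hμ.le
  have vb : Tendsto vL (𝓝[<] μ₁) (𝓝 (N.ιp (vS μ₁))) := by
    rw [← gp, ← nhdsWithin_Ioo_eq_nhdsLT hab]
    exact (hv.contL μ₁ (right_mem_Icc.2 hab.le)).mono_left (nhdsWithin_mono _ Ioo_subset_Icc_self)
  have va : Tendsto vL (𝓝[>] (-μ₁)) (𝓝 (N.ιm (vS (μ₀ - μ₁)))) := by
    rw [← gm, ← nhdsWithin_Ioo_eq_nhdsGT hab]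
    exact (hv.contL (-μ₁) (left_mem_Icc.2 hab.le)).mono_left
      (nhdsWithin_mono _ Ioo_subset_Icc_self)
  have vc : Tendsto vS (𝓝[>] μ₁) (𝓝 (vS μ₁)) := by
    rw [← nhdsWithin_Ioo_eq_nhdsGT hμ]
    exact (hv.contS μ₁ mc).mono_left (nhdsWithin_mono _ Ioo_subset_Icc_self)
  have vd : Tendsto vS (𝓝[<] (μ₀ - μ₁)) (𝓝 (vS (μ₀ - μ₁))) := by
    rw [← nhdsWithin_Ioo_eq_nhdsLT hμ]
    exact (hv.contS (μ₀ - μ₁) md).mono_left (nhdsWithin_mono _ Ioo_subset_Icc_self)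
  have hc : Tendsto X.ηS₁ (𝓝[>] μ₁) (𝓝 (X.ηS₁ μ₁)) :=
    (hX.solS₁.continuousOn'.continuousAt (isOpen_Ioo.mem_nhds (hsub mc))).mono_left
      nhdsWithin_le_nhds
  have hd : Tendsto X.ηS₂ (𝓝[<] (μ₀ - μ₁)) (𝓝 (X.ηS₂ (μ₀ - μ₁))) :=
    (hX.solS₂.continuousOn'.continuousAt (isOpen_Ioo.mem_nhds (hsub md))).mono_left
      nhdsWithin_le_nhds
  have jp : surj N.ιp X.dp = X.ηS₁ μ₁ := sub_eq_zero.1 hX.jumpp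
  have jm : X.ηS₂ (μ₀ - μ₁) = surj N.ιm X.dm := sub_eq_zero.1 hX.jumpm
  refine ⟨hv.contL, hv.contS, gp, gm, ⟨X.dp + r • N.ιp (vS μ₁), ?_, ?_⟩,
    ⟨X.dm + r • N.ιm (vS (μ₀ - μ₁)), ?_, ?_⟩, ?_, ?_⟩
  · refine (hX.limp'.add (vb.const_smul r)).congr' ?_
    filter_upwards [Ioo_mem_nhdsLT hp.2] with z hz
    exact (covDeriv_eq (hX.solL₂.mono oL₂) (fun w hw => hv.eqL₂ w (oL₂ hw) hw.1.le) hz).symm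
  · rw [map_add, map_smul, surj_inj, jp]
    refine (hc.add (vc.const_smul r)).congr' ?_
    filter_upwards [Ioo_mem_nhdsGT hq.1] with z hz
    exact (covDeriv_eq (t₁.mono oS₁)
      (fun w hw => hv.eqS₁ w (Ioo_subset_Icc_self (oS₁ hw)) hw.2.le) hz).symm
  · refine (hX.limm'.add (va.const_smul r)).congr' ?_
    filter_upwards [Ioo_mem_nhdsGT hp.1] with z hz
    exact (covDeriv_eq (hX.solL₁.mono oL₁) (fun w hw => hv.eqL₁ w (oL₁ hw) hw.2.le) hz).symm
  · rw [map_add, map_smul, surj_inj, ← jm]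
    refine (hd.add (vd.const_smul r)).congr' ?_
    filter_upwards [Ioo_mem_nhdsLT hq.2] with z hz
    exact (covDeriv_eq (t₂.mono oS₂)
      (fun w hw => hv.eqS₂ w (Ioo_subset_Icc_self (oS₂ hw)) hw.1.le) hz).symm
  · exact hN.large.weakEq_of_isGreen hp
      ⟨hX.solL₁, hX.solL₂, hX.valL, hX.jumpL, hv.eqL₁, hv.eqL₂⟩
  · exact hN.small.weakEq_of_isGreen hq
      ⟨t₁, t₂, hX.valS, hX.jumpS, fun z hz h1 => hv.eqS₁ z (Ioo_subset_Icc_self hz) h1,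
        fun z hz h1 => hv.eqS₂ z (Ioo_subset_Icc_self hz) h1⟩

theorem exists_solvesOnCircle (hC : (gluedNahm μ₀ μ₁ N x).Admissible)
    (hN : IsNahmSolution μ₀ μ₁ N) (hp : p ∈ Ioo (-μ₁) μ₁) (hq : q ∈ Ioo μ₁ (μ₀ - μ₁))
    (uL : Vn (k + j)) (uS : Vn k) :
    ∃ vL vS, SolvesOnCircle μ₀ μ₁ N x (diracAt p uL) (diracAt q uS) vL vS := by
  obtain ⟨X, hX⟩ := hC.exists_transmission hp hq uL uS
  obtain ⟨vL, vS, hv⟩ := hC.exists_isSection hp hX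
  exact ⟨vL, vS, hX.solvesOnCircle hC hN hp hq hv⟩

theorem SolvesOnCircle.eqOn (hC : (gluedNahm μ₀ μ₁ N x).Admissible)
    (hN : IsNahmSolution μ₀ μ₁ N) (hp : p ∈ Ioo (-μ₁) μ₁) (hq : q ∈ Ioo μ₁ (μ₀ - μ₁))
    {vL' : ℝ → Vn (k + j)} {vS' : ℝ → Vn k}
    (h : SolvesOnCircle μ₀ μ₁ N x (diracAt p uL) (diracAt q uS) vL vS)
    (h' : SolvesOnCircle μ₀ μ₁ N x (diracAt p uL) (diracAt q uS) vL' vS') :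
    EqOn vL vL' (Icc (-μ₁) μ₁) ∧ EqOn vS vS' (Icc μ₁ (μ₀ - μ₁)) := by
  have hab : -μ₁ < μ₁ := hp.1.trans hp.2
  have hμ : μ₁ < μ₀ - μ₁ := hq.1.trans hq.2
  obtain ⟨X, hX, hv⟩ := h.exists_transmission hμ hN hp hq
  obtain ⟨X', hX', hv'⟩ := h'.exists_transmission hμ hN hp hq
  have hs := hX.sub hX'
  simp only [sub_self] at hs
  obtain ⟨zL, zS, -, -⟩ := hC.eq_zero hp hq hs
  constructor
  · refine EqOn.of_subset_closure (s := Ioo (-μ₁) μ₁) (fun z hz => ?_) h.contL h'.contL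
      Ioo_subset_Icc_self (closure_Ioo hab.ne).ge
    obtain ⟨h1, -, h2, -⟩ := zL z hz
    rcases le_total z p with h3 | h3
    · rw [hv.eqL₁ z hz h3, hv'.eqL₁ z hz h3]; exact sub_eq_zero.1 h1
    · rw [hv.eqL₂ z hz h3, hv'.eqL₂ z hz h3]; exact sub_eq_zero.1 h2
  · intro z hz
    obtain ⟨h1, -, h2, -⟩ := zS z (hC.Icc_subset hz)
    rcases le_total z q with h3 | h3
    · rw [hv.eqS₁ z hz h3, hv'.eqS₁ z hz h3]; exact sub_eq_zero.1 h1
    · rw [hv.eqS₂ z hz h3, hv'.eqS₂ z hz h3]; exact sub_eq_zero.1 h2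

end Circle

end

/-! ### The theorem on Green's functions. -/

theorem mainTheorem10 {k j : ℕ} (hk : 0 < k) (hj : 0 < j) (μ₀ μ₁ : ℝ) (hμ₁ : 0 < μ₁)
    (hμ : μ₁ < μ₀ - μ₁) (N : NahmData k j) (hN : IsNahmSolution μ₀ μ₁ N)
    (hirr : IsIrreducibleNahm μ₀ μ₁ N) (x : Fin 4 → ℝ) :
    -- Green's function on the circle, pole on the large side
    (∀ p ∈ Ioo (-μ₁) μ₁, ∀ u : Vn (k + j),
      (∃ vL vS, SolvesOnCircle μ₀ μ₁ N x (diracAt p u) zeroDistr vL vS) ∧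
      ∀ vL vS vL' vS', SolvesOnCircle μ₀ μ₁ N x (diracAt p u) zeroDistr vL vS →
        SolvesOnCircle μ₀ μ₁ N x (diracAt p u) zeroDistr vL' vS' →
        EqOn vL vL' (Icc (-μ₁) μ₁) ∧ EqOn vS vS' (Icc μ₁ (μ₀ - μ₁))) ∧
    -- Green's function on the circle, pole on the small side
    (∀ p ∈ Ioo μ₁ (μ₀ - μ₁), ∀ u : Vn k,
      (∃ vL vS, SolvesOnCircle μ₀ μ₁ N x zeroDistr (diracAt p u) vL vS) ∧
      ∀ vL vS vL' vS', SolvesOnCircle μ₀ μ₁ N x zeroDistr (diracAt p u) vL vS →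
        SolvesOnCircle μ₀ μ₁ N x zeroDistr (diracAt p u) vL' vS' →
        EqOn vL vL' (Icc (-μ₁) μ₁) ∧ EqOn vS vS' (Icc μ₁ (μ₀ - μ₁))) ∧
    -- prescribed boundary values on the small interval
    (∀ p ∈ Ioo μ₁ (μ₀ - μ₁), ∀ u uplus uminus : Vn k,
      (∃ v, SolvesOnInterval μ₀ N.TS x μ₁ (μ₀ - μ₁) uplus uminus (diracAt p u) v) ∧
      ∀ v v', SolvesOnInterval μ₀ N.TS x μ₁ (μ₀ - μ₁) uplus uminus (diracAt p u) v →
        SolvesOnInterval μ₀ N.TS x μ₁ (μ₀ - μ₁) uplus uminus (diracAt p u) v' →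
        EqOn v v' (Icc μ₁ (μ₀ - μ₁))) ∧
    -- the bound by a constant that does not depend on the pole `p` or on `u`
    (∃ C : ℝ,
      (∀ p ∈ Ioo (-μ₁) μ₁, ∀ u : Vn (k + j), ∀ vL vS,
        SolvesOnCircle μ₀ μ₁ N x (diracAt p u) zeroDistr vL vS →
        (∀ z ∈ Icc (-μ₁) μ₁, ‖vL z‖ ≤ C * ‖u‖) ∧
        (∀ z ∈ Icc μ₁ (μ₀ - μ₁), ‖vS z‖ ≤ C * ‖u‖)) ∧
      (∀ p ∈ Ioo μ₁ (μ₀ - μ₁), ∀ u : Vn k, ∀ vL vS,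
        SolvesOnCircle μ₀ μ₁ N x zeroDistr (diracAt p u) vL vS →
        (∀ z ∈ Icc (-μ₁) μ₁, ‖vL z‖ ≤ C * ‖u‖) ∧
        (∀ z ∈ Icc μ₁ (μ₀ - μ₁), ‖vS z‖ ≤ C * ‖u‖))) := by
  have hC := hN.admissible hj hμ₁ hμ hirr x
  have hab : -μ₁ < μ₁ := by linarith
  -- Fixed dummy poles of strength zero for the side that carries no delta distribution.
  obtain ⟨p₀, hp₀⟩ := exists_between hab
  obtain ⟨q₀, hq₀⟩ := exists_between hμ
  refine ⟨fun p hp u => ?_, fun p hp u => ?_, fun p hp u uplus uminus =>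
    ⟨hN.small.exists_solvesOnInterval hN.small_limits hp u uplus uminus, fun v v' hv hv' =>
      hN.small.solvesOnInterval_unique hμ hN.small_limits hv hv'⟩, ?_⟩
  · rw [zeroDistr_eq_diracAt q₀]
    exact ⟨exists_solvesOnCircle hC hN hp hq₀ u 0, fun vL vS vL' vS' h h' =>
      h.eqOn hC hN hp hq₀ h'⟩
  · rw [zeroDistr_eq_diracAt p₀]
    exact ⟨exists_solvesOnCircle hC hN hp₀ hp 0 u, fun vL vS vL' vS' h h' =>
      h.eqOn hC hN hp₀ hp h'⟩
  · obtain ⟨M, hM⟩ := hC.exists_bound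
    refine ⟨M, fun p hp u vL vS h => ?_, fun p hp u vL vS h => ?_⟩
    · rw [zeroDistr_eq_diracAt q₀] at h
      obtain ⟨X, hX, hv⟩ := h.exists_transmission hμ hN hp hq₀
      have h1 := hM p hp q₀ hq₀ u 0 X vL vS hX hv
      rwa [norm_zero, add_zero] at h1
    · rw [zeroDistr_eq_diracAt p₀] at h
      obtain ⟨X, hX, hv⟩ := h.exists_transmission hμ hN hp₀ hp
      have h1 := hM p₀ hp₀ p hp 0 u X vL vS hX hv
      rwa [norm_zero, zero_add] at h1
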